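/- Let $K$ be an algebraically closed field of characteristic zero, $\theta\in K$ a primitive cube root of unity, and $$A=K[x,y,z]/(\theta x^3+\theta^2y^3+z^3)$$ with its standard grading. Let $B=K[s,t]$ be standard graded, and let $R=\bigoplus_{n\ge 0}A_n\otimes_K B_n\subset A\otimes_K B$ be the Segre product, graded by $R_n=A_n\otimes_K B_n$; let $\mathfrak m$ and $\mathfrak m_A$ be the ideals generated by the elements of positive degree of $R$ and $A$. For a domain $S$ let $S^+$ be the integral closure of $S$ in an algebraic closure of its fraction field. If $S$ is $\mathbb N$-graded, an element $a\in S^+$ has degree $\varepsilon\in\mathbb Q$ if $a^N+c_1a^{N-1}+\cdots+c_N=0$ for some homogeneous $c_i\in S$ of degree $i\varepsilon$ (with $c_i=0$ if $i\varepsilon\notin\mathbb N$). Local cohomology is computed by the Čech complex: on $x,y$ for $\mathfrak m_A$, and on $sx,\,ty,\,sy+tx$ for $\mathfrak m$. Then: 1. $A$ is a domain; $R$ is a normal domain of dimension $3$; $\mathfrak m$ is a maximal ideal, and it is the radical of the ideal generated by the degree one elements $sx,\,ty,\,sy+tx$, which thus form a homogeneous system of parameters for $R$. 2. $H^2_{\mathfrak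 m}(R)$ is a one-dimensional $K$-vector space spanned by the class $\eta\neq 0$ of the relation $(sz)(tz)(sy+tx)=(sz)^2(ty)+(tz)^2(sx)$. 3. For each $\zeta\in K$ with $\zeta^3=\theta$ there is a finite injective $K$-algebra homomorphism $\varphi\colon A\to A$ with $\varphi(A_m)\subseteq A_{3m}$ for all $m$ and $$x^3=\zeta\varphi(x)+\zeta^2\varphi(y),\quad y^3=\zeta\varphi(x)+\zeta^5\varphi(y),\quad z^3=\zeta\varphi(x)+\zeta^8\varphi(y),\quad \varphi(z)=-xyz,$$ such that the following hold. (a) For every $n\ge 0$, every element of $\mathfrak m_A$ annihilates the image of the degree zero part $[H^2_{\mathfrak m_A}(A)]_0$ (the classes of $a/(xy)^k$ with $a\in A_{2k}$) under the map of second local cohomology induced by $\varphi^n\colon A\to A$. (b) There are injective ring homomorphisms $\rho_n\colon A\to A^+$, $n\ge 0$, such that $\rho_0$ is the inclusion, $\rho_{n+1}\circ\varphi=\rho_n$, $\rho_n(a)$ has degree $m/3^n$ for every $a\in A_m$, and, for every $n$, each element of $\rho_n(\mathfrak m_A)$ annihilates the image of $[H^2_{\mathfrak m_A}(A)]_0$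 in $H^2_{\mathfrak m_A}(A^+)$. So the rings $A_{(n)}=\rho_n(A)$ form a tower $A=A_{(0)}\subset A_{(1)}\subset A_{(2)}\subset\cdots$ in $A^+$ of copies of $A$. (c) There are injective ring homomorphisms $\rho_n\colon A\to R^+$, $n\ge 0$, such that $\rho_0(a)=a\otimes s^m\in R$ for $a\in A_m$, $\rho_{n+1}\circ\varphi=\rho_n$, $\rho_n(a)$ has degree $m/3^n$ for every $a\in A_m$, and, for every $n$, each element of $\rho_n(\mathfrak m_A)$ annihilates the image of $H^2_{\mathfrak m}(R)\to H^2_{\mathfrak m}(R^+)$. In particular, for every $n$ the nonzero elements $\rho_n(x),\rho_n(y),\rho_n(z)$ of $R^+$, of degree $1/3^n$, annihilate this image. -/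

import Mathlib

open scoped TensorProduct

universe u v w

noncomputable section

/-! ### The Čech complex and its cohomology -/

namespace Cech

variable {ι : Type*} [LinearOrder ι] {S : Type u} [CommRing S] {T : Type v} [CommRing T]

/-- For a ring homomorphism `g : S → T` and `a ∈ S`, `b ∈ T` with `g a ∣ b`, the ring homomorphism
`S_a → T_b` induced by `g`. -/
def awayLift (g : S →+* T) (a : S) (b : T) (h : g a ∣ b) :
    Localization.Away a →+* Localization.Away b :=
  IsLocalization.Away.lift (S := Localization.Away a) a
    (g := (algebraMap T (Localization.Away b)).comp g)
    (isUnit_of_dvd_unit (map_dvd (algebraMap T (Localization.Away b)) h)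
      (IsLocalization.Away.algebraMap_isUnit b))

theorem awayLift_algebraMap (g : S →+* T) (a : S) (b : T) (h : g a ∣ b) (r : S) :
    awayLift g a b h (algebraMap S _ r) = algebraMap T _ (g r) :=
  IsLocalization.Away.lift_eq _ _ _

/-- Čech cochains of degree `p`: one element of `S_{f_{i_1} ⋯ f_{i_p}}` for every
`i_1 < ⋯ < i_p`. -/
abbrev Cochain (f : ι → S) (p : ℕ) : Type _ :=
  ∀ s : Fin p ↪o ι, Localization.Away (∏ i, f (s i))

/-- The increasing sequence obtained from `s` by omitting its `k`-th entry. -/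
def face {p : ℕ} (s : Fin (p + 1) ↪o ι) (k : Fin (p + 1)) : Fin p ↪o ι :=
  (Fin.succAboveOrderEmb k).trans s

theorem face_dvd (f : ι → S) {p : ℕ} (s : Fin (p + 1) ↪o ι) (k : Fin (p + 1)) :
    RingHom.id S (∏ i, f (face s k i)) ∣ ∏ i, f (s i) := by
  rw [Fin.prod_univ_succAbove _ k]
  exact Dvd.intro_left _ rfl

/-- The Čech differential, `(d c)_s = ∑ₖ (-1)ᵏ c_{s without its k-th entry}`. -/
def d (f : ι → S) (p : ℕ) : Cochain f p →ₗ[S] Cochain f (p + 1) where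
  toFun c s := ∑ k : Fin (p + 1), (-1) ^ (k : ℕ) * awayLift (RingHom.id S) _ _ (face_dvd f s k) (c (face s k))
  map_add' c c' := by
    funext s
    simp only [Pi.add_apply, map_add, mul_add, Finset.sum_add_distrib]
  map_smul' r c := by
    funext s
    simp only [Pi.smul_apply, RingHom.id_apply, Algebra.smul_def, map_mul, Finset.mul_sum,
      awayLift_algebraMap]
    exact Finset.sum_congr rfl fun k _ => by ring

/-- The coboundaries of degree `p`. -/
def coboundaries (f : ι → S) : ∀ p : ℕ, Submodule S (Cochain f p)
  | 0 => ⊥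
  | p + 1 => LinearMap.range (d f p)

/-- The `p`-th cohomology module of the Čech complex of the sequence `f` in `S`; when `S` is an
algebra over a Noetherian ring and `f` comes from generators up to radical of an ideal `𝔪` of that
ring, this is the local cohomology module `H^p_𝔪(S)`. -/
def H (f : ι → S) (p : ℕ) : Type _ :=
  LinearMap.ker (d f p) ⧸ (coboundaries f p).submoduleOf (LinearMap.ker (d f p))

instance (f : ι → S) (p : ℕ) : AddCommGroup (H f p) :=
  inferInstanceAs (AddCommGroup
    (LinearMap.ker (d f p) ⧸ (coboundaries f p).submoduleOf (LinearMap.ker (d f p))))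

instance (f : ι → S) (p : ℕ) : Module S (H f p) :=
  inferInstanceAs (Module S
    (LinearMap.ker (d f p) ⧸ (coboundaries f p).submoduleOf (LinearMap.ker (d f p))))

/-- The cohomology class of a cocycle. -/
def toH (f : ι → S) (p : ℕ) : LinearMap.ker (d f p) →ₗ[S] H f p :=
  Submodule.mkQ ((coboundaries f p).submoduleOf (LinearMap.ker (d f p)))

/-- The map of cochains induced by a ring homomorphism. -/
def cochainMap (g : S →+* T) (f : ι → S) (p : ℕ) :
    Cochain f p →ₛₗ[g] Cochain (fun i => g (f i)) p where
  toFun c s := awayLift g _ _ (by rw [map_prod]) (c s)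
  map_add' c c' := by
    funext s
    simp only [Pi.add_apply, map_add]
  map_smul' r c := by
    funext s
    simp only [Pi.smul_apply, Algebra.smul_def, map_mul, awayLift_algebraMap]

theorem d_cochainMap (g : S →+* T) (f : ι → S) (p : ℕ) (c : Cochain f p) :
    d (fun i => g (f i)) p (cochainMap g f p c) = cochainMap g f (p + 1) (d f p c) := by
  funext s
  simp only [d, cochainMap, LinearMap.coe_mk, AddHom.coe_mk, map_sum, map_mul, map_pow, map_neg,
    map_one]
  refine Finset.sum_congr rfl fun k _ => ?_
  congr 1
  simp only [← RingHom.comp_apply]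
  congr 1
  refine IsLocalization.ringHom_ext (Submonoid.powers (∏ i, f (face s k i))) ?_
  ext r
  simp only [RingHom.comp_apply, awayLift_algebraMap, RingHom.id_apply]

/-- The map of Čech cohomology modules induced by a ring homomorphism `g : S → T`. -/
def map (g : S →+* T) (f : ι → S) (p : ℕ) : H f p →ₛₗ[g] H (fun i => g (f i)) p :=
  Submodule.mapQ _ _
    (((cochainMap g f p).domRestrict (LinearMap.ker (d f p))).codRestrict
      (LinearMap.ker (d (fun i => g (f i)) p)) (fun c => by
        rw [LinearMap.mem_ker, LinearMap.domRestrict_apply, d_cochainMap, LinearMap.mem_ker.1 c.2,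
          map_zero]))
    (by
      rintro ⟨c, hc⟩ h
      cases p with
      | zero =>
        have h0 : c = 0 := h
        subst h0
        exact Submodule.zero_mem _
      | succ p =>
        obtain ⟨b, hb⟩ := h
        exact ⟨cochainMap g f p b, by rw [d_cochainMap, hb]; rfl⟩)

/-- For a relation `∑ₖ rₖ fₖ = 0` on `f_0, …, f_n`, the `n`-cochain whose component at the sequence
omitting `k` is `(-1)ᵏ rₖ / ∏_{i ≠ k} f_i`. -/
def relationCochain {n : ℕ} (f r : Fin (n + 1) → S) : Cochain f n := fun s =>
  Localization.mk (∑ k, if Fin.succAboveOrderEmb k = s then (-1) ^ (k : ℕ) * r k else 0)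
    ⟨∏ i, f (s i), Submonoid.mem_powers _⟩

theorem d_relationCochain {n : ℕ} (f r : Fin (n + 1) → S) (h : ∑ k, r k * f k = 0) :
    d f n (relationCochain f r) = 0 := by
  funext s
  have hs : s = RelEmbedding.refl _ := by
    refine DFunLike.coe_injective ((StrictMono.range_inj s.strictMono strictMono_id).1 ?_)
    rw [(Finite.surjective_of_injective s.injective).range_eq, Set.range_id]
  subst hs
  have hface : ∀ j k : Fin (n + 1), Fin.succAboveOrderEmb j =
      face (RelEmbedding.refl (fun a b : Fin (n + 1) => a ≤ b)) k ↔ j = k := by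
    intro j k
    constructor
    · intro hjk
      refine Fin.succAbove_left_injective (funext fun i => ?_)
      exact DFunLike.congr_fun hjk i
    · rintro rfl
      rfl
  have hP := IsLocalization.Away.algebraMap_isUnit
    (S := Localization.Away (∏ i, f (RelEmbedding.refl (fun a b : Fin (n + 1) => a ≤ b) i)))
    (∏ i, f (RelEmbedding.refl (fun a b : Fin (n + 1) => a ≤ b) i))
  refine (hP.mul_right_eq_zero).1 ?_
  rw [← map_zero (algebraMap S _), ← h]
  simp only [d, LinearMap.coe_mk, AddHom.coe_mk, Finset.mul_sum, map_sum]
  refine Finset.sum_congr rfl fun k _ => ?_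
  have key : relationCochain f r (face (RelEmbedding.refl _) k) *
      algebraMap S _ (∏ i, f (face (RelEmbedding.refl (fun a b : Fin (n + 1) => a ≤ b)) k i)) =
      algebraMap S _ ((-1) ^ (k : ℕ) * r k) := by
    simp only [relationCochain, hface, Finset.sum_ite_eq', Finset.mem_univ, if_true]
    rw [Localization.mk_eq_mk']
    exact IsLocalization.mk'_spec _ _ _
  have key2 := congrArg (awayLift (RingHom.id S) _ _ (face_dvd f (RelEmbedding.refl _) k)) key
  rw [map_mul, awayLift_algebraMap, awayLift_algebraMap] at key2
  simp only [RingHom.id_apply] at key2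
  have hprod : ∏ i, f (RelEmbedding.refl (fun a b : Fin (n + 1) => a ≤ b) i) =
      f k * ∏ i, f (face (RelEmbedding.refl (fun a b : Fin (n + 1) => a ≤ b)) k i) :=
    Fin.prod_univ_succAbove _ k
  have hsq : ((-1 : Localization.Away
      (∏ i, f (RelEmbedding.refl (fun a b : Fin (n + 1) => a ≤ b) i))) ^ (k : ℕ)) *
      (-1) ^ (k : ℕ) = 1 := by
    rw [← mul_pow, neg_one_mul, neg_neg, one_pow]
  rw [congrArg (algebraMap S (Localization.Away _)) hprod, map_mul]
  simp only [map_mul, map_pow, map_neg, map_one] at key2 ⊢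
  linear_combination (algebraMap S _ (f k)) * (-1) ^ (k : ℕ) * key2 +
    (algebraMap S _ (f k)) * (algebraMap S _ (r k)) * hsq

/-- The class in the `n`-th Čech cohomology given by a relation `∑ₖ rₖ fₖ = 0` on
`f_0, …, f_n`. -/
def relationClass {n : ℕ} (f r : Fin (n + 1) → S) (h : ∑ k, r k * f k = 0) : H f n :=
  toH f n ⟨relationCochain f r, d_relationCochain f r h⟩

/-- The class of the fraction `a / (f_1 ⋯ f_n)ᵏ` in the top Čech cohomology `H^n` of
`f_1, …, f_n`. -/
def topClass {n : ℕ} (f : Fin n → S) (a : S) (k : ℕ) : H f n :=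
  toH f n
    ⟨fun s => Localization.mk a ⟨(∏ i, f (s i)) ^ k, k, rfl⟩, by
      rw [LinearMap.mem_ker]
      funext s
      exact absurd (Fintype.card_le_of_injective s s.injective) (by simp)⟩

end Cech

/-! ### Gradings, Segre products, degrees of integral elements -/

section Graded

variable {K : Type u} [Field K]

/-- The ideal generated by the elements of positive degree. -/
def positiveIdeal {S : Type v} [CommRing S] [Algebra K S] (𝒢 : ℕ → Submodule K S) : Ideal S :=
  Ideal.span {a | ∃ n, 0 < n ∧ a ∈ 𝒢 n}

/-- An element `a` of an extension `T` of the graded ring `S = ⊕ₙ 𝒢 n` has degree `ε` if it is a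
root of a monic polynomial `Xᴺ + c₁ Xᴺ⁻¹ + ⋯ + c_N` in which each `cᵢ` is homogeneous of degree
`i ε` (so `cᵢ = 0` if `i ε` is not a natural number). -/
def HasDegree {S : Type v} [CommRing S] [Algebra K S] (𝒢 : ℕ → Submodule K S)
    {T : Type w} [CommRing T] [Algebra S T] (a : T) (ε : ℚ) : Prop :=
  ∃ P : Polynomial S, P.Monic ∧ Polynomial.aeval a P = 0 ∧
    ∀ i j : ℕ, i + j = P.natDegree →
      P.coeff j = 0 ∨ ∃ m : ℕ, (m : ℚ) = i * ε ∧ P.coeff j ∈ 𝒢 m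

variable {A : Type v} [CommRing A] [Algebra K A] {B : Type w} [CommRing B] [Algebra K B]

/-- The image of `𝒜 n ⊗ ℬ n` in `A ⊗ B`. -/
def segrePiece (𝒜 : ℕ → Submodule K A) (ℬ : ℕ → Submodule K B) (n : ℕ) : Submodule K (A ⊗[K] B) :=
  Submodule.span K {c | ∃ a ∈ 𝒜 n, ∃ b ∈ ℬ n, c = a ⊗ₜ[K] b}

variable (𝒜 : ℕ → Submodule K A) (ℬ : ℕ → Submodule K B)
  [SetLike.GradedMonoid 𝒜] [SetLike.GradedMonoid ℬ]

/-- The Segre product `⊕ₙ 𝒜 n ⊗ ℬ n`, as a subalgebra of `A ⊗ B`. -/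
def segreProduct : Subalgebra K (A ⊗[K] B) :=
  (⨆ n, segrePiece 𝒜 ℬ n).toSubalgebra
    (Submodule.mem_iSup_of_mem 0 (Submodule.subset_span
      ⟨1, SetLike.GradedOne.one_mem, 1, SetLike.GradedOne.one_mem, Algebra.TensorProduct.one_def⟩))
    (by
      have key : (⨆ n, segrePiece 𝒜 ℬ n) * (⨆ n, segrePiece 𝒜 ℬ n) ≤ ⨆ n, segrePiece 𝒜 ℬ n := by
        rw [Submodule.iSup_mul]
        refine iSup_le fun m => ?_
        rw [Submodule.mul_iSup]
        refine iSup_le fun n => le_trans ?_ (le_iSup _ (m + n))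
        rw [segrePiece, segrePiece, Submodule.span_mul_span]
        refine Submodule.span_le.2 ?_
        rintro _ ⟨_, ⟨a, ha, b, hb, rfl⟩, _, ⟨a', ha', b', hb', rfl⟩, rfl⟩
        exact Submodule.subset_span ⟨a * a', SetLike.GradedMul.mul_mem ha ha', b * b',
          SetLike.GradedMul.mul_mem hb hb', Algebra.TensorProduct.tmul_mul_tmul _ _ _ _⟩
      exact fun x y hx hy => key (Submodule.mul_mem_mul hx hy))

/-- The grading of the Segre product. -/
def segreGrading (n : ℕ) : Submodule K (segreProduct 𝒜 ℬ) :=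
  (segrePiece 𝒜 ℬ n).comap (segreProduct 𝒜 ℬ).val.toLinearMap

variable {𝒜 ℬ}

/-- The element `a ⊗ b` of the Segre product, for `a` and `b` homogeneous of the same degree. -/
def segreMk {n : ℕ} {a : A} {b : B} (ha : a ∈ 𝒜 n) (hb : b ∈ ℬ n) : segreProduct 𝒜 ℬ :=
  ⟨a ⊗ₜ[K] b, Submodule.mem_iSup_of_mem n (Submodule.subset_span ⟨a, ha, b, hb, rfl⟩)⟩

end Graded

/-! ### The cubic cone and its Segre product with a polynomial ring in two variables -/

namespace Cubic

open MvPolynomial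

variable {K : Type u} [Field K]

/-- The ring `K[x,y,z]/(θx³ + θ²y³ + z³)`. -/
def A (θ : K) : Type u :=
  MvPolynomial (Fin 3) K ⧸
    Ideal.span {(C θ * X 0 ^ 3 + C θ ^ 2 * X 1 ^ 3 + X 2 ^ 3 : MvPolynomial (Fin 3) K)}

instance (θ : K) : CommRing (A θ) := inferInstanceAs (CommRing (_ ⧸ _))

instance (θ : K) : Algebra K (A θ) := inferInstanceAs (Algebra K (MvPolynomial (Fin 3) K ⧸ _))

/-- The quotient map `K[x,y,z] → K[x,y,z]/(θx³ + θ²y³ + z³)`. -/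
def toA (θ : K) : MvPolynomial (Fin 3) K →ₐ[K] A θ := Ideal.Quotient.mkₐ K _

/-- The classes `x`, `y`, `z` of the three variables. -/
def gen (θ : K) (i : Fin 3) : A θ := toA θ (X i)

/-- The standard grading of `K[x,y,z]/(θx³ + θ²y³ + z³)`. -/
def grA (θ : K) (n : ℕ) : Submodule K (A θ) :=
  (homogeneousSubmodule (Fin 3) K n).map (toA θ).toLinearMap

instance (θ : K) : SetLike.GradedMonoid (grA θ) where
  one_mem := ⟨1, isHomogeneous_one _ _, map_one (toA θ)⟩
  mul_mem := by
    rintro m n _ _ ⟨p, hp, rfl⟩ ⟨q, hq, rfl⟩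
    exact ⟨p * q, IsHomogeneous.mul hp hq, map_mul (toA θ) _ _⟩

theorem gen_mem (θ : K) (i : Fin 3) : gen θ i ∈ grA θ 1 := ⟨X i, isHomogeneous_X K i, rfl⟩

variable (K) in
/-- The standard grading of `K[s,t]`. -/
abbrev grB : ℕ → Submodule K (MvPolynomial (Fin 2) K) := homogeneousSubmodule (Fin 2) K

theorem var_mem (j : Fin 2) : (X j : MvPolynomial (Fin 2) K) ∈ grB K 1 := isHomogeneous_X K j

theorem s_pow_mem (m : ℕ) : (X 0 ^ m : MvPolynomial (Fin 2) K) ∈ grB K m := isHomogeneous_X_pow 0 m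

/-- The Segre product of `K[x,y,z]/(θx³ + θ²y³ + z³)` and `K[s,t]`. -/
def R (θ : K) : Type u := segreProduct (grA θ) (grB K)

instance (θ : K) : CommRing (R θ) := inferInstanceAs (CommRing (segreProduct (grA θ) (grB K)))

instance (θ : K) : Algebra K (R θ) := inferInstanceAs (Algebra K (segreProduct (grA θ) (grB K)))

/-- The inclusion of the Segre product in the tensor product. -/
def inclR (θ : K) : R θ →ₐ[K] A θ ⊗[K] MvPolynomial (Fin 2) K :=
  (segreProduct (grA θ) (grB K)).val

theorem inclR_injective (θ : K) : Function.Injective (inclR θ) := Subtype.val_injective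

/-- The grading of the Segre product. -/
def grR (θ : K) : ℕ → Submodule K (R θ) := segreGrading (grA θ) (grB K)

/-- The element `a ⊗ b` of the Segre product, for `a` and `b` homogeneous of the same degree. -/
def tens {θ : K} {n : ℕ} {a : A θ} {b : MvPolynomial (Fin 2) K} (ha : a ∈ grA θ n)
    (hb : b ∈ grB K n) : R θ :=
  segreMk ha hb

theorem inclR_tens {θ : K} {n : ℕ} {a : A θ} {b : MvPolynomial (Fin 2) K} (ha : a ∈ grA θ n)
    (hb : b ∈ grB K n) : inclR θ (tens ha hb) = a ⊗ₜ[K] b :=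
  rfl

/-- The degree one generators of the Segre product: `mon θ i j` is the product of the `i`-th of
`x, y, z` and the `j`-th of `s, t`. -/
def mon (θ : K) (i : Fin 3) (j : Fin 2) : R θ := tens (gen_mem θ i) (var_mem j)

/-- The sequence `sx`, `ty`, `sy + tx`. -/
def params (θ : K) : Fin 3 → R θ := ![mon θ 0 0, mon θ 1 1, mon θ 1 0 + mon θ 0 1]

/-- The coefficients `-(tz)²`, `-(sz)²`, `(sz)(tz)` of the relation
`(sz)(tz)(sy + tx) = (sz)²(ty) + (tz)²(sx)` on `sx`, `ty`, `sy + tx`. -/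
def relCoeff (θ : K) : Fin 3 → R θ := ![-(mon θ 2 1) ^ 2, -(mon θ 2 0) ^ 2, mon θ 2 0 * mon θ 2 1]

theorem relation (θ : K) : ∑ k, relCoeff θ k * params θ k = 0 := by
  refine inclR_injective θ ?_
  simp only [Fin.sum_univ_three, relCoeff, params, mon, Matrix.cons_val_zero, Matrix.cons_val_one,
    Matrix.cons_val, map_add, map_mul, map_neg, map_pow, map_zero, inclR_tens, mul_add, neg_mul,
    Algebra.TensorProduct.tmul_pow, Algebra.TensorProduct.tmul_mul_tmul]
  have h1 : (gen θ 2 * gen θ 2 * gen θ 1) ⊗ₜ[K] (X 0 * X 1 * X 0 : MvPolynomial (Fin 2) K) =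
      (gen θ 2 ^ 2 * gen θ 1) ⊗ₜ[K] (X 0 ^ 2 * X 1) := by congr 1 <;> ring
  have h2 : (gen θ 2 * gen θ 2 * gen θ 0) ⊗ₜ[K] (X 0 * X 1 * X 1 : MvPolynomial (Fin 2) K) =
      (gen θ 2 ^ 2 * gen θ 0) ⊗ₜ[K] (X 1 ^ 2 * X 0) := by congr 1 <;> ring
  rw [h1, h2]
  abel

/-- The elements `x`, `y` of `A`. -/
def xy (θ : K) : Fin 2 → A θ := ![gen θ 0, gen θ 1]

/-- A sequence `ρ` of embeddings of `A = K[x,y,z]/(θx³ + θ²y³ + z³)` into an extension `T` of a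
graded ring `S` that realizes the tower of self-embeddings `φ : A → A` inside `T`, with
the elements of degree `d` of the `n`-th copy of `A` having degree `d / 3ⁿ` over `S`. -/
structure IsTower {θ : K} (φ : A θ →ₐ[K] A θ) {S : Type v} [CommRing S] [Algebra K S]
    (𝒢 : ℕ → Submodule K S) {T : Type w} [CommRing T] [Algebra S T] (ρ : ℕ → A θ →+* T) :
    Prop where
  injective : ∀ n, Function.Injective (ρ n)
  comp : ∀ n, (ρ (n + 1)).comp φ.toRingHom = ρ n
  degree : ∀ n m, ∀ a ∈ grA θ m, HasDegree 𝒢 (ρ n a) (m / 3 ^ n)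

end Cubic

end

/-! Structure of `A` and `R`. Over `K[x,y]` the ring `A` is the cyclic cubic extension by a cube
root `z` of `g = -θx³ - θ²y³`. In characteristic zero `g` is squarefree, so `g` is not a cube and
`A` is a domain. If `α` is integral over `A`, averaging over the automorphism `z ↦ θz` splits `α`
into integral eigencomponents `pᵢzⁱ/p`; their cubes give `p³ ∣ pᵢ³gⁱ`, hence `p ∣ pᵢ`, so `A` is
normal. `A ⊗ K[s,t]` is then a normal domain, and `R` is the subring where left degree equals right
degree, an equalizer of two homomorphisms (`mem_segreProduct_iff`). It is closed under division, so
it is normal too.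

Cohomology of `R`. Put `u = sx`, `v = ty`, `w = sy + tx` and `P = K[u,v,w]`. As a `P`-module `R` is
generated by `1, sy, sz, tz, (sz)², (sz)(tz), (tz)²` (`modComb_surjective`), and the syzygies are
the multiples of `v(sz)² - w(sz)(tz) + u(tz)² = 0` (`syzygy_of_modComb_eq_zero`). So `R` is free of
rank four plus the cokernel of `(v, -w, u) : P → P³`. The free part has no second cohomology, and
the cokernel has as second cohomology the socle of `H³(P)`, which is a line. The proof does this
with elements: a 2-cocycle is a relation on `(l+1)`-st powers of the parameters; lifted to `P` it
becomes a multiple `q` of the syzygy, with `q` in the socle of `P/(u^(l+1), v^(l+1), w^(l+1))`. That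
socle is spanned by `(uvw)^l`, which is the contribution of `η`.

The self-embedding. Solving the first two equations for `φ(x), φ(y)` makes the third one equivalent
to the cubic relation, and the product of the three linear forms in `φ(x), φ(y)` is `θφ(x)³ +
θ²φ(y)³`; so `φ(z) = -xyz` is consistent. Thus `φ` triples degrees, and it is finite because the
cubes of the generators lie in its image.

Annihilation over `A`. For `a` of degree `2k` and `u` of positive degree, `u φⁿ(a)` has degree above
`2k·3ⁿ`, so it lies in `(x,y)^(2k·3ⁿ - 1)`. This ideal is contained in `(φⁿ(x)ᵏ, φⁿ(y)ᵏ)` by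
induction on `n` (`IsCubing.xyIdeal_pow_le`), since `(x,y)^(3m+2) ⊆ (x³,y³)ᵐ`. Hence the class of `u
φⁿ(a)` vanishes. Extending embeddings along `φ` into an algebraically closed field transports this
to the absolute integral closure.

Annihilation over `R`. For `a = z²` the identity reads `u·(sz)² = α·sx + β·sy` in `R⁺`, with `α, β`
of degree at least one. Elements of such degree can be multiplied by `t/s` inside `R⁺`
(`IsTower.exists_mul_eq`). Multiplying the identity by `t/s` once and twice expresses all three
coefficients of `u·η` through one Koszul relation, so `u·η` dies. -/

noncomputable section

/-! ### Fractions as Čech cochains -/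

namespace Cech

variable {ι : Type*} [LinearOrder ι] {S : Type u} [CommRing S] {T : Type v} [CommRing T]

/-- The cochain with components `e_s / (∏ f_{s i})ᵏ`. -/
def fracCochain (f : ι → S) {p : ℕ} (e : (Fin p ↪o ι) → S) (k : ℕ) : Cochain f p :=
  fun s => Localization.mk (e s) ⟨(∏ i, f (s i)) ^ k, k, rfl⟩

theorem fracCochain_mul (f : ι → S) {p : ℕ} (e : (Fin p ↪o ι) → S) (k : ℕ) (s : Fin p ↪o ι) :
    fracCochain f e k s * algebraMap S _ ((∏ i, f (s i)) ^ k) = algebraMap S _ (e s) := by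
  rw [fracCochain, Localization.mk_eq_mk']
  exact IsLocalization.mk'_spec _ _ _

theorem eq_fracCochain (f : ι → S) {p : ℕ} (c : Cochain f p) (e : (Fin p ↪o ι) → S) (k : ℕ)
    (h : ∀ s, c s * algebraMap S _ ((∏ i, f (s i)) ^ k) = algebraMap S _ (e s)) :
    c = fracCochain f e k := by
  funext s
  have hu : IsUnit (algebraMap S (Localization.Away (∏ i, f (s i))) ((∏ i, f (s i)) ^ k)) := by
    rw [map_pow]
    exact (IsLocalization.Away.algebraMap_isUnit _).pow k
  exact hu.mul_left_injective ((h s).trans (fracCochain_mul f e k s).symm)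

theorem exists_eq_fracCochain (f : ι → S) {p : ℕ} [Finite (Fin p ↪o ι)] (c : Cochain f p) :
    ∃ (k : ℕ) (e : (Fin p ↪o ι) → S), c = fracCochain f e k := by
  have h : ∀ s, ∃ (n : ℕ) (a : S), c s * algebraMap S _ ((∏ i, f (s i)) ^ n) = algebraMap S _ a := by
    intro s
    obtain ⟨n, a, h⟩ := IsLocalization.Away.surj (∏ i, f (s i)) (c s)
    exact ⟨n, a, by rw [map_pow, h]⟩
  choose n a h using h
  obtain ⟨k, hk⟩ := (Set.finite_range n).bddAbove
  refine ⟨k, fun s => a s * (∏ i, f (s i)) ^ (k - n s), eq_fracCochain _ _ _ _ fun s => ?_⟩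
  have hks : k = n s + (k - n s) := by have := hk ⟨s, rfl⟩; omega
  conv_lhs => rw [hks]
  rw [pow_add, map_mul, ← mul_assoc, h, map_mul]

theorem d_fracCochain (f : ι → S) {p : ℕ} (e : (Fin p ↪o ι) → S) (k : ℕ) :
    d f p (fracCochain f e k) = fracCochain f
      (fun s => ∑ j : Fin (p + 1), (-1) ^ (j : ℕ) * (e (face s j) * f (s j) ^ k)) k := by
  refine eq_fracCochain _ _ _ _ fun s => ?_
  simp only [d, LinearMap.coe_mk, AddHom.coe_mk, Finset.sum_mul, map_sum]
  refine Finset.sum_congr rfl fun j _ => ?_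
  have key := congrArg (awayLift (RingHom.id S) _ _ (face_dvd f s j))
    (fracCochain_mul f e k (face s j))
  rw [map_mul, awayLift_algebraMap, awayLift_algebraMap] at key
  simp only [RingHom.id_apply] at key
  have hprod : ∏ i, f (s i) = f (s j) * ∏ i, f (face s j i) := Fin.prod_univ_succAbove _ j
  rw [congrArg (fun x => algebraMap S (Localization.Away (∏ i, f (s i))) (x ^ k)) hprod, mul_pow]
  simp only [map_mul, map_pow, map_neg, map_one] at key ⊢
  linear_combination (-1) ^ (j : ℕ) * algebraMap S _ (f (s j)) ^ k * key

theorem smul_fracCochain (f : ι → S) {p : ℕ} (e : (Fin p ↪o ι) → S) (k : ℕ) (r : S) :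
    r • fracCochain f e k = fracCochain f (fun s => r * e s) k := by
  refine eq_fracCochain _ _ _ _ fun s => ?_
  rw [Pi.smul_apply, Algebra.smul_def, mul_assoc, fracCochain_mul, map_mul]

theorem sub_fracCochain (f : ι → S) {p : ℕ} (e e' : (Fin p ↪o ι) → S) (k : ℕ) :
    fracCochain f e k - fracCochain f e' k = fracCochain f (fun s => e s - e' s) k := by
  refine eq_fracCochain _ _ _ _ fun s => ?_
  rw [Pi.sub_apply, sub_mul, fracCochain_mul, fracCochain_mul, map_sub]

theorem fracCochain_add (f : ι → S) {p : ℕ} (e : (Fin p ↪o ι) → S) (k l : ℕ) :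
    fracCochain f e k = fracCochain f (fun s => e s * (∏ i, f (s i)) ^ l) (k + l) := by
  refine eq_fracCochain _ _ _ _ fun s => ?_
  rw [pow_add, map_mul, ← mul_assoc, fracCochain_mul, map_mul]

theorem cochainMap_fracCochain (g : S →+* T) (f : ι → S) {p : ℕ} (e : (Fin p ↪o ι) → S) (k : ℕ) :
    cochainMap g f p (fracCochain f e k) = fracCochain (fun i => g (f i)) (fun s => g (e s)) k := by
  refine eq_fracCochain _ _ _ _ fun s => ?_
  have key := congrArg (awayLift g (∏ i, f (s i)) (∏ i, g (f (s i))) (by rw [map_prod]))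
    (fracCochain_mul f e k s)
  rw [map_mul, awayLift_algebraMap, awayLift_algebraMap] at key
  have hp : g ((∏ i, f (s i)) ^ k) = (∏ i, g (f (s i))) ^ k := by rw [map_pow, map_prod]
  rw [← hp]
  exact key

theorem fracCochain_injective [IsDomain S] (f : ι → S) (hf : ∀ i, f i ≠ 0) {p : ℕ}
    {e e' : (Fin p ↪o ι) → S} {k : ℕ} (h : fracCochain f e k = fracCochain f e' k) : e = e' := by
  funext s
  have hs : ∏ i, f (s i) ≠ 0 := Finset.prod_ne_zero_iff.2 fun i _ => hf _
  have hinj : Function.Injective (algebraMap S (Localization.Away (∏ i, f (s i)))) :=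
    IsLocalization.injective _ (powers_le_nonZeroDivisors_of_noZeroDivisors hs)
  refine hinj ?_
  rw [← fracCochain_mul f e k s, h, fracCochain_mul]

theorem relationCochain_eq {n : ℕ} (f r : Fin (n + 1) → S) :
    relationCochain f r = fracCochain f
      (fun s => ∑ k, if Fin.succAboveOrderEmb k = s then (-1) ^ (k : ℕ) * r k else 0) 1 := by
  refine eq_fracCochain _ _ _ _ fun s => ?_
  rw [relationCochain, Localization.mk_eq_mk', pow_one]
  exact IsLocalization.mk'_spec _ _ _

theorem toH_eq_zero_iff (f : ι → S) (p : ℕ) (c : LinearMap.ker (d f p)) :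
    toH f p c = 0 ↔ (c : Cochain f p) ∈ coboundaries f p :=
  Submodule.Quotient.mk_eq_zero _

theorem toH_surjective (f : ι → S) (p : ℕ) : Function.Surjective (toH f p) :=
  Submodule.mkQ_surjective _

theorem map_toH (g : S →+* T) (f : ι → S) (p : ℕ) (c : LinearMap.ker (d f p)) :
    map g f p (toH f p c) = toH _ p ⟨cochainMap g f p c, by
      rw [LinearMap.mem_ker, d_cochainMap, LinearMap.mem_ker.1 c.2, map_zero]⟩ :=
  rfl

theorem topClass_eq {n : ℕ} (f : Fin n → S) (a : S) (k : ℕ)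
    (h : fracCochain f (fun _ => a) k ∈ LinearMap.ker (d f n)) :
    topClass f a k = toH f n ⟨fracCochain f (fun _ => a) k, h⟩ :=
  rfl

theorem fracCochain_mem_ker {n : ℕ} (f : Fin n → S) (c : Cochain f n) :
    c ∈ LinearMap.ker (d f n) := by
  rw [LinearMap.mem_ker]
  funext s
  exact absurd (Fintype.card_le_of_injective s s.injective) (by simp)

/-! ### Sequences of length two -/

/-- Dividing the hypothesis by the `k`-th power of the product of the two elements gives `e₀/g(f 1)ᵏ
+ e₁/g(f 0)ᵏ`. This is the coboundary of the 1-cochain with components `-e₁/g(f 0)ᵏ` and `e₀/g(f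
1)ᵏ`, the sign coming from `d`. -/
theorem smul_map_topClass_eq_zero (g : S →+* T) (f : Fin 2 → S) (a : S) (k : ℕ) (u e₀ e₁ : T)
    (h : u * g a = e₀ * g (f 0) ^ k + e₁ * g (f 1) ^ k) :
    u • map g f 2 (topClass f a k) = 0 := by
  rw [topClass_eq f a k (fracCochain_mem_ker f _), map_toH, ← map_smul, toH_eq_zero_iff]
  refine ⟨fracCochain _ (fun s => if s 0 = 0 then -e₁ else e₀) k, ?_⟩
  rw [d_fracCochain]
  change _ = u • cochainMap g f 2 (fracCochain f _ k)
  rw [cochainMap_fracCochain, smul_fracCochain]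
  congr 1
  funext s
  have hs : s = RelEmbedding.refl _ := by
    refine DFunLike.coe_injective ((StrictMono.range_inj s.strictMono strictMono_id).1 ?_)
    rw [(Finite.surjective_of_injective s.injective).range_eq, Set.range_id]
  subst hs
  refine (Fin.sum_univ_two _).trans ?_
  have h0 : face (RelEmbedding.refl (fun a b : Fin 2 => a ≤ b)) 0 0 ≠ 0 := one_ne_zero
  have h1 : face (RelEmbedding.refl (fun a b : Fin 2 => a ≤ b)) 1 0 = 0 := rfl
  rw [if_neg h0, if_pos h1]
  change (-1) ^ 0 * (e₀ * g (f 0) ^ k) + (-1) ^ 1 * (-e₁ * g (f 1) ^ k) = u * g a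
  linear_combination -h

/-! ### Sequences of length three -/

theorem exists_succAboveOrderEmb_eq {n : ℕ} (s : Fin n ↪o Fin (n + 1)) :
    ∃ k, Fin.succAboveOrderEmb k = s := by
  obtain ⟨k, hk⟩ : ∃ k, k ∉ Set.range s := by
    by_contra! h
    have := Fintype.card_le_of_surjective s h
    simp at this
  refine ⟨k, DFunLike.coe_injective
    ((StrictMono.range_inj (Fin.strictMono_succAbove k) s.strictMono).1 ?_)⟩
  rw [Fin.range_succAbove]
  symm
  refine Set.eq_of_subset_of_ncard_le (fun x hx => ?_) ?_ (Set.toFinite _)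
  · rintro rfl
    exact hk hx
  · rw [Set.ncard_compl, Set.ncard_singleton, ← Set.image_univ,
      Set.ncard_image_of_injective _ s.injective, Set.ncard_univ]
    simp

theorem succAboveOrderEmb_inj {n : ℕ} {j k : Fin (n + 1)} :
    Fin.succAboveOrderEmb j = Fin.succAboveOrderEmb k ↔ j = k :=
  ⟨fun h => Fin.succAbove_left_injective (congrArg DFunLike.coe h), fun h => h ▸ rfl⟩

/-- The fractional `n`-cochain whose component at the sequence omitting `k` is
`(-1)ᵏ rₖ / ∏_{i ≠ k} f_iᵐ`. -/
def relCochain {n : ℕ} (f r : Fin (n + 1) → S) (m : ℕ) : Cochain f n :=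
  fracCochain f (fun s => ∑ k, if Fin.succAboveOrderEmb k = s then (-1) ^ (k : ℕ) * r k else 0) m

theorem exists_eq_relCochain {n : ℕ} (f : Fin (n + 1) → S) (c : Cochain f n) :
    ∃ (m : ℕ) (r : Fin (n + 1) → S), c = relCochain f r m := by
  have : Finite (Fin n ↪o Fin (n + 1)) := Finite.of_surjective _ exists_succAboveOrderEmb_eq
  obtain ⟨m, e, rfl⟩ := exists_eq_fracCochain f c
  refine ⟨m, fun k => (-1) ^ (k : ℕ) * e (Fin.succAboveOrderEmb k), ?_⟩
  rw [relCochain]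
  congr 1
  funext s
  obtain ⟨k, rfl⟩ := exists_succAboveOrderEmb_eq s
  simp only [succAboveOrderEmb_inj, Finset.sum_ite_eq', Finset.mem_univ, if_true]
  rw [← mul_assoc, ← mul_pow, neg_one_mul, neg_neg, one_pow, one_mul]

theorem sub_relCochain {n : ℕ} (f r r' : Fin (n + 1) → S) (m : ℕ) :
    relCochain f r m - relCochain f r' m = relCochain f (fun k => r k - r' k) m := by
  rw [relCochain, relCochain, sub_fracCochain, relCochain]
  congr 1
  funext s
  rw [← Finset.sum_sub_distrib]
  refine Finset.sum_congr rfl fun k _ => ?_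
  split_ifs <;> ring

theorem smul_relCochain {n : ℕ} (f r : Fin (n + 1) → S) (m : ℕ) (u : S) :
    u • relCochain f r m = relCochain f (fun k => u * r k) m := by
  rw [relCochain, smul_fracCochain, relCochain]
  congr 1
  funext s
  rw [Finset.mul_sum]
  refine Finset.sum_congr rfl fun k _ => ?_
  split_ifs <;> ring

theorem cochainMap_relCochain (g : S →+* T) {n : ℕ} (f r : Fin (n + 1) → S) (m : ℕ) :
    cochainMap g f n (relCochain f r m) =
      relCochain (fun i => g (f i)) (fun k => g (r k)) m := by
  rw [relCochain, cochainMap_fracCochain, relCochain]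
  congr 1
  funext s
  rw [map_sum]
  refine Finset.sum_congr rfl fun k _ => ?_
  split_ifs <;> simp

theorem relationCochain_eq_relCochain {n : ℕ} (f r : Fin (n + 1) → S) :
    relationCochain f r = relCochain f r 1 :=
  relationCochain_eq f r

theorem relCochain_injective [IsDomain S] {n : ℕ} {f : Fin (n + 1) → S} (hf : ∀ i, f i ≠ 0)
    {r r' : Fin (n + 1) → S} {m : ℕ} (h : relCochain f r m = relCochain f r' m) : r = r' := by
  funext k
  have := congrFun (fracCochain_injective f hf h) (Fin.succAboveOrderEmb k)
  simp only [succAboveOrderEmb_inj, Finset.sum_ite_eq', Finset.mem_univ, if_true] at this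
  have h2 : ((-1 : S) ^ (k : ℕ)) * (-1) ^ (k : ℕ) = 1 := by
    rw [← mul_pow, neg_one_mul, neg_neg, one_pow]
  linear_combination (-1) ^ (k : ℕ) * this - (r k - r' k) * h2

/-- A domain embeds in its localizations at nonzero elements, so the cocycle condition can be
cleared of denominators exactly, with no extra power of the `f k`. The signs in `relCochain` cancel
those of `d`. -/
theorem sum_of_d_relCochain_eq_zero [IsDomain S] {n : ℕ} {f : Fin (n + 1) → S}
    (hf : ∀ i, f i ≠ 0) {r : Fin (n + 1) → S} {m : ℕ} (h : d f n (relCochain f r m) = 0) :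
    ∑ k, r k * f k ^ m = 0 := by
  rw [relCochain, d_fracCochain] at h
  have h0 : (0 : Cochain f (n + 1)) = fracCochain f (fun _ => 0) m :=
    eq_fracCochain _ _ _ _ fun s => by simp
  rw [h0] at h
  rw [← congrFun (fracCochain_injective f hf h) (RelEmbedding.refl _)]
  refine Finset.sum_congr rfl fun k _ => ?_
  have hface : ∀ j, (Fin.succAboveOrderEmb j =
      face (RelEmbedding.refl (fun a b : Fin (n + 1) => a ≤ b)) k) ↔ j = k := fun j =>
    succAboveOrderEmb_inj (j := j) (k := k)
  simp only [hface, Finset.sum_ite_eq', Finset.mem_univ, if_true]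
  have h2 : ((-1 : S) ^ (k : ℕ)) * (-1) ^ (k : ℕ) = 1 := by
    rw [← mul_pow, neg_one_mul, neg_neg, one_pow]
  change _ = (-1) ^ (k : ℕ) * ((-1) ^ (k : ℕ) * r k * f k ^ m)
  linear_combination -(r k * f k ^ m) * h2

/-- The Koszul relations on the `m`-th powers of a sequence of length three. -/
def koszul (f e : Fin 3 → S) (m : ℕ) : Fin 3 → S :=
  ![e 2 * f 1 ^ m - e 1 * f 2 ^ m, e 0 * f 2 ^ m - e 2 * f 0 ^ m, e 1 * f 0 ^ m - e 0 * f 1 ^ m]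

/-- Bringing `e j / (f j)ᵐ - e i / (f i)ᵐ` to a common denominator produces the Koszul numerators;
the orientation chosen in `koszul` absorbs the signs of `relCochain`. -/
theorem d_fracCochain_one (f e : Fin 3 → S) (m : ℕ) :
    d f 1 (fracCochain f (fun s => e (s 0)) m) = relCochain f (koszul f e m) m := by
  rw [d_fracCochain, relCochain]
  congr 1
  funext s
  obtain ⟨k, rfl⟩ := exists_succAboveOrderEmb_eq s
  simp only [succAboveOrderEmb_inj, Finset.sum_ite_eq', Finset.mem_univ, if_true]
  refine (Fin.sum_univ_two _).trans ?_
  change (-1) ^ 0 * (e (k.succAbove 1) * f (k.succAbove 0) ^ m) +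
    (-1) ^ 1 * (e (k.succAbove 0) * f (k.succAbove 1) ^ m) = _
  fin_cases k
  · change (-1) ^ 0 * (e 2 * f 1 ^ m) + (-1) ^ 1 * (e 1 * f 2 ^ m) =
      (-1) ^ 0 * (e 2 * f 1 ^ m - e 1 * f 2 ^ m)
    ring
  · change (-1) ^ 0 * (e 2 * f 0 ^ m) + (-1) ^ 1 * (e 0 * f 2 ^ m) =
      (-1) ^ 1 * (e 0 * f 2 ^ m - e 2 * f 0 ^ m)
    ring
  · change (-1) ^ 0 * (e 1 * f 0 ^ m) + (-1) ^ 1 * (e 0 * f 1 ^ m) =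
      (-1) ^ 2 * (e 1 * f 0 ^ m - e 0 * f 1 ^ m)
    ring

theorem mem_coboundaries_two_iff (f : Fin 3 → S) (c : Cochain f 2) :
    c ∈ coboundaries f 2 ↔ ∃ (m : ℕ) (e : Fin 3 → S), c = relCochain f (koszul f e m) m := by
  constructor
  · rintro ⟨b, rfl⟩
    have hinj : Function.Injective (fun s : Fin 1 ↪o Fin 3 => s 0) := by
      intro s t h
      ext i
      rw [Subsingleton.elim i 0]
      exact congrArg Fin.val h
    have : Finite (Fin 1 ↪o Fin 3) := Finite.of_injective _ hinj
    obtain ⟨m, e, rfl⟩ := exists_eq_fracCochain f b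
    obtain ⟨e', he⟩ : ∃ e' : Fin 3 → S, ∀ s, e s = e' (s 0) :=
      ⟨Function.extend (fun s : Fin 1 ↪o Fin 3 => s 0) e 0, fun s => (hinj.extend_apply e 0 s).symm⟩
    refine ⟨m, e', ?_⟩
    rw [← d_fracCochain_one]
    congr 2
    funext s
    exact he s
  · rintro ⟨m, e, rfl⟩
    exact ⟨_, d_fracCochain_one f e m⟩

/-- The component omitting `k` has the other two elements in its denominator, so passing to the
exponent `m + l` multiplies its numerator by the `l`-th power of their product. -/
theorem relCochain_add (f r : Fin 3 → S) (m l : ℕ) :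
    relCochain f r m = relCochain f
      ![r 0 * (f 1 * f 2) ^ l, r 1 * (f 0 * f 2) ^ l, r 2 * (f 0 * f 1) ^ l] (m + l) := by
  rw [relCochain, fracCochain_add f _ m l, relCochain]
  congr 1
  funext s
  obtain ⟨k, rfl⟩ := exists_succAboveOrderEmb_eq s
  simp only [succAboveOrderEmb_inj, Finset.sum_ite_eq', Finset.mem_univ, if_true,
    Fin.prod_univ_two, Fin.succAboveOrderEmb_apply]
  rw [mul_assoc]
  congr 1
  fin_cases k <;> rfl

theorem exists_eq_toH_relCochain [IsDomain S] {f : Fin 3 → S} (hf : ∀ i, f i ≠ 0) (ξ : H f 2) :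
    ∃ (l : ℕ) (r : Fin 3 → S) (h : relCochain f r (l + 1) ∈ LinearMap.ker (d f 2)),
      ξ = toH f 2 ⟨relCochain f r (l + 1), h⟩ ∧ ∑ k, r k * f k ^ (l + 1) = 0 := by
  obtain ⟨⟨c, hc⟩, rfl⟩ := toH_surjective f 2 ξ
  obtain ⟨m, r, rfl⟩ := exists_eq_relCochain f c
  -- The exponent is raised by one so that it has the form `l + 1`, as the socle argument needs.
  have hm := relCochain_add f r m 1
  generalize relCochain f r m = c at hm hc
  subst hm
  exact ⟨m, _, hc, rfl, sum_of_d_relCochain_eq_zero hf hc⟩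

theorem smul_map_relationClass_eq_zero (g : S →+* T) (f r : Fin 3 → S)
    (h : ∑ k, r k * f k = 0) (u : T) (e : Fin 3 → T)
    (he : ∀ k, u * g (r k) = koszul (fun i => g (f i)) e 1 k) :
    u • map g f 2 (relationClass f r h) = 0 := by
  rw [relationClass, map_toH, ← map_smul, toH_eq_zero_iff]
  refine (mem_coboundaries_two_iff _ _).2 ⟨1, e, ?_⟩
  change u • cochainMap g f 2 (relationCochain f r) = _
  rw [relationCochain_eq_relCochain, cochainMap_relCochain, smul_relCochain]
  congr 1
  funext k
  exact he k

theorem exists_koszul_of_relationClass_eq_zero [IsDomain S] {f : Fin 3 → S} (hf : ∀ i, f i ≠ 0)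
    (r : Fin 3 → S) (h : ∑ k, r k * f k = 0) (h0 : relationClass f r h = 0) :
    ∃ (l : ℕ) (e : Fin 3 → S),
      ![r 0 * (f 1 * f 2) ^ l, r 1 * (f 0 * f 2) ^ l, r 2 * (f 0 * f 1) ^ l] =
        koszul f e (l + 1) := by
  rw [relationClass, toH_eq_zero_iff, mem_coboundaries_two_iff] at h0
  obtain ⟨m, e, h0⟩ := h0
  change relationCochain f r = _ at h0
  rw [relationCochain_eq_relCochain, relCochain_add f r 1 m, relCochain_add _ _ m 1,
    Nat.add_comm m 1] at h0
  -- Both cocycles are written with exponent `m + 1`; the 1-cochain `e i / (f i)ᵐ` becomes `e i f i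
  -- / (f i)^(m+1)`.
  refine ⟨m, ![e 0 * f 0, e 1 * f 1, e 2 * f 2], (relCochain_injective hf h0).trans ?_⟩
  funext k
  fin_cases k <;> simp [koszul] <;> ring

theorem toH_eq_smul_relationClass {f : Fin 3 → S} (r ρ : Fin 3 → S) (h : ∑ k, ρ k * f k = 0)
    (l : ℕ) (hr : relCochain f r (l + 1) ∈ LinearMap.ker (d f 2)) (c : S) (e : Fin 3 → S)
    (he : ∀ k, r k - c * (![ρ 0 * (f 1 * f 2) ^ l, ρ 1 * (f 0 * f 2) ^ l,
      ρ 2 * (f 0 * f 1) ^ l] : Fin 3 → S) k = koszul f e (l + 1) k) :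
    toH f 2 ⟨relCochain f r (l + 1), hr⟩ = c • relationClass f ρ h := by
  rw [← sub_eq_zero, relationClass, ← map_smul, ← map_sub, toH_eq_zero_iff,
    mem_coboundaries_two_iff]
  refine ⟨l + 1, e, ?_⟩
  change relCochain f r (l + 1) - c • relationCochain f ρ = _
  rw [relationCochain_eq_relCochain, relCochain_add f ρ 1 l, Nat.add_comm 1 l, smul_relCochain,
    sub_relCochain]
  congr 1
  funext k
  exact he k

end Cech
end

noncomputable section

/-! ### Krull dimension and integral extensions -/

section Dimension

theorem RingHom.IsIntegral.ringKrullDim_le {R S : Type*} [CommRing R] [CommRing S] {f : R →+* S}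
    (hf : f.IsIntegral) : ringKrullDim S ≤ ringKrullDim R := by
  algebraize [f]
  have : Algebra.IsIntegral R S := ⟨hf⟩
  exact Order.krullDim_le_of_strictMono (PrimeSpectrum.comap f) fun p q h =>
    Ideal.IsIntegral.comap_lt_comap (A := S) (R := R) h

/-- If a nonzero `a` were killed, `D` would be integral over the quotient by `a`, whose dimension is
at most `n - 1`. -/
theorem injective_of_isIntegral_of_le_ringKrullDim {K : Type*} [Field K] {n : ℕ} {D : Type*}
    [CommRing D] [IsDomain D] (f : MvPolynomial (Fin n) K →+* D) (hf : f.IsIntegral)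
    (hn : (n : WithBot ℕ∞) ≤ ringKrullDim D) : Function.Injective f := by
  rw [injective_iff_map_eq_zero]
  by_contra! h
  obtain ⟨a, ha, ha0⟩ := h
  have hle : ∀ x ∈ Ideal.span {a}, f x = 0 := by
    intro x hx
    obtain ⟨b, rfl⟩ := Ideal.mem_span_singleton.1 hx
    rw [map_mul, ha, zero_mul]
  have hint : (Ideal.Quotient.lift (Ideal.span {a}) f hle).IsIntegral :=
    RingHom.IsIntegral.tower_top (Ideal.Quotient.mk _) _
      (by rwa [Ideal.Quotient.lift_comp_mk])
  have h1 := ringKrullDim_quotient_succ_le_of_nonZeroDivisor (mem_nonZeroDivisors_of_ne_zero ha0)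
  have h2 := hn.trans hint.ringKrullDim_le
  have h3 : ringKrullDim (MvPolynomial (Fin n) K) = n := by simp
  rw [h3] at h1
  have h4 : (n : WithBot ℕ∞) + 1 ≤ n := (by gcongr : (n : WithBot ℕ∞) + 1 ≤ _).trans h1
  have h5 : ((n + 1 : ℕ) : WithBot ℕ∞) ≤ (n : ℕ) := by exact_mod_cast h4
  have := Nat.cast_le.1 h5
  omega

theorem le_ringKrullDim_of_strictMono {R : Type*} [CommRing R] {n : ℕ}
    (p : Fin (n + 1) → PrimeSpectrum R) (hp : StrictMono p) :
    (n : WithBot ℕ∞) ≤ ringKrullDim R :=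
  Order.LTSeries.length_le_krullDim (⟨n, p, fun i => hp i.castSucc_lt_succ⟩ : LTSeries (PrimeSpectrum R))

end Dimension

/-! ### Powers of the variables in a polynomial ring -/

namespace MvPolynomial

variable {K : Type u} [Field K] {σ : Type*}

theorem mem_span_X_pow_image {k : ℕ} {s : Set σ} {p : MvPolynomial σ K} :
    p ∈ Ideal.span ((fun i => (X i : MvPolynomial σ K) ^ k) '' s) ↔
      ∀ d ∈ p.support, ∃ i ∈ s, k ≤ d i := by
  have h : (fun i => (X i : MvPolynomial σ K) ^ k) '' s =
      (fun d => monomial d (1 : K)) '' ((fun i => Finsupp.single i k) '' s) := by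
    rw [Set.image_image]
    refine Set.image_congr fun i _ => ?_
    rw [X_pow_eq_monomial]
  rw [h, mem_ideal_span_monomial_image]
  simp only [Set.exists_mem_image, Finsupp.single_le_iff]

/-- Membership in a monomial ideal is tested on exponents, and multiplying by a power of `X j` does
not change the exponents of the variables in `s`. This is the regularity of the sequence of powers
of the variables. -/
theorem mem_span_X_pow_of_mul_X_pow {k : ℕ} {s : Set σ} {j : σ} (hj : j ∉ s)
    {p : MvPolynomial σ K}
    (h : p * X j ^ k ∈ Ideal.span ((fun i => (X i : MvPolynomial σ K) ^ k) '' s)) :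
    p ∈ Ideal.span ((fun i => (X i : MvPolynomial σ K) ^ k) '' s) := by
  rw [mem_span_X_pow_image] at h ⊢
  intro d hd
  obtain ⟨i, hi, hk⟩ := h (d + Finsupp.single j k) (by
    rw [mem_support_iff] at hd ⊢
    rwa [X_pow_eq_monomial, coeff_mul_monomial, mul_one])
  refine ⟨i, hi, ?_⟩
  have : j ≠ i := by rintro rfl; exact hj hi
  rwa [Finsupp.add_apply, Finsupp.single_eq_of_ne' this, add_zero] at hk

/-- The powers of the variables form a regular sequence, so the first Koszul homology vanishes:
reduce `r 0` modulo the second and third powers, then the corrected `r 2` modulo the second. -/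
theorem exists_koszul_eq {k : ℕ} (r : Fin 3 → MvPolynomial (Fin 3) K)
    (h : ∑ i, r i * X i ^ k = 0) : ∃ e, r = Cech.koszul X e k := by
  rw [Fin.sum_univ_three] at h
  have h0 : r 0 ∈ Ideal.span
      ((fun i => (X i : MvPolynomial (Fin 3) K) ^ k) '' ({1, 2} : Set (Fin 3))) := by
    refine mem_span_X_pow_of_mul_X_pow (j := 0) (by decide) ?_
    have : r 0 * X 0 ^ k = -r 1 * X 1 ^ k + -r 2 * X 2 ^ k := by linear_combination h
    rw [this, Set.image_pair]
    exact Ideal.mem_span_pair.2 ⟨_, _, rfl⟩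
  rw [Set.image_pair, Ideal.mem_span_pair] at h0
  obtain ⟨e₂, e₁, h0⟩ := h0
  have h1 : r 2 + e₁ * X 0 ^ k ∈ Ideal.span
      ((fun i => (X i : MvPolynomial (Fin 3) K) ^ k) '' ({1} : Set (Fin 3))) := by
    refine mem_span_X_pow_of_mul_X_pow (j := 2) (by decide) ?_
    rw [Set.image_singleton, Ideal.mem_span_singleton]
    exact ⟨-r 1 - e₂ * X 0 ^ k, by linear_combination h + X 0 ^ k * h0⟩
  rw [Set.image_singleton, Ideal.mem_span_singleton] at h1
  obtain ⟨e₀, h1⟩ := h1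
  have h2 : r 1 = -e₀ * X 2 ^ k - e₂ * X 0 ^ k := by
    have hX : (X 1 : MvPolynomial (Fin 3) K) ^ k ≠ 0 := pow_ne_zero _ (X_ne_zero _)
    refine mul_right_cancel₀ hX ?_
    linear_combination h + X 0 ^ k * h0 - X 2 ^ k * h1
  refine ⟨![-e₀, -e₁, e₂], ?_⟩
  funext i
  fin_cases i
  · simp [Cech.koszul]
    linear_combination -h0
  · simp [Cech.koszul]
    linear_combination h2
  · simp [Cech.koszul]
    linear_combination h1

theorem prod_X_pow_eq_monomial_const [Fintype σ] (l : ℕ) :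
    (∏ i, (X i : MvPolynomial σ K)) ^ l = monomial (Finsupp.equivFunOnFinite.symm fun _ => l) 1 := by
  rw [monomial_eq, C_1, one_mul, Finsupp.prod_fintype _ _ fun i => pow_zero _, ← Finset.prod_pow]
  rfl

/-- The socle of the quotient by the powers of the variables. -/
theorem sub_C_mul_mem_span_X_pow [Fintype σ] {l : ℕ} {p : MvPolynomial σ K}
    (h : ∀ j, p * X j ∈ Ideal.span (Set.range fun i => (X i : MvPolynomial σ K) ^ (l + 1))) :
    ∃ c : K, p - C c * (∏ i, X i) ^ l ∈
      Ideal.span (Set.range fun i => (X i : MvPolynomial σ K) ^ (l + 1)) := by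
  classical
  simp only [← Set.image_univ, mem_span_X_pow_image, Set.mem_univ, true_and] at h ⊢
  -- The socle is spanned by the monomial with all exponents `l`, so `c` is the coefficient of that
  -- monomial.
  refine ⟨coeff (Finsupp.equivFunOnFinite.symm fun _ => l) p, fun d hd => ?_⟩
  by_contra! hlt
  rw [mem_support_iff, prod_X_pow_eq_monomial_const, C_mul_monomial, mul_one, coeff_sub,
    coeff_monomial] at hd
  split_ifs at hd with hdl
  · exact hd (by rw [hdl, sub_self])
  · rw [sub_zero] at hd
    -- All exponents of `d` are at most `l` and one is smaller, say at `j`. Multiplying by `X j`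
    -- then still leaves every exponent at most `l`, against `h j`.
    obtain ⟨j, hj⟩ : ∃ j, d j ≠ l := by
      by_contra! hall
      exact hdl (Finsupp.ext fun i => (hall i).symm)
    obtain ⟨i, hi⟩ := h j (d + Finsupp.single j 1) (by
      rw [mem_support_iff, coeff_mul_X]
      exact hd)
    rw [Finsupp.add_apply, Finsupp.single_apply] at hi
    have h1 := hlt i
    split_ifs at hi with hji
    · subst hji
      omega
    · omega

theorem prod_X_pow_notMem_span_X_pow [Fintype σ] (l : ℕ) :
    (∏ i, (X i : MvPolynomial σ K)) ^ l ∉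
      Ideal.span (Set.range fun i => (X i : MvPolynomial σ K) ^ (l + 1)) := by
  classical
  simp only [← Set.image_univ, mem_span_X_pow_image, Set.mem_univ, true_and]
  intro h
  obtain ⟨i, hi⟩ := h (Finsupp.equivFunOnFinite.symm fun _ => l) (by
    rw [prod_X_pow_eq_monomial_const, mem_support_iff, coeff_monomial, if_pos rfl]
    exact one_ne_zero)
  change l + 1 ≤ l at hi
  omega

/-! ### Binary cubic forms -/

/-- A repeated prime factor divides both partial derivatives, which are nonzero multiples of `X 0 ^
2` and `X 1 ^ 2` because `3 ≠ 0`; it would divide two non-associated variables. -/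
theorem not_mul_self_dvd_cubic [CharZero K] {a b : K} (ha : a ≠ 0) (hb : b ≠ 0)
    {π : MvPolynomial (Fin 2) K} (hπ : Prime π) :
    ¬ π * π ∣ C a * X 0 ^ 3 + C b * X 1 ^ 3 := by
  rintro ⟨q, hq⟩
  have key : ∀ i : Fin 2, π ∣ pderiv i (C a * X 0 ^ 3 + C b * X 1 ^ 3) := by
    intro i
    rw [hq, Derivation.leibniz, Derivation.leibniz]
    simp only [smul_eq_mul]
    exact ⟨π * pderiv i q + q * (2 * pderiv i π), by ring⟩
  have h0 : π ∣ X 0 := by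
    have h := key 0
    have e : pderiv (0 : Fin 2) (C a * X 0 ^ 3 + C b * X 1 ^ 3 : MvPolynomial (Fin 2) K) =
        C (a * 3) * X 0 ^ 2 := by
      have h3 : (C 3 : MvPolynomial (Fin 2) K) = 3 := map_ofNat C 3
      simp [pderiv_X, h3]
      ring
    rw [e, IsUnit.dvd_mul_left ((isUnit_iff_ne_zero.2 (by simp [ha])).map C)] at h
    exact hπ.dvd_of_dvd_pow h
  have h1 : π ∣ X 1 := by
    have h := key 1
    have e : pderiv (1 : Fin 2) (C a * X 0 ^ 3 + C b * X 1 ^ 3 : MvPolynomial (Fin 2) K) =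
        C (b * 3) * X 1 ^ 2 := by
      have h3 : (C 3 : MvPolynomial (Fin 2) K) = 3 := map_ofNat C 3
      simp [pderiv_X, h3]
      ring
    rw [e, IsUnit.dvd_mul_left ((isUnit_iff_ne_zero.2 (by simp [hb])).map C)] at h
    exact hπ.dvd_of_dvd_pow h
  have h2 := ((X_prime (R := K) (i := (0 : Fin 2))).irreducible.dvd_iff.1 h0).resolve_left
    hπ.not_isUnit
  have h3 := (h2.dvd.trans h1)
  rw [X_dvd_X] at h3
  exact absurd h3 (by simp)

theorem cubic_ne_zero {a b : K} (ha : a ≠ 0) :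
    (C a * X 0 ^ 3 + C b * X 1 ^ 3 : MvPolynomial (Fin 2) K) ≠ 0 := by
  intro h
  have := congrArg (eval ![1, 0]) h
  simp [ha] at this

/-- At each prime the cubic form has valuation at most one, so `3 v(p) ≤ 3 v(q) + 2` and hence `v(p)
≤ v(q)`. The induction strips one prime factor of `p` at a time. -/
theorem dvd_of_pow_three_dvd [CharZero K] {a b : K} (ha : a ≠ 0) (hb : b ≠ 0)
    {p q : MvPolynomial (Fin 2) K} {e : ℕ} (he : e ≤ 2)
    (h : p ^ 3 ∣ q ^ 3 * (C a * X 0 ^ 3 + C b * X 1 ^ 3) ^ e) : p ∣ q := by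
  set g : MvPolynomial (Fin 2) K := C a * X 0 ^ 3 + C b * X 1 ^ 3 with hg
  induction p using UniqueFactorizationMonoid.induction_on_prime generalizing q with
  | h₁ =>
    rw [zero_pow three_ne_zero, zero_dvd_iff, mul_eq_zero] at h
    rcases h with h | h
    · rw [pow_eq_zero_iff three_ne_zero] at h
      rw [h]
    · exact absurd (eq_zero_of_pow_eq_zero h) (cubic_ne_zero ha)
  | h₂ p hp => exact hp.dvd
  | h₃ p π _ hπ ih =>
    have hq : π ∣ q := by
      by_contra hq
      have h3 : π ^ 3 ∣ g ^ e := hπ.pow_dvd_of_dvd_mul_left 3 (fun h => hq (hπ.dvd_of_dvd_pow h))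
        ((pow_dvd_pow_of_dvd (dvd_mul_right π p) 3).trans h)
      obtain ⟨k, hk⟩ : π ∣ g := hπ.dvd_of_dvd_pow ((dvd_pow_self π three_ne_zero).trans h3)
      have hk' : ¬ π ∣ k := by
        rintro ⟨l, rfl⟩
        exact not_mul_self_dvd_cubic ha hb hπ ⟨l, by rw [← hg, hk, mul_assoc]⟩
      rw [hk, mul_pow] at h3
      -- Since `e + 1 ≤ 3`, one factor `π` survives the cancellation of `π ^ e` and would divide
      -- `k`.
      have h4 : π ^ (e + 1) ∣ π ^ e * k ^ e := (pow_dvd_pow π (by omega)).trans h3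
      rw [pow_succ, mul_dvd_mul_iff_left (pow_ne_zero _ hπ.ne_zero)] at h4
      exact hk' (hπ.dvd_of_dvd_pow h4)
    obtain ⟨q, rfl⟩ := hq
    refine mul_dvd_mul_left π (ih ?_)
    rwa [mul_pow, mul_pow, mul_assoc, mul_dvd_mul_iff_left (pow_ne_zero _ hπ.ne_zero)] at h

end MvPolynomial
end

/-! ### The cubic cone as a cyclic cubic extension of `K[x,y]`, and its normality -/

noncomputable section

/-- The element `β` equals the fraction `q / p`, and an integral fraction belongs to the integrally
closed ring `P`. -/
theorem dvd_of_isIntegral_of_mul_eq {P L : Type*} [CommRing P] [IsDomain P] [IsIntegrallyClosed P]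
    [Field L] [Algebra P L] [FaithfulSMul P L] {p q : P} (hp : p ≠ 0) {β : L}
    (hβ : IsIntegral P β) (h : algebraMap P L p * β = algebraMap P L q) : p ∣ q := by
  let := FractionRing.liftAlgebra P L
  have hp' : algebraMap P (FractionRing P) p ≠ 0 := by simpa using hp
  have hpL : algebraMap P L p ≠ 0 := by simpa using hp
  set x : FractionRing P := algebraMap P _ q / algebraMap P _ p with hx
  have hxβ : algebraMap (FractionRing P) L x = β := by
    rw [hx, map_div₀, ← IsScalarTower.algebraMap_apply, ← IsScalarTower.algebraMap_apply, ← h,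
      mul_div_cancel_left₀ _ hpL]
  have hxi : IsIntegral P x := by
    rw [← hxβ] at hβ
    exact (isIntegral_algebraMap_iff (algebraMap (FractionRing P) L).injective).1 hβ
  obtain ⟨y, hy⟩ := IsIntegrallyClosed.isIntegral_iff.1 hxi
  refine ⟨y, IsFractionRing.injective P (FractionRing P) ?_⟩
  rw [map_mul, hy, hx, mul_div_cancel₀ _ hp']

namespace Cubic

open MvPolynomial

variable {K : Type u} [Field K]

section Basic

variable (θ : K)

theorem toA_surjective : Function.Surjective (toA θ) := Ideal.Quotient.mkₐ_surjective K _

theorem cubic_relation : algebraMap K (A θ) θ * gen θ 0 ^ 3 + algebraMap K (A θ) θ ^ 2 * gen θ 1 ^ 3 +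
    gen θ 2 ^ 3 = 0 := by
  have h : toA θ (C θ * X 0 ^ 3 + C θ ^ 2 * X 1 ^ 3 + X 2 ^ 3) = 0 :=
    Ideal.Quotient.eq_zero_iff_mem.2 (Ideal.mem_span_singleton_self _)
  rw [← h]
  simp only [map_add, map_mul, map_pow, gen]
  rw [← MvPolynomial.algebraMap_eq, AlgHom.commutes]

variable {θ}

/-- The universal property of `A`. -/
def liftA {D : Type*} [CommRing D] [Algebra K D] (c : Fin 3 → D)
    (h : algebraMap K D θ * c 0 ^ 3 + algebraMap K D θ ^ 2 * c 1 ^ 3 + c 2 ^ 3 = 0) :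
    A θ →ₐ[K] D :=
  Ideal.Quotient.liftₐ _ (aeval c) fun a ha => by
    obtain ⟨b, rfl⟩ := Ideal.mem_span_singleton.1 ha
    rw [map_mul]
    simp only [map_add, map_mul, map_pow, aeval_X, aeval_C, h, zero_mul]

theorem liftA_toA {D : Type*} [CommRing D] [Algebra K D] (c : Fin 3 → D)
    (h : algebraMap K D θ * c 0 ^ 3 + algebraMap K D θ ^ 2 * c 1 ^ 3 + c 2 ^ 3 = 0)
    (p : MvPolynomial (Fin 3) K) : liftA c h (toA θ p) = aeval c p :=
  rfl

theorem liftA_gen {D : Type*} [CommRing D] [Algebra K D] (c : Fin 3 → D)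
    (h : algebraMap K D θ * c 0 ^ 3 + algebraMap K D θ ^ 2 * c 1 ^ 3 + c 2 ^ 3 = 0) (i : Fin 3) :
    liftA c h (gen θ i) = c i := by
  rw [gen, liftA_toA, aeval_X]

theorem algHom_ext_gen {D : Type*} [CommRing D] [Algebra K D] {f g : A θ →ₐ[K] D}
    (h : ∀ i, f (gen θ i) = g (gen θ i)) : f = g := by
  have : f.comp (toA θ) = g.comp (toA θ) := MvPolynomial.algHom_ext h
  ext a
  obtain ⟨p, rfl⟩ := toA_surjective θ a
  exact DFunLike.congr_fun this p

variable (θ)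

/-- The map `K[x,y] → A`. -/
def polyA : MvPolynomial (Fin 2) K →ₐ[K] A θ := aeval (xy θ)

theorem polyA_X (i : Fin 2) : polyA θ (X i) = gen θ i.castSucc := by
  rw [polyA, aeval_X]
  fin_cases i <;> rfl

/-- The form `z³ = -θx³ - θ²y³`. -/
def cubicForm : MvPolynomial (Fin 2) K := C (-θ) * X 0 ^ 3 + C (-θ ^ 2) * X 1 ^ 3

theorem map_cubicForm {D : Type*} [CommRing D] [Algebra K D] (f : MvPolynomial (Fin 2) K →ₐ[K] D) :
    f (cubicForm θ) =
      -(algebraMap K D θ * f (X 0) ^ 3 + algebraMap K D θ ^ 2 * f (X 1) ^ 3) := by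
  have hC : ∀ c : K, f (C c) = algebraMap K _ c := fun c => by
    rw [← MvPolynomial.algebraMap_eq, AlgHom.commutes]
  simp only [cubicForm, map_add, map_mul, map_pow, hC, map_neg]
  ring

theorem polyA_cubicForm : polyA θ (cubicForm θ) = gen θ 2 ^ 3 := by
  have := cubic_relation θ
  have h0 : polyA θ (X 0) = gen θ 0 := polyA_X θ 0
  have h1 : polyA θ (X 1) = gen θ 1 := polyA_X θ 1
  rw [map_cubicForm, h0, h1]
  linear_combination -this

theorem exists_eq_polyA (a : A θ) : ∃ p₀ p₁ p₂ : MvPolynomial (Fin 2) K,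
    a = polyA θ p₀ + polyA θ p₁ * gen θ 2 + polyA θ p₂ * gen θ 2 ^ 2 := by
  obtain ⟨p, rfl⟩ := toA_surjective θ a
  induction p using MvPolynomial.induction_on with
  | C c => exact ⟨C c, 0, 0, by
      rw [← MvPolynomial.algebraMap_eq, ← MvPolynomial.algebraMap_eq, AlgHom.commutes,
        AlgHom.commutes]
      simp⟩
  | add p q hp hq =>
    obtain ⟨p₀, p₁, p₂, hp⟩ := hp
    obtain ⟨q₀, q₁, q₂, hq⟩ := hq
    refine ⟨p₀ + q₀, p₁ + q₁, p₂ + q₂, ?_⟩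
    simp only [map_add, hp, hq]
    ring
  | mul_X p i hp =>
    obtain ⟨p₀, p₁, p₂, hp⟩ := hp
    rw [map_mul, hp]
    change ∃ q₀ q₁ q₂, _ * gen θ i = _
    induction i using Fin.lastCases with
    | last =>
      refine ⟨p₂ * cubicForm θ, p₀, p₁, ?_⟩
      rw [map_mul, polyA_cubicForm]
      change _ * gen θ 2 = _
      ring
    | cast i =>
      refine ⟨p₀ * X i, p₁ * X i, p₂ * X i, ?_⟩
      simp only [map_mul, polyA_X]
      ring

theorem finite_polyA : (polyA θ).toRingHom.Finite := by
  let := (polyA θ).toRingHom.toAlgebra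
  change Module.Finite (MvPolynomial (Fin 2) K) (A θ)
  refine Module.finite_def.2 (Submodule.fg_def.2
    ⟨{1, gen θ 2, gen θ 2 ^ 2}, Set.toFinite _, ?_⟩)
  rw [eq_top_iff]
  rintro a -
  obtain ⟨p₀, p₁, p₂, rfl⟩ := exists_eq_polyA θ a
  have h : ∀ (p : MvPolynomial (Fin 2) K) (b : A θ), polyA θ p * b = p • b := fun p b => rfl
  rw [← mul_one (polyA θ p₀), h, h, h]
  refine add_mem (add_mem ?_ ?_) ?_ <;>
    exact Submodule.smul_mem _ _ (Submodule.subset_span (by simp))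

/-- The presentation of `A` as an extension of `K[x,y]` by a cube root. -/
def toAdjoinRoot : A θ →ₐ[K]
    AdjoinRoot (Polynomial.X ^ 3 - Polynomial.C (cubicForm θ) :
      Polynomial (MvPolynomial (Fin 2) K)) :=
  liftA ![AdjoinRoot.of _ (X 0), AdjoinRoot.of _ (X 1), AdjoinRoot.root _] (by
    have h := AdjoinRoot.eval₂_root
      (Polynomial.X ^ 3 - Polynomial.C (cubicForm θ) : Polynomial (MvPolynomial (Fin 2) K))
    have hf := map_cubicForm θ (AdjoinRoot.ofAlgHom K
      (Polynomial.X ^ 3 - Polynomial.C (cubicForm θ) : Polynomial (MvPolynomial (Fin 2) K)))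
    simp only [AdjoinRoot.coe_ofAlgHom] at hf
    rw [Polynomial.eval₂_sub, Polynomial.eval₂_pow, Polynomial.eval₂_X, Polynomial.eval₂_C, hf] at h
    simp only [Matrix.cons_val_zero, Matrix.cons_val_one, Matrix.cons_val]
    linear_combination h)

theorem toAdjoinRoot_polyA (p : MvPolynomial (Fin 2) K) :
    toAdjoinRoot θ (polyA θ p) = AdjoinRoot.of _ p := by
  have : (toAdjoinRoot θ).comp (polyA θ) = AdjoinRoot.ofAlgHom K _ := by
    refine MvPolynomial.algHom_ext fun i => ?_
    rw [AlgHom.comp_apply, polyA_X, toAdjoinRoot, liftA_gen, AdjoinRoot.coe_ofAlgHom]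
    fin_cases i <;> rfl
  exact DFunLike.congr_fun this p

theorem toAdjoinRoot_injective : Function.Injective (toAdjoinRoot θ) := by
  have h : (Polynomial.X ^ 3 - Polynomial.C (cubicForm θ) :
      Polynomial (MvPolynomial (Fin 2) K)).eval₂ (polyA θ).toRingHom (gen θ 2) = 0 := by
    rw [Polynomial.eval₂_sub, Polynomial.eval₂_pow, Polynomial.eval₂_X, Polynomial.eval₂_C]
    exact sub_eq_zero.2 (polyA_cubicForm θ).symm
  have : (AdjoinRoot.liftAlgHom _ (polyA θ) (gen θ 2) h).comp (toAdjoinRoot θ) =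
      AlgHom.id K (A θ) := by
    refine algHom_ext_gen fun i => ?_
    rw [AlgHom.comp_apply, toAdjoinRoot, liftA_gen]
    induction i using Fin.lastCases with
    | last => exact AdjoinRoot.liftAlgHom_root _ _ _ _
    | cast i =>
      rw [AlgHom.id_apply, ← polyA_X]
      fin_cases i <;> exact AdjoinRoot.liftAlgHom_of _ _ _ _ _
  exact Function.LeftInverse.injective (DFunLike.congr_fun this)

end Basic

theorem polyA_injective (θ : K) : Function.Injective (polyA θ) := by
  intro p q h
  have h2 := congrArg (toAdjoinRoot θ) h
  rw [toAdjoinRoot_polyA, toAdjoinRoot_polyA] at h2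
  refine AdjoinRoot.of.injective_of_degree_ne_zero ?_ h2
  rw [Polynomial.degree_X_pow_sub_C (by norm_num)]
  norm_num

variable {θ : K}

/-- The automorphism of `A` that multiplies `z` by a cube root of unity. -/
def rotA (hθ : θ ^ 3 = 1) : A θ →ₐ[K] A θ :=
  liftA ![gen θ 0, gen θ 1, algebraMap K _ θ * gen θ 2] (by
    have h := cubic_relation θ
    have h3 := congrArg (algebraMap K (A θ)) hθ
    rw [map_pow, map_one] at h3
    simp only [Matrix.cons_val_zero, Matrix.cons_val_one, Matrix.cons_val]
    linear_combination h + gen θ 2 ^ 3 * h3)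

theorem rotA_gen_two (hθ : θ ^ 3 = 1) : rotA hθ (gen θ 2) = algebraMap K _ θ * gen θ 2 :=
  liftA_gen _ _ 2

theorem rotA_polyA (hθ : θ ^ 3 = 1) (p : MvPolynomial (Fin 2) K) :
    rotA hθ (polyA θ p) = polyA θ p := by
  have : (rotA hθ).comp (polyA θ) = polyA θ := by
    refine MvPolynomial.algHom_ext fun i => ?_
    rw [AlgHom.comp_apply, polyA_X, rotA, liftA_gen]
    fin_cases i <;> rfl
  exact DFunLike.congr_fun this p

theorem rotA_injective (hθ : θ ^ 3 = 1) : Function.Injective (rotA hθ) := by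
  have : ((rotA hθ).comp (rotA hθ)).comp (rotA hθ) = AlgHom.id K (A θ) := by
    refine algHom_ext_gen fun i => ?_
    simp only [AlgHom.comp_apply, AlgHom.id_apply]
    induction i using Fin.lastCases with
    | last =>
      change rotA hθ (rotA hθ (rotA hθ (gen θ 2))) = gen θ 2
      have h3 := congrArg (algebraMap K (A θ)) hθ
      rw [map_pow, map_one] at h3
      simp only [rotA_gen_two, map_mul, AlgHom.commutes]
      linear_combination gen θ 2 * h3
    | cast i => rw [← polyA_X, rotA_polyA, rotA_polyA, rotA_polyA]
  exact Function.LeftInverse.injective (g := (rotA hθ).comp (rotA hθ)) (DFunLike.congr_fun this)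

variable [CharZero K]

/-- A cube root in the fraction field is integral, hence a polynomial `q`. It is not a unit because
the form vanishes at the origin, so a prime factor of `q` would divide the squarefree form more than
once. -/
theorem cubicForm_not_cube (hθ : θ ≠ 0) (b : FractionRing (MvPolynomial (Fin 2) K)) :
    b ^ 3 ≠ algebraMap _ _ (cubicForm θ) := by
  intro h
  have hb : IsIntegral (MvPolynomial (Fin 2) K) b :=
    IsIntegral.of_pow (n := 3) (by norm_num) (h ▸ isIntegral_algebraMap)
  obtain ⟨q, rfl⟩ := IsIntegrallyClosed.isIntegral_iff.1 hb
  rw [← map_pow] at h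
  have h := IsFractionRing.injective _ _ h
  have hq0 : q ≠ 0 := by
    rintro rfl
    rw [zero_pow three_ne_zero] at h
    exact cubic_ne_zero (neg_ne_zero.2 hθ) h.symm
  have hqu : ¬ IsUnit q := by
    intro hu
    have := (hu.pow 3).map (eval ![(0 : K), 0])
    rw [h] at this
    simp [cubicForm] at this
  obtain ⟨π, hπ, hd⟩ := WfDvdMonoid.exists_irreducible_factor hqu hq0
  refine not_mul_self_dvd_cubic (neg_ne_zero.2 hθ) (neg_ne_zero.2 (pow_ne_zero 2 hθ)) hπ.prime ?_
  change π * π ∣ cubicForm θ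
  rw [← h, pow_succ, pow_two]
  exact (mul_dvd_mul hd hd).mul_right q

/-- Gauss's lemma reduces the irreducibility of `X³ - g` to the field `K(x,y)`, where it holds
because `3` is prime and `g` is not a cube. -/
theorem isDomain_A (hθ : θ ≠ 0) : IsDomain (A θ) := by
  have hirr : Irreducible (Polynomial.X ^ 3 - Polynomial.C (cubicForm θ) :
      Polynomial (MvPolynomial (Fin 2) K)) := by
    rw [Polynomial.Monic.irreducible_iff_irreducible_map_fraction_map
      (K := FractionRing (MvPolynomial (Fin 2) K))
      (Polynomial.monic_X_pow_sub_C _ (by norm_num))]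
    simp only [Polynomial.map_sub, Polynomial.map_pow, Polynomial.map_X, Polynomial.map_C]
    exact X_pow_sub_C_irreducible_of_prime Nat.prime_three (cubicForm_not_cube hθ)
  have := AdjoinRoot.isDomain_of_prime hirr.prime
  exact (toAdjoinRoot_injective θ).isDomain (toAdjoinRoot θ).toRingHom

/-- The projections onto the eigenspaces of `z ↦ θz` preserve integrality over `K[x,y]` because `3`
is invertible. The cubes of the eigencomponents of an integral element are then polynomials, and
squarefreeness of the cubic form gives divisibility of the components themselves. -/
theorem isIntegrallyClosed_A (hθ : IsPrimitiveRoot θ 3) : IsIntegrallyClosed (A θ) := by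
  have hθ0 : θ ≠ 0 := hθ.ne_zero (by norm_num)
  have := isDomain_A hθ0
  have hθ1 := hθ.pow_eq_one
  have hθs : 1 + θ + θ ^ 2 = 0 := by
    have := hθ.geom_sum_eq_zero (by norm_num)
    simpa [Finset.sum_range_succ] using this
  let := (polyA θ).toRingHom.toAlgebra
  let L := FractionRing (A θ)
  have hinjL : Function.Injective (algebraMap (A θ) L) := IsFractionRing.injective _ _
  have : FaithfulSMul (MvPolynomial (Fin 2) K) L :=
    (faithfulSMul_iff_algebraMap_injective _ _).2 (hinjL.comp (polyA_injective θ))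
  have hfin : Module.Finite (MvPolynomial (Fin 2) K) (A θ) := finite_polyA θ
  have hint : Algebra.IsIntegral (MvPolynomial (Fin 2) K) (A θ) := inferInstance
  rw [isIntegrallyClosed_iff L]
  intro α hα
  have hα : IsIntegral (MvPolynomial (Fin 2) K) α := isIntegral_trans α hα
  obtain ⟨a, b, hb, rfl⟩ := IsFractionRing.div_surjective (A := A θ) α
  have hb0 : b ≠ 0 := nonZeroDivisors.ne_zero hb
  -- By integrality `b` has a nonzero multiple in `K[x,y]`, so the denominator of `α` may be taken
  -- to be a polynomial.
  obtain ⟨p, hpb, hp0⟩ : ∃ p : MvPolynomial (Fin 2) K, polyA θ p ∈ Ideal.span {b} ∧ p ≠ 0 := by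
    have := Ideal.comap_ne_bot_of_integral_mem (R := MvPolynomial (Fin 2) K) hb0
      (Ideal.mem_span_singleton_self b) (Algebra.IsIntegral.isIntegral b)
    obtain ⟨p, hp, hp0⟩ := Submodule.exists_mem_ne_zero_of_ne_bot this
    exact ⟨p, hp, hp0⟩
  obtain ⟨c, hc⟩ := Ideal.mem_span_singleton.1 hpb
  set α : L := algebraMap (A θ) L a / algebraMap (A θ) L b with hαdef
  obtain ⟨p₀, p₁, p₂, hac⟩ := exists_eq_polyA θ (a * c)
  let j : A θ →+* L := algebraMap (A θ) L
  have hpα : j (polyA θ p) * α = j (a * c) := by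
    have : j b ≠ 0 := (map_ne_zero_iff j hinjL).2 hb0
    rw [hc, hαdef, map_mul, map_mul]
    change j b * j c * (j a / j b) = _
    rw [mul_comm (j b), mul_assoc, mul_div_cancel₀ _ this, mul_comm]
  rw [hac] at hpα
  -- The rotation `z ↦ θz` extended to the fraction field; it fixes `K[x,y]` and so preserves
  -- integrality over it.
  let τ : L →+* L := IsFractionRing.lift (g := j.comp (rotA hθ1).toRingHom)
    (hinjL.comp (rotA_injective hθ1))
  have hτ : ∀ x, τ (j x) = j (rotA hθ1 x) := fun x => IsFractionRing.lift_algebraMap _ x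
  have hτi : ∀ x : L, IsIntegral (MvPolynomial (Fin 2) K) x →
      IsIntegral (MvPolynomial (Fin 2) K) (τ x) := fun x hx =>
    hx.map_of_comp_eq (RingHom.id _) τ (by
      refine RingHom.ext fun q => ?_
      change j (polyA θ q) = τ (j (polyA θ q))
      rw [hτ, rotA_polyA])
  have hK : ∀ r : K, IsIntegral (MvPolynomial (Fin 2) K) (j (algebraMap K _ r)) := fun r => by
    rw [← (polyA θ).commutes r]
    exact isIntegral_algebraMap (A := L) (x := algebraMap K (MvPolynomial (Fin 2) K) r)
  have h1 := congrArg τ hpα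
  have h2 := congrArg τ h1
  simp only [map_add, map_mul, map_pow, hτ, rotA_polyA, rotA_gen_two, AlgHom.commutes] at hpα h1 h2
  set t : L := j (algebraMap K _ θ)
  have ht1 : t ^ 3 = 1 := by rw [← map_pow, ← map_pow, hθ1, map_one, map_one]
  have hts : 1 + t + t ^ 2 = 0 := by
    rw [← map_pow, ← map_pow, ← map_one j, ← map_one (algebraMap K (A θ)), ← map_add, ← map_add,
      ← map_add, ← map_add, hθs, map_zero, map_zero]
  set h3 : L := j (algebraMap K _ 3⁻¹)
  have hh3 : h3 * 3 = 1 := by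
    have : (3 : L) = j (algebraMap K _ 3) := by rw [map_ofNat, map_ofNat]
    rw [this, ← map_mul, ← map_mul, inv_mul_cancel₀ (by norm_num), map_one, map_one]
  set y := j (polyA θ p)
  set z := j (gen θ 2)
  have hz : z ^ 3 = j (polyA θ (cubicForm θ)) := by rw [polyA_cubicForm, map_pow]
  have hα1 := hτi _ hα
  have hα2 := hτi _ hα1
  -- These three identities are the projections of `yα` onto the eigenspaces of `τ` with eigenvalues
  -- `1`, `t` and `t²`.
  have e0 : y * (h3 * (α + τ α + τ (τ α))) = j (polyA θ p₀) := by
    linear_combination h3 * (hpα + h1 + h2) + j (polyA θ p₀) * hh3 +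
      h3 * j (polyA θ p₁) * z * hts + h3 * j (polyA θ p₂) * z ^ 2 * (hts + t * ht1)
  have e1 : y * (h3 * (α + t ^ 2 * τ α + t * τ (τ α))) = j (polyA θ p₁) * z := by
    linear_combination h3 * (hpα + t ^ 2 * h1 + t * h2) + j (polyA θ p₁) * z * hh3 +
      h3 * j (polyA θ p₀) * hts + 2 * h3 * j (polyA θ p₁) * z * ht1 +
      h3 * j (polyA θ p₂) * z ^ 2 * (hts + (t + t ^ 2) * ht1)
  have e2 : y * (h3 * (α + t * τ α + t ^ 2 * τ (τ α))) = j (polyA θ p₂) * z ^ 2 := by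
    linear_combination h3 * (hpα + t * h1 + t ^ 2 * h2) + j (polyA θ p₂) * z ^ 2 * hh3 +
      h3 * j (polyA θ p₀) * hts + h3 * j (polyA θ p₁) * z * (hts + t * ht1) +
      h3 * j (polyA θ p₂) * z ^ 2 * (t ^ 3 + 2) * ht1
  have d0 : p ∣ p₀ := dvd_of_isIntegral_of_mul_eq hp0
    ((hK 3⁻¹).mul ((hα.add hα1).add hα2)) e0
  -- Cubing turns `p₁z` into `p₁³g`, an equation between polynomials; similarly `p₂z²` becomes
  -- `p₂³g²` below.
  have d1 : p ∣ p₁ := by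
    refine dvd_of_pow_three_dvd (neg_ne_zero.2 hθ0) (neg_ne_zero.2 (pow_ne_zero 2 hθ0))
      one_le_two (dvd_of_isIntegral_of_mul_eq (pow_ne_zero 3 hp0)
        (((hK 3⁻¹).mul ((hα.add (((hK θ).pow 2).mul hα1)).add ((hK θ).mul hα2))).pow 3) ?_)
    change j (polyA θ (p ^ 3)) * _ = j (polyA θ (_ * cubicForm θ ^ 1))
    rw [map_pow, map_pow, ← mul_pow, e1, pow_one, map_mul, map_mul, map_pow, map_pow, ← hz, mul_pow]
  have d2 : p ∣ p₂ := by
    refine dvd_of_pow_three_dvd (neg_ne_zero.2 hθ0) (neg_ne_zero.2 (pow_ne_zero 2 hθ0))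
      le_rfl (dvd_of_isIntegral_of_mul_eq (pow_ne_zero 3 hp0)
        (((hK 3⁻¹).mul ((hα.add ((hK θ).mul hα1)).add (((hK θ).pow 2).mul hα2))).pow 3) ?_)
    change j (polyA θ (p ^ 3)) * _ = j (polyA θ (_ * cubicForm θ ^ 2))
    rw [map_pow, map_pow, ← mul_pow, e2, map_mul, map_mul, map_pow, map_pow, map_pow, map_pow, ← hz,
      mul_pow]
    ring
  obtain ⟨q₀, rfl⟩ := d0
  obtain ⟨q₁, rfl⟩ := d1
  obtain ⟨q₂, rfl⟩ := d2
  refine ⟨polyA θ q₀ + polyA θ q₁ * gen θ 2 + polyA θ q₂ * gen θ 2 ^ 2, ?_⟩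
  have hy : y ≠ 0 := (map_ne_zero_iff j hinjL).2 ((map_ne_zero_iff _ (polyA_injective θ)).2 hp0)
  refine mul_left_cancel₀ hy ?_
  rw [hpα]
  simp only [map_mul, map_add, map_pow]
  change y * (j _ + j _ * z + j _ * z ^ 2) = _
  ring

end Cubic
end

/-! ### Coactions that record degrees, and powers of the ideal `(x, y)` -/

noncomputable section

/-- An algebra homomorphism `S → S[T]` that sends `a` to `a Tᵐ` for `a` homogeneous of degree `m`,
and whose coefficients are the homogeneous components. -/
structure IsCoaction {K : Type*} [Field K] {S : Type*} [CommRing S] [Algebra K S]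
    (𝒢 : ℕ → Submodule K S) (δ : S →ₐ[K] Polynomial S) : Prop where
  apply_of_mem : ∀ m, ∀ a ∈ 𝒢 m, δ a = Polynomial.C a * Polynomial.X ^ m
  coeff_mem : ∀ a m, (δ a).coeff m ∈ 𝒢 m
  eval_one : ∀ a, (δ a).eval 1 = a

namespace MvPolynomial

variable {K : Type u} [Field K] {σ : Type*}

/-- The homomorphism `K[X] → K[X][T]` that multiplies all variables by `T`. -/
def coaction (K : Type u) [Field K] (σ : Type*) :
    MvPolynomial σ K →ₐ[K] Polynomial (MvPolynomial σ K) :=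
  aeval fun i => Polynomial.C (X i) * Polynomial.X

theorem coaction_of_isHomogeneous {m : ℕ} {p : MvPolynomial σ K} (hp : p.IsHomogeneous m) :
    coaction K σ p = Polynomial.C p * Polynomial.X ^ m := by
  induction hp using IsWeightedHomogeneous.induction_on with
  | zero => simp
  | add p q _ _ hp hq => rw [map_add, hp, hq, map_add, add_mul]
  | monomial d r hr =>
    have hm : m = d.degree := by rw [← hr, Finsupp.degree_eq_weight_one]; rfl
    have h : (algebraMap K (Polynomial (MvPolynomial σ K))) r = Polynomial.C (C r) := rfl
    rw [coaction, aeval_monomial, hm, monomial_eq, map_mul, h, mul_assoc]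
    congr 1
    simp only [Finsupp.prod, map_prod, map_pow, mul_pow, Finset.prod_mul_distrib,
      Finset.prod_pow_eq_pow_sum]
    rfl

theorem coeff_coaction (p : MvPolynomial σ K) (m : ℕ) :
    (coaction K σ p).coeff m = homogeneousComponent m p := by
  conv_lhs => rw [← sum_homogeneousComponent p]
  rw [map_sum, Polynomial.finsetSum_coeff]
  simp only [coaction_of_isHomogeneous (homogeneousComponent_isHomogeneous _ p),
    Polynomial.coeff_C_mul_X_pow]
  rw [Finset.sum_ite_eq]
  split_ifs with h
  · rfl
  · rw [homogeneousComponent_eq_zero]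
    simpa using h

theorem isCoaction : IsCoaction (homogeneousSubmodule σ K) (coaction K σ) where
  apply_of_mem m p hp := coaction_of_isHomogeneous hp
  coeff_mem p m := by
    rw [coeff_coaction]
    exact homogeneousComponent_mem m p
  eval_one p := by
    have : ((Polynomial.aeval (1 : MvPolynomial σ K)).restrictScalars K).comp (coaction K σ) =
        AlgHom.id K _ := by
      refine algHom_ext fun i => ?_
      simp [coaction]
    simpa using DFunLike.congr_fun this p

end MvPolynomial

/-- Induction on `n`, with `W` replaced by the ideals of elements that `a`, respectively `b`,
multiplies into `W`. -/
theorem Ideal.span_pair_pow_le {S : Type*} [CommRing S] {a b : S} {n : ℕ} {W : Ideal S}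
    (h : ∀ i j, i + j = n → a ^ i * b ^ j ∈ W) : Ideal.span {a, b} ^ n ≤ W := by
  induction n generalizing W with
  | zero =>
    rw [(Ideal.eq_top_iff_one W).2 (by simpa using h 0 0 rfl)]
    exact le_top
  | succ n ih =>
    rw [pow_succ', Ideal.mul_le]
    intro u hu c hc
    obtain ⟨x, y, rfl⟩ := Ideal.mem_span_pair.1 hu
    have ha : a * c ∈ W :=
      ih (W := Submodule.comap (LinearMap.mulLeft S a) W) (fun i j hij => by
        have := h (i + 1) j (by omega)
        rwa [pow_succ', mul_assoc] at this) hc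
    have hb : b * c ∈ W :=
      ih (W := Submodule.comap (LinearMap.mulLeft S b) W) (fun i j hij => by
        have := h i (j + 1) (by omega)
        rwa [pow_succ', mul_left_comm] at this) hc
    rw [add_mul, mul_assoc, mul_assoc]
    exact add_mem (W.mul_mem_left x ha) (W.mul_mem_left y hb)

/-- In a monomial of degree `3m + 2` the remainders of the exponents modulo `3` add up to at most
`4`, which leaves at least `m` full cubes. -/
theorem Ideal.span_pair_pow_le_span_cubes_pow {S : Type*} [CommRing S] (a b : S) (m : ℕ) :
    Ideal.span {a, b} ^ (3 * m + 2) ≤ Ideal.span {a ^ 3, b ^ 3} ^ m := by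
  refine Ideal.span_pair_pow_le fun i j hij => ?_
  have h : a ^ i * b ^ j = (a ^ (i % 3) * b ^ (j % 3)) * ((a ^ 3) ^ (i / 3) * (b ^ 3) ^ (j / 3)) := by
    rw [← pow_mul, ← pow_mul, mul_mul_mul_comm, ← pow_add, ← pow_add, Nat.mod_add_div,
      Nat.mod_add_div]
  rw [h]
  refine Ideal.mul_mem_left _ _ (Ideal.pow_le_pow_right (n := i / 3 + j / 3) (by omega) ?_)
  rw [pow_add]
  exact Ideal.mul_mem_mul (Ideal.pow_mem_pow (Ideal.subset_span (by simp)) _)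
    (Ideal.pow_mem_pow (Ideal.subset_span (by simp)) _)

namespace Cubic

open MvPolynomial

variable {K : Type u} [Field K]

/-- The homomorphism `A → A[T]` that multiplies the generators by `T`. -/
def coactA (θ : K) : A θ →ₐ[K] Polynomial (A θ) :=
  liftA (fun i => Polynomial.C (gen θ i) * Polynomial.X) (by
    have h := congrArg Polynomial.C (cubic_relation θ)
    simp only [map_add, map_mul, map_pow, map_zero] at h
    rw [IsScalarTower.algebraMap_apply K (A θ) (Polynomial (A θ)), Polynomial.algebraMap_eq]
    linear_combination (Polynomial.X ^ 3 : Polynomial (A θ)) * h)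

theorem coactA_toA (θ : K) (p : MvPolynomial (Fin 3) K) :
    coactA θ (toA θ p) = (coaction K (Fin 3) p).map (toA θ).toRingHom := by
  have : (coactA θ).comp (toA θ) = (Polynomial.mapAlgHom (toA θ)).comp (coaction K (Fin 3)) := by
    refine MvPolynomial.algHom_ext fun i => ?_
    change coactA θ (gen θ i) = _
    rw [coactA, liftA_gen]
    simp [coaction, gen]
  exact DFunLike.congr_fun this p

theorem isCoaction_coactA (θ : K) : IsCoaction (grA θ) (coactA θ) where
  apply_of_mem := by
    rintro m _ ⟨p, hp, rfl⟩
    change coactA θ (toA θ p) = _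
    rw [coactA_toA, coaction_of_isHomogeneous hp]
    simp
  coeff_mem a m := by
    obtain ⟨p, rfl⟩ := toA_surjective θ a
    rw [coactA_toA, Polynomial.coeff_map, coeff_coaction]
    exact ⟨_, homogeneousComponent_mem m p, rfl⟩
  eval_one a := by
    obtain ⟨p, rfl⟩ := toA_surjective θ a
    rw [coactA_toA, Polynomial.eval_one_map, isCoaction.eval_one]
    rfl

theorem grA_eq_pow (θ : K) (n : ℕ) : grA θ n = Submodule.span K (Set.range (gen θ)) ^ n := by
  rw [grA, ← homogeneousSubmodule_one_pow, Submodule.map_pow, homogeneousSubmodule_one_eq_span_X,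
    Submodule.map_span, ← Set.range_comp]
  rfl

theorem grA_succ_le (θ : K) {n : ℕ} {W : Submodule K (A θ)}
    (h : ∀ i, ∀ a ∈ grA θ n, gen θ i * a ∈ W) : grA θ (n + 1) ≤ W := by
  rw [grA_eq_pow, pow_succ', ← grA_eq_pow, Submodule.mul_le]
  intro b hb a ha
  have : Submodule.span K (Set.range (gen θ)) ≤ W.comap (LinearMap.mulRight K a) := by
    rw [Submodule.span_le]
    rintro _ ⟨i, rfl⟩
    exact h i a ha
  exact this hb

theorem grB_succ_le {n : ℕ} {W : Submodule K (MvPolynomial (Fin 2) K)}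
    (h : ∀ i, ∀ a ∈ grB K n, X i * a ∈ W) : grB K (n + 1) ≤ W := by
  rw [grB, ← homogeneousSubmodule_one_pow, pow_succ', homogeneousSubmodule_one_pow,
    homogeneousSubmodule_one_eq_span_X, Submodule.mul_le]
  intro b hb a ha
  have : Submodule.span K (Set.range (X : Fin 2 → MvPolynomial (Fin 2) K)) ≤
      W.comap (LinearMap.mulRight K a) := by
    rw [Submodule.span_le]
    rintro _ ⟨i, rfl⟩
    exact h i a ha
  exact this hb

theorem grA_zero_le (θ : K) : grA θ 0 ≤ 1 := by
  rw [grA_eq_pow, pow_zero]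

theorem grB_zero_le : grB K 0 ≤ 1 := by
  rw [grB, homogeneousSubmodule_zero]

/-! ### The ideal generated by `x` and `y` -/

/-- The ideal of `A` generated by `x` and `y`. -/
def xyIdeal (θ : K) : Ideal (A θ) := Ideal.span {gen θ 0, gen θ 1}

theorem gen_two_pow_mem (θ : K) (q : ℕ) : gen θ 2 ^ (3 * q) ∈ xyIdeal θ ^ (3 * q) := by
  rw [pow_mul, pow_mul]
  refine Ideal.pow_mem_pow ?_ q
  have h : gen θ 2 ^ 3 = algebraMap K _ (-θ) * gen θ 0 ^ 3 + algebraMap K _ (-θ ^ 2) * gen θ 1 ^ 3 := by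
    rw [map_neg, map_neg, map_pow]
    linear_combination cubic_relation θ
  rw [h]
  exact add_mem (Ideal.mul_mem_left _ _ (Ideal.pow_mem_pow (Ideal.subset_span (by simp)) 3))
    (Ideal.mul_mem_left _ _ (Ideal.pow_mem_pow (Ideal.subset_span (by simp)) 3))

/-- Since `z³` is a cubic form in `x, y`, a monomial loses only the factor `z ^ (e 2 % 3)`, of
degree at most two. -/
theorem grA_le_xyIdeal_pow (θ : K) {d : ℕ} {a : A θ} (ha : a ∈ grA θ d) :
    a ∈ xyIdeal θ ^ (d - 2) := by
  obtain ⟨p, hp, rfl⟩ := ha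
  change toA θ p ∈ _
  rw [SetLike.mem_coe, mem_homogeneousSubmodule] at hp
  induction hp using IsWeightedHomogeneous.induction_on with
  | zero => simp
  | add p q _ _ hp hq =>
    rw [map_add]
    exact add_mem hp hq
  | monomial e r hr =>
    have hd : d = e 0 + e 1 + e 2 := by
      rw [← hr]
      simp [Finsupp.weight_apply, Finsupp.sum_fintype, Fin.sum_univ_three]
    have hmon : toA θ (monomial e r) = algebraMap K _ r *
        (gen θ 2 ^ (e 2 % 3) * (gen θ 0 ^ e 0 * gen θ 1 ^ e 1 * gen θ 2 ^ (3 * (e 2 / 3)))) := by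
      have h2 : gen θ 2 ^ e 2 = gen θ 2 ^ (e 2 % 3) * gen θ 2 ^ (3 * (e 2 / 3)) := by
        rw [← pow_add, Nat.mod_add_div]
      rw [monomial_eq, map_mul, Finsupp.prod_fintype _ _ fun i => pow_zero _, Fin.prod_univ_three,
        map_mul, map_mul, map_pow, map_pow, map_pow, ← MvPolynomial.algebraMap_eq, AlgHom.commutes]
      change _ * (gen θ 0 ^ e 0 * gen θ 1 ^ e 1 * gen θ 2 ^ e 2) = _
      rw [h2]
      ring
    rw [hmon]
    refine Ideal.mul_mem_left _ _ (Ideal.mul_mem_left _ _ ?_)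
    have h0 : gen θ 0 ∈ xyIdeal θ := Ideal.subset_span (by simp)
    have h1 : gen θ 1 ∈ xyIdeal θ := Ideal.subset_span (by simp)
    refine Ideal.pow_le_pow_right (m := d - 2) (n := e 0 + e 1 + 3 * (e 2 / 3)) (by omega) ?_
    rw [pow_add, pow_add]
    exact Ideal.mul_mem_mul (Ideal.mul_mem_mul (Ideal.pow_mem_pow h0 _) (Ideal.pow_mem_pow h1 _))
      (gen_two_pow_mem θ _)

end Cubic
end

noncomputable section

namespace Cubic

open MvPolynomial

variable {K : Type u} [Field K] {θ : K}

/-! ### The self-embedding -/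

/-- The equations that characterize the self-embedding of `A`. -/
structure IsCubing (ζ : K) (φ : A θ →ₐ[K] A θ) : Prop where
  gen_zero : gen θ 0 ^ 3 = ζ • φ (gen θ 0) + ζ ^ 2 • φ (gen θ 1)
  gen_one : gen θ 1 ^ 3 = ζ • φ (gen θ 0) + ζ ^ 5 • φ (gen θ 1)
  gen_two : gen θ 2 ^ 3 = ζ • φ (gen θ 0) + ζ ^ 8 • φ (gen θ 1)
  apply_two : φ (gen θ 2) = -(gen θ 0 * gen θ 1 * gen θ 2)
  mem : ∀ i, φ (gen θ i) ∈ grA θ 3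

/-- The first two equations are linear in `φ(x), φ(y)` with determinant a nonzero multiple of `θ -
1`. The third is then the defining relation of `A`, rewritten with `1 + θ + θ² = 0`. -/
theorem exists_isCubing (hθ : IsPrimitiveRoot θ 3) {ζ : K} (hζ : ζ ^ 3 = θ) :
    ∃ φ : A θ →ₐ[K] A θ, IsCubing ζ φ := by
  have hθ0 : θ ≠ 0 := hθ.ne_zero (by norm_num)
  have hζ0 : ζ ≠ 0 := by rintro rfl; exact hθ0 (by rw [← hζ, zero_pow three_ne_zero])
  have hθ1 : θ - 1 ≠ 0 := sub_ne_zero.2 (hθ.ne_one (by norm_num))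
  have hθs : 1 + θ + θ ^ 2 = 0 := by
    have := hθ.geom_sum_eq_zero (by norm_num)
    simpa [Finset.sum_range_succ] using this
  have hrel := cubic_relation θ
  set k := algebraMap K (A θ) with hk
  have ha : k ζ * k ζ⁻¹ = 1 := by rw [← map_mul, mul_inv_cancel₀ hζ0, map_one]
  have hb : (k ζ ^ 3 - 1) * k (θ - 1)⁻¹ = 1 := by
    rw [← map_pow, hζ, ← map_one k, ← map_sub, ← map_mul, mul_inv_cancel₀ hθ1]
  have hs : 1 + k ζ ^ 3 + k ζ ^ 6 = 0 := by
    have h6 : 1 + ζ ^ 3 + ζ ^ 6 = 0 := by linear_combination hθs + (1 + θ + ζ ^ 3) * hζ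
    rw [← map_pow, ← map_pow, ← map_one k, ← map_add, ← map_add, h6, map_zero]
  have ht : k θ = k ζ ^ 3 := (congrArg k hζ).symm.trans (map_pow k ζ 3)
  rw [ht] at hrel
  set t := k ζ
  set a := k ζ⁻¹ with ha'
  set b := k (θ - 1)⁻¹ with hb'
  set x := gen θ 0
  set y := gen θ 1
  set z := gen θ 2
  -- `X` and `Y` are the solution of `x³ = tX + t²Y`, `y³ = tX + t⁵Y`, where `a` inverts `t` and `b`
  -- inverts `t³ - 1`.
  obtain ⟨X, hX⟩ : ∃ X, X = b * a * (t ^ 3 * x ^ 3 - y ^ 3) := ⟨_, rfl⟩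
  obtain ⟨Y, hY⟩ : ∃ Y, Y = b * a ^ 2 * (y ^ 3 - x ^ 3) := ⟨_, rfl⟩
  have e0 : x ^ 3 = t * X + t ^ 2 * Y := by
    rw [hX, hY]
    linear_combination -x ^ 3 * hb - b * (t ^ 3 * x ^ 3 - y ^ 3) * ha -
      b * (y ^ 3 - x ^ 3) * (t * a + 1) * ha
  have e1 : y ^ 3 = t * X + t ^ 5 * Y := by
    rw [hX, hY]
    linear_combination -y ^ 3 * hb - b * (t ^ 3 * x ^ 3 - y ^ 3) * ha -
      t ^ 3 * b * (y ^ 3 - x ^ 3) * (t * a + 1) * ha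
  have e2 : z ^ 3 = t * X + t ^ 8 * Y := by
    linear_combination hrel - t ^ 3 * e0 - t ^ 6 * e1 - t * X * hs -
      t ^ 5 * Y * hs
  -- The three linear forms for `x³, y³, z³` multiply to `t³X³ + t⁶Y³`, because their coefficient
  -- ratios `t, t⁴, t⁷` run through the cube roots of `t³`.
  have e3 : t ^ 3 * X ^ 3 + (t ^ 3) ^ 2 * Y ^ 3 + (-(x * y * z)) ^ 3 = 0 := by
    have : (-(x * y * z)) ^ 3 = -(x ^ 3 * y ^ 3 * z ^ 3) := by ring
    rw [this, e0, e1, e2]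
    linear_combination -(t ^ 4 * X ^ 2 * Y + t ^ 8 * X * Y ^ 2 + t ^ 6 * Y ^ 3 * (t ^ 3 - 1)) * hs
  have hmem3 : ∀ i, gen θ i ^ 3 ∈ grA θ 3 := fun i => by
    have := SetLike.pow_mem_graded 3 (gen_mem θ i)
    simpa using this
  have hXm : X ∈ grA θ 3 := by
    rw [hX, ha', hb', ← ht, ← map_mul, ← Algebra.smul_def, ← Algebra.smul_def]
    exact Submodule.smul_mem _ _ (sub_mem (Submodule.smul_mem _ _ (hmem3 0)) (hmem3 1))
  have hYm : Y ∈ grA θ 3 := by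
    rw [hY, ha', hb', ← map_pow, ← map_mul, ← Algebra.smul_def]
    exact Submodule.smul_mem _ _ (sub_mem (hmem3 1) (hmem3 0))
  have hZm : -(x * y * z) ∈ grA θ 3 :=
    neg_mem (SetLike.mul_mem_graded (SetLike.mul_mem_graded (gen_mem θ 0) (gen_mem θ 1))
      (gen_mem θ 2))
  refine ⟨liftA ![X, Y, -(x * y * z)] (by rw [← hk, ht]; exact e3), ?_, ?_, ?_, ?_, ?_⟩
  · simp only [liftA_gen, Algebra.smul_def, map_pow]; exact e0
  · simp only [liftA_gen, Algebra.smul_def, map_pow]; exact e1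
  · simp only [liftA_gen, Algebra.smul_def, map_pow]; exact e2
  · rw [liftA_gen]; rfl
  · intro i
    rw [liftA_gen]
    fin_cases i
    exacts [hXm, hYm, hZm]

/-- A homomorphism that sends the generators to elements of degree `e` multiplies degrees
by `e`. -/
theorem map_mem_grA {φ : A θ →ₐ[K] A θ} {e : ℕ} (h : ∀ i, φ (gen θ i) ∈ grA θ e) {m : ℕ} {a : A θ}
    (ha : a ∈ grA θ m) : φ a ∈ grA θ (e * m) := by
  induction m generalizing a with
  | zero =>
    obtain ⟨c, rfl⟩ := Submodule.mem_one.1 (grA_zero_le θ ha)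
    rw [AlgHom.commutes, mul_zero, grA_eq_pow, pow_zero]
    exact Submodule.mem_one.2 ⟨c, rfl⟩
  | succ m ih =>
    have : grA θ (m + 1) ≤ (grA θ (e * (m + 1))).comap φ.toLinearMap := by
      refine grA_succ_le θ fun i b hb => ?_
      rw [Submodule.mem_comap, AlgHom.toLinearMap_apply, map_mul, mul_add, mul_one, add_comm]
      exact SetLike.mul_mem_graded (h i) (ih hb)
    exact this ha

theorem isIntegral_of_gen {S : Type*} [CommRing S] (f : S →+* A θ)
    (hK : ∀ c, f.IsIntegralElem (algebraMap K (A θ) c)) (h : ∀ i, f.IsIntegralElem (gen θ i)) :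
    f.IsIntegral := by
  intro a
  obtain ⟨p, rfl⟩ := toA_surjective θ a
  induction p using MvPolynomial.induction_on with
  | C c =>
    rw [← MvPolynomial.algebraMap_eq, AlgHom.commutes]
    exact hK c
  | add p q hp hq =>
    rw [map_add]
    exact RingHom.IsIntegralElem.add f hp hq
  | mul_X p i hp =>
    rw [map_mul]
    exact RingHom.IsIntegralElem.mul f hp (h i)

/-- The cube of each generator is in the image of `φ`, by the three linear equations. -/
theorem IsCubing.isIntegral {ζ : K} {φ : A θ →ₐ[K] A θ} (h : IsCubing ζ φ) :
    φ.toRingHom.IsIntegral := by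
  have h3 : ∀ a b : A θ, a ^ 3 = φ b → φ.toRingHom.IsIntegralElem a := by
    intro a b hab
    refine ⟨Polynomial.X ^ 3 - Polynomial.C b, Polynomial.monic_X_pow_sub_C _ (by norm_num), ?_⟩
    rw [Polynomial.eval₂_sub, Polynomial.eval₂_pow, Polynomial.eval₂_X, Polynomial.eval₂_C, hab]
    exact sub_self _
  refine isIntegral_of_gen _ (fun c => ?_) fun i => ?_
  · rw [← φ.commutes c]
    exact RingHom.isIntegralElem_map _
  · fin_cases i
    · exact h3 _ (ζ • gen θ 0 + ζ ^ 2 • gen θ 1) (by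
        rw [map_add, map_smul, map_smul]; exact h.gen_zero)
    · exact h3 _ (ζ • gen θ 0 + ζ ^ 5 • gen θ 1) (by
        rw [map_add, map_smul, map_smul]; exact h.gen_one)
    · exact h3 _ (ζ • gen θ 0 + ζ ^ 8 • gen θ 1) (by
        rw [map_add, map_smul, map_smul]; exact h.gen_two)

instance : Algebra.FiniteType K (A θ) :=
  Algebra.FiniteType.of_surjective (toA θ) (toA_surjective θ)

theorem IsCubing.finite {ζ : K} {φ : A θ →ₐ[K] A θ} (h : IsCubing ζ φ) : φ.toRingHom.Finite := by
  refine h.isIntegral.to_finite (RingHom.FiniteType.of_comp_finiteType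
    (f := algebraMap K (A θ)) ?_)
  have : φ.toRingHom.comp (algebraMap K (A θ)) = algebraMap K (A θ) := φ.comp_algebraMap
  rw [this, RingHom.finiteType_algebraMap]
  infer_instance

/-- The point `(1, 1, 1)` of the cubic curve, as a line in the cone. -/
def pointA (hθ : IsPrimitiveRoot θ 3) : A θ →ₐ[K] Polynomial K :=
  liftA (fun _ => Polynomial.X) (by
    have hθs : 1 + θ + θ ^ 2 = 0 := by
      have := hθ.geom_sum_eq_zero (by norm_num)
      simpa [Finset.sum_range_succ] using this
    have := congrArg (algebraMap K (Polynomial K)) hθs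
    rw [map_add, map_add, map_one, map_pow, map_zero] at this
    linear_combination (Polynomial.X ^ 3 : Polynomial K) * this)

/-- The chain consists of the zero ideal, the ideal of the line over the point `(1, 1, 1)`, and the
ideal of the vertex. -/
theorem two_le_ringKrullDim_A (hθ : IsPrimitiveRoot θ 3) [IsDomain (A θ)] :
    ((2 : ℕ) : WithBot ℕ∞) ≤ ringKrullDim (A θ) := by
  let f := (pointA hθ).toRingHom
  let g := (Polynomial.evalRingHom (0 : K)).comp f
  let p : Fin 3 → PrimeSpectrum (A θ) := ![⟨⊥, Ideal.isPrime_bot⟩,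
    ⟨RingHom.ker f, RingHom.ker_isPrime f⟩, ⟨RingHom.ker g, RingHom.ker_isPrime g⟩]
  have hf : ∀ i, f (gen θ i) = Polynomial.X := fun i => liftA_gen _ _ i
  refine le_ringKrullDim_of_strictMono p (Fin.strictMono_iff_lt_succ.2 fun i => ?_)
  fin_cases i
  · change (⊥ : Ideal (A θ)) < RingHom.ker f
    refine lt_of_le_of_ne bot_le fun h => ?_
    have hm : gen θ 0 - gen θ 1 ∈ RingHom.ker f := by
      rw [RingHom.mem_ker, map_sub, hf, hf, sub_self]
    rw [← h, Ideal.mem_bot, sub_eq_zero] at hm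
    have := polyA_injective θ ((polyA_X θ 0).trans (hm.trans (polyA_X θ 1).symm))
    exact absurd (X_injective this) (by simp)
  · change RingHom.ker f < RingHom.ker g
    refine lt_of_le_of_ne (fun a ha => by
      rw [RingHom.mem_ker] at ha ⊢
      rw [RingHom.comp_apply, ha, map_zero]) fun h => ?_
    have hm : gen θ 0 ∈ RingHom.ker g := by
      rw [RingHom.mem_ker, RingHom.comp_apply, hf]
      simp
    rw [← h, RingHom.mem_ker, hf] at hm
    exact Polynomial.X_ne_zero hm

/-- Composed with `K[x,y] → A`, the map `φ` is integral into a domain of dimension at least two, so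
the composite is injective. A nonzero kernel element would have a nonzero multiple in `K[x,y]`, by
integrality. -/
theorem IsCubing.injective (hθ : IsPrimitiveRoot θ 3) [IsDomain (A θ)] {ζ : K}
    {φ : A θ →ₐ[K] A θ} (h : IsCubing ζ φ) : Function.Injective φ := by
  have hf : Function.Injective (φ.toRingHom.comp (polyA θ).toRingHom) :=
    injective_of_isIntegral_of_le_ringKrullDim _
      ((finite_polyA θ).to_isIntegral.trans _ _ h.isIntegral) (two_le_ringKrullDim_A hθ)
  rw [injective_iff_map_eq_zero]
  by_contra! hc
  obtain ⟨a, ha, ha0⟩ := hc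
  let := (polyA θ).toRingHom.toAlgebra
  have hint : IsIntegral (MvPolynomial (Fin 2) K) a := (finite_polyA θ).to_isIntegral a
  obtain ⟨p, hp, hp0⟩ := Submodule.exists_mem_ne_zero_of_ne_bot
    (Ideal.comap_ne_bot_of_integral_mem ha0 (Ideal.mem_span_singleton_self a) hint)
  obtain ⟨c, hc⟩ := Ideal.mem_span_singleton.1 (Ideal.mem_comap.1 hp)
  refine hp0 (hf ?_)
  rw [map_zero]
  change φ (algebraMap _ (A θ) p) = 0
  rw [hc, map_mul, ha, zero_mul]

/-! ### Iterates of the self-embedding -/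

theorem IsCubing.pow_mem {ζ : K} {φ : A θ →ₐ[K] A θ} (h : IsCubing ζ φ) (n : ℕ) {m : ℕ} {a : A θ}
    (ha : a ∈ grA θ m) : (φ ^ n) a ∈ grA θ (3 ^ n * m) := by
  induction n with
  | zero => simpa using ha
  | succ n ih =>
    rw [pow_succ', pow_succ', mul_assoc]
    exact map_mem_grA h.mem ih

theorem IsCubing.pow_isIntegral {ζ : K} {φ : A θ →ₐ[K] A θ} (h : IsCubing ζ φ) (n : ℕ) :
    (φ ^ n).toRingHom.IsIntegral := by
  induction n with
  | zero => exact fun a => RingHom.isIntegralElem_map (RingHom.id (A θ))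
  | succ n ih =>
    rw [pow_succ']
    exact RingHom.IsIntegral.trans _ _ ih h.isIntegral

/-- For `n = 0` this is the pigeonhole principle on exponents with sum `2j - 1`. The induction step
uses that `x³` and `y³` lie in the ideal generated by `φ(x), φ(y)`. -/
theorem IsCubing.xyIdeal_pow_le {ζ : K} {φ : A θ →ₐ[K] A θ} (h : IsCubing ζ φ) (n j : ℕ) :
    xyIdeal θ ^ (2 * j * 3 ^ n - 1) ≤
      Ideal.span {(φ ^ n) (gen θ 0) ^ j, (φ ^ n) (gen θ 1) ^ j} := by
  -- For `j = 0` the subtraction truncates, but the right side is the unit ideal.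
  rcases Nat.eq_zero_or_pos j with rfl | hj
  · rw [pow_zero, (Ideal.eq_top_iff_one (Ideal.span _)).2 (Ideal.subset_span (by simp))]
    exact le_top
  induction n with
  | zero =>
    refine Ideal.span_pair_pow_le fun i i' hi => ?_
    by_cases hij : j ≤ i
    · exact Ideal.mul_mem_right _ _ ((Ideal.mem_span_pair.2 ⟨gen θ 0 ^ (i - j), 0, by
        change _ * gen θ 0 ^ j + _ = _
        rw [← pow_add, zero_mul, add_zero, Nat.sub_add_cancel hij]⟩))
    · have hij : j ≤ i' := by omega
      exact Ideal.mul_mem_left _ _ ((Ideal.mem_span_pair.2 ⟨0, gen θ 1 ^ (i' - j), by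
        change _ + _ * gen θ 1 ^ j = _
        rw [← pow_add, zero_mul, zero_add, Nat.sub_add_cancel hij]⟩))
  | succ n ih =>
    have hpos : 0 < 3 ^ n := by positivity
    -- The exponent reproduces itself under `m ↦ 3m + 2`, exactly the loss in passing from `(x, y)`
    -- to `(x³, y³)`.
    have h1 : 2 * j * 3 ^ (n + 1) - 1 = 3 * (2 * j * 3 ^ n - 1) + 2 := by
      have : 0 < j * 3 ^ n := Nat.mul_pos hj hpos
      have e1 : 2 * j * 3 ^ (n + 1) = 6 * (j * 3 ^ n) := by ring
      have e2 : 2 * j * 3 ^ n = 2 * (j * 3 ^ n) := by ring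
      omega
    have h2 : Ideal.span {gen θ 0 ^ 3, gen θ 1 ^ 3} ≤ (xyIdeal θ).map φ.toRingHom := by
      have h0 : φ (gen θ 0) ∈ (xyIdeal θ).map φ.toRingHom :=
        Ideal.mem_map_of_mem φ.toRingHom (Ideal.subset_span (by simp))
      have h1 : φ (gen θ 1) ∈ (xyIdeal θ).map φ.toRingHom :=
        Ideal.mem_map_of_mem φ.toRingHom (Ideal.subset_span (by simp))
      rw [Ideal.span_le]
      rintro _ (rfl | rfl)
      · rw [h.gen_zero, Algebra.smul_def, Algebra.smul_def]
        exact add_mem (Ideal.mul_mem_left _ _ h0) (Ideal.mul_mem_left _ _ h1)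
      · rw [h.gen_one, Algebra.smul_def, Algebra.smul_def]
        exact add_mem (Ideal.mul_mem_left _ _ h0) (Ideal.mul_mem_left _ _ h1)
    rw [h1]
    refine (Ideal.span_pair_pow_le_span_cubes_pow _ _ _).trans ((Ideal.pow_right_mono h2 _).trans ?_)
    rw [← Ideal.map_pow]
    refine (Ideal.map_mono ih).trans ?_
    rw [Ideal.map_span, Set.image_pair]
    refine le_of_eq (congrArg Ideal.span ?_)
    rw [pow_succ']
    change {φ ((φ ^ n) (gen θ 0) ^ j), φ ((φ ^ n) (gen θ 1) ^ j)} = _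
    rw [map_pow, map_pow]
    rfl

/-- A homogeneous `u` of positive degree makes `u φⁿ(a)` of degree at least `2k·3ⁿ + 1`. After the
loss of two in `grA_le_xyIdeal_pow` the exponent `2k·3ⁿ - 1` remains, which is what `xyIdeal_pow_le`
requires. -/
theorem IsCubing.exists_eq_add {ζ : K} {φ : A θ →ₐ[K] A θ} (h : IsCubing ζ φ) (n k : ℕ) {a : A θ}
    (ha : a ∈ grA θ (2 * k)) {u : A θ} (hu : u ∈ positiveIdeal (grA θ)) :
    ∃ α β, u * (φ ^ n) a = α * (φ ^ n) (gen θ 0) ^ k + β * (φ ^ n) (gen θ 1) ^ k := by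
  have hle : positiveIdeal (grA θ) ≤ Submodule.comap (LinearMap.mulRight (A θ) ((φ ^ n) a))
      (Ideal.span {(φ ^ n) (gen θ 0) ^ k, (φ ^ n) (gen θ 1) ^ k}) := by
    refine Ideal.span_le.2 ?_
    rintro v ⟨m, hm, hv⟩
    refine h.xyIdeal_pow_le n k ?_
    refine Ideal.pow_le_pow_right ?_
      (grA_le_xyIdeal_pow θ (SetLike.mul_mem_graded hv (h.pow_mem n ha)))
    have e2 : 3 ^ n * (2 * k) = 2 * k * 3 ^ n := by ring
    omega
  obtain ⟨α, β, hαβ⟩ := Ideal.mem_span_pair.1 (hle hu)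
  exact ⟨α, β, hαβ.symm⟩

/-- For `u` of positive degree `m`, the coefficients in `u φⁿ(a) = α φⁿ(x) + β φⁿ(y)` can be chosen
homogeneous. -/
theorem IsCubing.exists_eq_add_homogeneous {ζ : K} {φ : A θ →ₐ[K] A θ} (h : IsCubing ζ φ) (n : ℕ)
    {a : A θ} (ha : a ∈ grA θ 2) {m : ℕ} (hm : 0 < m) {u : A θ} (hu : u ∈ grA θ m) :
    ∃ α ∈ grA θ (m + 3 ^ n), ∃ β ∈ grA θ (m + 3 ^ n),
      u * (φ ^ n) a = α * (φ ^ n) (gen θ 0) + β * (φ ^ n) (gen θ 1) := by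
  obtain ⟨α, β, hαβ⟩ := h.exists_eq_add n 1 ha (Ideal.subset_span ⟨m, hm, hu⟩)
  have hδ := isCoaction_coactA θ
  refine ⟨_, hδ.coeff_mem α _, _, hδ.coeff_mem β _, ?_⟩
  have hua := SetLike.mul_mem_graded hu (h.pow_mem n ha)
  have h0 := h.pow_mem n (gen_mem θ 0)
  have h1 := h.pow_mem n (gen_mem θ 1)
  -- Comparing components of degree `m + 2·3ⁿ` replaces `α` and `β` by their components of degree `m
  -- + 3ⁿ`.
  have key := congrArg (fun P => P.coeff (m + 3 ^ n * 2)) (congrArg (coactA θ) hαβ)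
  have hdeg : m + 3 ^ n * 2 = (m + 3 ^ n) + 3 ^ n * 1 := by ring
  simp only [pow_one, map_add, map_mul (coactA θ) α, map_mul (coactA θ) β,
    hδ.apply_of_mem _ _ hua, hδ.apply_of_mem _ _ h0, hδ.apply_of_mem _ _ h1] at key
  rw [Polynomial.coeff_C_mul, Polynomial.coeff_X_pow_self, mul_one, hdeg, Polynomial.coeff_add,
    ← mul_assoc, ← mul_assoc, Polynomial.coeff_mul_X_pow, Polynomial.coeff_mul_X_pow,
    Polynomial.coeff_mul_C, Polynomial.coeff_mul_C] at key
  exact key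

end Cubic
end

noncomputable section

/-! ### Homogeneous equations of integral dependence -/

theorem exists_monic_of_sum_eq_zero {S T : Type*} [CommRing S] [Nontrivial S] [CommRing T]
    [Algebra S T] (N : ℕ) (c : ℕ → S) (b : T) (h0 : c 0 = 1)
    (h : ∑ i ∈ Finset.range (N + 1), algebraMap S T (c i) * b ^ (N - i) = 0) :
    ∃ P : Polynomial S, P.Monic ∧ P.natDegree = N ∧ Polynomial.aeval b P = 0 ∧
      ∀ i j, i + j = N → P.coeff j = c i := by
  set P : Polynomial S := ∑ i ∈ Finset.range (N + 1), Polynomial.monomial (N - i) (c i) with hP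
  have hcoeff : ∀ i j, i + j = N → P.coeff j = c i := by
    intro i j hij
    rw [hP, Polynomial.finsetSum_coeff, Finset.sum_eq_single i]
    · rw [Polynomial.coeff_monomial, if_pos (by omega)]
    · intro i' hi' hne
      rw [Polynomial.coeff_monomial, if_neg]
      have := Finset.mem_range.1 hi'
      omega
    · intro hi
      exact absurd (Finset.mem_range.2 (by omega)) hi
  have hN : P.coeff N = 1 := by rw [hcoeff 0 N (zero_add N), h0]
  have hle : P.natDegree ≤ N :=
    Polynomial.natDegree_sum_le_of_forall_le _ _ fun i _ =>
      (Polynomial.natDegree_monomial_le _).trans (Nat.sub_le _ _)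
  refine ⟨P, Polynomial.monic_of_natDegree_le_of_coeff_eq_one N hle hN,
    Polynomial.natDegree_eq_of_le_of_coeff_ne_zero hle (by rw [hN]; exact one_ne_zero), ?_, hcoeff⟩
  rw [hP, map_sum, ← h]
  exact Finset.sum_congr rfl fun i _ => Polynomial.aeval_monomial _

/-- Multiplying the equation for `b` by `w ^ N` gives an equation for `b * w` with coefficients `c i
* w ^ i`. -/
theorem isIntegral_mul_of_sum_eq_zero {S T : Type*} [CommRing S] [Nontrivial S] [CommRing T]
    [Algebra S T] (N : ℕ) (c : ℕ → T) (b w : T) (h0 : c 0 = 1)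
    (h : ∑ i ∈ Finset.range (N + 1), c i * b ^ (N - i) = 0)
    (hc : ∀ i, ∃ d : S, algebraMap S T d = c i * w ^ i) : IsIntegral S (b * w) := by
  -- `algebraMap S T` need not be injective, so the leading coefficient is chosen to be `1`
  -- explicitly.
  have hc' : ∀ i, ∃ d : S, algebraMap S T d = c i * w ^ i ∧ (i = 0 → d = 1) := by
    intro i
    rcases Nat.eq_zero_or_pos i with rfl | hi
    · exact ⟨1, by rw [h0]; simp, fun _ => rfl⟩
    · obtain ⟨d, hd⟩ := hc i
      exact ⟨d, hd, fun h => absurd h hi.ne'⟩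
  choose d hd hd0 using hc'
  obtain ⟨P, hP, -, hP0, -⟩ := exists_monic_of_sum_eq_zero N d (b * w) (hd0 0 rfl) (by
    rw [← mul_zero (w ^ N), ← h, Finset.mul_sum]
    refine Finset.sum_congr rfl fun i hi => ?_
    have hi : N = i + (N - i) := by have := Finset.mem_range.1 hi; omega
    rw [hd, mul_pow]
    conv_rhs => rw [hi, pow_add]
    rw [← hi]
    ring)
  exact ⟨P, hP, hP0⟩

/-- An embedding into an algebraically closed field extends along an integral extension of domains.
The extension is injective because its kernel contracts to zero, and it takes values in the integral
closure by transitivity of integrality. -/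
theorem exists_ringHom_extension {S T C L : Type*} [CommRing S] [CommRing T] [IsDomain T]
    [CommRing C] [Field L] [IsAlgClosed L] (φ : S →+* T) (hφ : Function.Injective φ)
    (hφi : φ.IsIntegral) [Algebra C L] [FaithfulSMul C L] (ρ : S →+* integralClosure C L)
    (hρ : Function.Injective ρ) :
    ∃ ρ' : T →+* integralClosure C L, Function.Injective ρ' ∧ ρ'.comp φ = ρ := by
  have : IsDomain S := hφ.isDomain φ
  let := φ.toAlgebra
  let := ((algebraMap (integralClosure C L) L).comp ρ).toAlgebra
  have : Algebra.IsIntegral S T := ⟨hφi⟩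
  have : FaithfulSMul S T := (faithfulSMul_iff_algebraMap_injective _ _).2 hφ
  have : FaithfulSMul S L :=
    (faithfulSMul_iff_algebraMap_injective _ _).2 (Subtype.val_injective.comp hρ)
  let g : T →ₐ[S] L := IsAlgClosed.lift
  have hg : Function.Injective g := by
    rw [← AlgHom.coe_toRingHom, RingHom.injective_iff_ker_eq_bot]
    refine Ideal.eq_bot_of_comap_eq_bot (R := S) ?_
    rw [RingHom.comap_ker, AlgHom.comp_algebraMap, ← RingHom.injective_iff_ker_eq_bot]
    exact FaithfulSMul.algebraMap_injective S L
  have hmem : ∀ t, g t ∈ integralClosure C L := by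
    intro t
    have h1 : IsIntegral S (g t) := (Algebra.IsIntegral.isIntegral t).map g
    have h2 : IsIntegral (integralClosure C L) (g t) :=
      h1.map_of_comp_eq ρ (RingHom.id L) (by ext; rfl)
    exact isIntegral_trans (R := C) (A := integralClosure C L) _ h2
  refine ⟨g.toRingHom.codRestrict (integralClosure C L) hmem, fun a b h => ?_, ?_⟩
  · exact hg (congrArg Subtype.val h)
  · ext s
    exact g.commutes s

namespace Cubic

open MvPolynomial

variable {K : Type u} [Field K] {θ : K}

/-- Since `ψ` multiplies degrees by `e`, the component of `ψ a` in degree `k` is `ψ` of the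
component of `a` in degree `k / e`, or zero; `expand` encodes the substitution `T ↦ Tᵉ`. -/
theorem coeff_coactA_map {ψ : A θ →ₐ[K] A θ} {e : ℕ} (h : ∀ i, ψ (gen θ i) ∈ grA θ e) (a : A θ)
    (k : ℕ) : (coactA θ (ψ a)).coeff k = ψ ((Polynomial.expand (A θ) e (coactA θ a)).coeff k) := by
  have : (coactA θ).comp ψ = (Polynomial.mapAlgHom ψ).comp
      (((Polynomial.expand (A θ) e).restrictScalars K).comp (coactA θ)) := by
    refine algHom_ext_gen fun i => ?_
    have hδ := isCoaction_coactA θ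
    rw [AlgHom.comp_apply, AlgHom.comp_apply, AlgHom.comp_apply, hδ.apply_of_mem _ _ (h i),
      hδ.apply_of_mem _ _ (gen_mem θ i)]
    simp
  rw [← AlgHom.comp_apply, this]
  exact Polynomial.coeff_map _ _

/-- In a monic equation of degree `N` for `a` over `ψ(A)`, take the component of degree `N * m`. The
coefficient of `a ^ (N - i)` is then replaced by the part of degree `i * m`, which comes from degree
`i * m / e` before applying `ψ`. -/
theorem exists_homogeneous_equation {ψ : A θ →ₐ[K] A θ} {e : ℕ} (he : 0 < e)
    (hψ : ψ.toRingHom.IsIntegral) (h : ∀ i, ψ (gen θ i) ∈ grA θ e) {m : ℕ} {a : A θ}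
    (ha : a ∈ grA θ m) : ∃ (N : ℕ) (c : ℕ → A θ), c 0 = 1 ∧
      (∀ i, c i = 0 ∨ ∃ k, k * e = i * m ∧ c i ∈ grA θ k) ∧
      ∑ i ∈ Finset.range (N + 1), ψ (c i) * a ^ (N - i) = 0 := by
  obtain ⟨P, hP, hP0⟩ := hψ a
  have hδ := isCoaction_coactA θ
  refine ⟨P.natDegree, fun i =>
    (Polynomial.expand (A θ) e (coactA θ (P.coeff (P.natDegree - i)))).coeff (i * m), ?_, ?_, ?_⟩
  · beta_reduce
    rw [Nat.sub_zero, hP.coeff_natDegree, map_one, map_one, zero_mul, Polynomial.coeff_one_zero]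
  · intro i
    beta_reduce
    rw [Polynomial.coeff_expand he]
    split_ifs with hd
    · exact Or.inr ⟨_, Nat.div_mul_cancel hd, hδ.coeff_mem _ _⟩
    · exact Or.inl rfl
  · rw [Polynomial.eval₂_eq_sum_range, ← Finset.sum_range_reflect] at hP0
    have key := congrArg (fun Q => Polynomial.coeff Q (P.natDegree * m))
      (congrArg (coactA θ) hP0)
    simp only [map_sum, Polynomial.finsetSum_coeff, map_zero, Polynomial.coeff_zero] at key
    rw [← key]
    refine Finset.sum_congr rfl fun i hi => ?_
    have hi := Finset.mem_range.1 hi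
    have e1 : P.natDegree + 1 - 1 - i = P.natDegree - i := by omega
    rw [e1, map_mul, map_pow, hδ.apply_of_mem _ _ ha, mul_pow, ← Polynomial.C_pow, ← pow_mul,
      ← mul_assoc]
    have e2 : P.natDegree * m = i * m + m * (P.natDegree - i) := by
      rw [mul_comm m, ← add_mul]
      congr 1
      omega
    rw [e2, Polynomial.coeff_mul_X_pow, Polynomial.coeff_mul_C]
    congr 1
    exact (coeff_coactA_map h _ _).symm

/-- The tower of copies of `A` in the absolute integral closure of a ring that contains `A`. -/
theorem IsCubing.exists_isTower (hθ : IsPrimitiveRoot θ 3) [IsDomain (A θ)] {ζ : K}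
    {φ : A θ →ₐ[K] A θ} (h : IsCubing ζ φ) {S : Type v} [CommRing S] [Algebra K S]
    (𝒢 : ℕ → Submodule K S) (ι : A θ →+* S) (hι : Function.Injective ι)
    (hι𝒢 : ∀ m, ∀ a ∈ grA θ m, ι a ∈ 𝒢 m) {L : Type w} [Field L] [IsAlgClosed L] [Algebra S L]
    [FaithfulSMul S L] : ∃ ρ : ℕ → A θ →+* integralClosure S L,
      IsTower φ 𝒢 ρ ∧ ρ 0 = (algebraMap S (integralClosure S L)).comp ι := by
  have : Nontrivial S := hι.nontrivial
  have hinj : Function.Injective (algebraMap S (integralClosure S L)) := fun a b hab =>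
    FaithfulSMul.algebraMap_injective S L (congrArg Subtype.val hab)
  have step : ∀ ρ : {ρ : A θ →+* integralClosure S L // Function.Injective ρ},
      ∃ ρ' : {ρ : A θ →+* integralClosure S L // Function.Injective ρ},
        ρ'.1.comp φ.toRingHom = ρ.1 := by
    rintro ⟨ρ, hρ⟩
    obtain ⟨ρ', hρ', hcomp⟩ :=
      exists_ringHom_extension φ.toRingHom (h.injective hθ) h.isIntegral ρ hρ
    exact ⟨⟨ρ', hρ'⟩, hcomp⟩
  choose next hnext using step
  let ρ : ℕ → {ρ : A θ →+* integralClosure S L // Function.Injective ρ} := fun n =>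
    Nat.rec ⟨(algebraMap S (integralClosure S L)).comp ι, hinj.comp hι⟩ (fun _ => next) n
  have hcomp : ∀ n, (ρ (n + 1)).1.comp φ.toRingHom = (ρ n).1 := fun n => hnext (ρ n)
  -- On `φⁿ(A)` the map `ρ n` is the original embedding, so an equation over `φⁿ(A)` becomes one
  -- with coefficients in `S`.
  have hpow : ∀ n a, (ρ n).1 ((φ ^ n) a) = algebraMap S _ (ι a) := by
    intro n
    induction n with
    | zero => exact fun a => rfl
    | succ n ih =>
      intro a
      rw [pow_succ', ← ih a, ← hcomp n]
      rfl
  refine ⟨fun n => (ρ n).1, ⟨fun n => (ρ n).2, hcomp, fun n m a ha => ?_⟩, rfl⟩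
  obtain ⟨N, c, hc0, hc, hsum⟩ := exists_homogeneous_equation (pow_pos (by norm_num : 0 < 3) n)
    (h.pow_isIntegral n) (fun i => by simpa using h.pow_mem n (gen_mem θ i)) ha
  obtain ⟨P, hP, hdeg, hP0, hcoeff⟩ := exists_monic_of_sum_eq_zero N (fun i => ι (c i))
    ((ρ n).1 a) (by rw [hc0, map_one]) (by
      have := congrArg (ρ n).1 hsum
      simp only [map_sum, map_mul, map_pow, hpow, map_zero] at this
      exact this)
  refine ⟨P, hP, hP0, fun i j hij => ?_⟩
  rw [hcoeff i j (hij.trans hdeg)]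
  rcases hc i with hi | ⟨k, hk, hi⟩
  · exact Or.inl (by rw [hi, map_zero])
  · refine Or.inr ⟨k, ?_, hι𝒢 k _ hi⟩
    have h3 : (3 : ℚ) ^ n ≠ 0 := pow_ne_zero _ (by norm_num)
    rw [mul_div_assoc', eq_div_iff h3]
    exact_mod_cast hk

theorem IsTower.apply_pow {φ : A θ →ₐ[K] A θ} {S : Type v} [CommRing S] [Algebra K S]
    {𝒢 : ℕ → Submodule K S} {T : Type w} [CommRing T] [Algebra S T] {ρ : ℕ → A θ →+* T}
    (h : IsTower φ 𝒢 ρ) (n : ℕ) (a : A θ) : ρ n ((φ ^ n) a) = ρ 0 a := by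
  induction n generalizing a with
  | zero => rfl
  | succ n ih =>
    rw [pow_succ', ← ih a, ← h.comp n]
    rfl

end Cubic
end

/-! ### Normality and dimension of the Segre product -/

noncomputable section

/-- The hypothesis `h` says that `R` contains every element of `W` that is a fraction of elements of
`R`. An integral fraction lies in `W` by normality of `W`, hence in `R`. -/
theorem IsIntegrallyClosed.of_injective {R W : Type*} [CommRing R] [IsDomain R] [CommRing W]
    [IsDomain W] [IsIntegrallyClosed W] (f : R →+* W) (hf : Function.Injective f)
    (h : ∀ r s w, s ≠ 0 → f s * w = f r → ∃ r', f r' = w) : IsIntegrallyClosed R := by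
  rw [isIntegrallyClosed_iff (FractionRing R)]
  intro x hx
  let g : FractionRing R →+* FractionRing W := IsFractionRing.lift
    (g := (algebraMap W (FractionRing W)).comp f) ((IsFractionRing.injective W _).comp hf)
  have hg : ∀ r, g (algebraMap R _ r) = algebraMap W _ (f r) := fun r =>
    IsFractionRing.lift_algebraMap _ r
  have hgx : IsIntegral W (g x) := hx.map_of_comp_eq f g (RingHom.ext fun r => (hg r).symm)
  obtain ⟨w, hw⟩ := IsIntegrallyClosed.isIntegral_iff.1 hgx
  obtain ⟨r, s, hs, rfl⟩ := IsFractionRing.div_surjective (A := R) x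
  have hs0 : s ≠ 0 := nonZeroDivisors.ne_zero hs
  have hs1 : algebraMap R (FractionRing R) s ≠ 0 := by simpa using hs0
  have hs2 : algebraMap W (FractionRing W) (f s) ≠ 0 := by
    rw [← hg]
    exact (map_ne_zero g).2 hs1
  have hsw : f s * w = f r := by
    refine IsFractionRing.injective W (FractionRing W) ?_
    rw [map_mul, hw, map_div₀, hg, hg, mul_div_cancel₀ _ hs2]
  obtain ⟨r', rfl⟩ := h r s w hs0 hsw
  refine ⟨r', ?_⟩
  rw [← map_mul] at hsw
  rw [eq_div_iff hs1, ← map_mul, mul_comm, hf hsw]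

theorem MvPolynomial.isIntegrallyClosed_fin {A : Type*} [CommRing A] [IsDomain A]
    [IsIntegrallyClosed A] (n : ℕ) : IsIntegrallyClosed (MvPolynomial (Fin n) A) := by
  induction n with
  | zero => exact IsIntegrallyClosed.of_equiv (MvPolynomial.isEmptyAlgEquiv A (Fin 0)).symm.toRingEquiv
  | succ n ih => exact IsIntegrallyClosed.of_equiv (MvPolynomial.finSuccEquiv A n).symm.toRingEquiv

namespace Cubic

open MvPolynomial

variable {K : Type u} [Field K]

/-! ### The tensor product -/

theorem isDomain_tensor (θ : K) [IsDomain (A θ)] :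
    IsDomain (A θ ⊗[K] MvPolynomial (Fin 2) K) :=
  (algebraTensorAlgEquiv (σ := Fin 2) K (A θ)).toMulEquiv.isDomain _

theorem isIntegrallyClosed_tensor (θ : K) [IsDomain (A θ)] [IsIntegrallyClosed (A θ)] :
    IsIntegrallyClosed (A θ ⊗[K] MvPolynomial (Fin 2) K) :=
  have := isIntegrallyClosed_fin (A := A θ) 2
  IsIntegrallyClosed.of_equiv (algebraTensorAlgEquiv (σ := Fin 2) K (A θ)).symm.toRingEquiv

section Coaction

variable {θ : K} {D : Type*} [CommRing D] [Algebra K D] (f : A θ →ₐ[K] D)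
  (g : MvPolynomial (Fin 2) K →ₐ[K] D)

/-- The homomorphism `a ⊗ b ↦ f a g b T ^ deg a`. -/
def gradL : A θ ⊗[K] MvPolynomial (Fin 2) K →ₐ[K] Polynomial D :=
  Algebra.TensorProduct.productMap ((Polynomial.mapAlgHom f).comp (coactA θ))
    ((IsScalarTower.toAlgHom K D (Polynomial D)).comp g)

/-- The homomorphism `a ⊗ b ↦ f a g b T ^ deg b`. -/
def gradR : A θ ⊗[K] MvPolynomial (Fin 2) K →ₐ[K] Polynomial D :=
  Algebra.TensorProduct.productMap ((IsScalarTower.toAlgHom K D (Polynomial D)).comp f)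
    ((Polynomial.mapAlgHom g).comp (coaction K (Fin 2)))

theorem coeff_gradL_tmul (a : A θ) (b : MvPolynomial (Fin 2) K) (m : ℕ) :
    (gradL f g (a ⊗ₜ b)).coeff m = f ((coactA θ a).coeff m) * g b := by
  rw [gradL, Algebra.TensorProduct.productMap_apply_tmul]
  change (Polynomial.map f.toRingHom (coactA θ a) * Polynomial.C (g b)).coeff m = _
  rw [Polynomial.coeff_mul_C, Polynomial.coeff_map]
  rfl

theorem coeff_gradR_tmul (a : A θ) (b : MvPolynomial (Fin 2) K) (m : ℕ) :
    (gradR f g (a ⊗ₜ b)).coeff m = f a * g ((coaction K (Fin 2) b).coeff m) := by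
  rw [gradR, Algebra.TensorProduct.productMap_apply_tmul]
  change (Polynomial.C (f a) * Polynomial.map g.toRingHom (coaction K (Fin 2) b)).coeff m = _
  rw [Polynomial.coeff_C_mul, Polynomial.coeff_map]
  rfl

theorem eval_one_gradL_tmul (a : A θ) (b : MvPolynomial (Fin 2) K) :
    (gradL f g (a ⊗ₜ b)).eval 1 = f a * g b := by
  rw [gradL, Algebra.TensorProduct.productMap_apply_tmul]
  change (Polynomial.map f.toRingHom (coactA θ a) * Polynomial.C (g b)).eval 1 = _
  rw [Polynomial.eval_mul, Polynomial.eval_C, Polynomial.eval_one_map,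
    (isCoaction_coactA θ).eval_one]
  rfl

end Coaction

/-- The homomorphism that records the degree of the left factor of a tensor. -/
def coactL (θ : K) := gradL (Algebra.TensorProduct.includeLeft : A θ →ₐ[K]
  A θ ⊗[K] MvPolynomial (Fin 2) K) Algebra.TensorProduct.includeRight

/-- The homomorphism that records the degree of the right factor of a tensor. -/
def coactR (θ : K) := gradR (Algebra.TensorProduct.includeLeft : A θ →ₐ[K]
  A θ ⊗[K] MvPolynomial (Fin 2) K) Algebra.TensorProduct.includeRight

theorem coeff_coactL_tmul (θ : K) (a : A θ) (b : MvPolynomial (Fin 2) K) (m : ℕ) :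
    (coactL θ (a ⊗ₜ b)).coeff m = (coactA θ a).coeff m ⊗ₜ b := by
  rw [coactL, coeff_gradL_tmul]
  simp

theorem coeff_coactR_tmul (θ : K) (a : A θ) (b : MvPolynomial (Fin 2) K) (m : ℕ) :
    (coactR θ (a ⊗ₜ b)).coeff m = a ⊗ₜ (coaction K (Fin 2) b).coeff m := by
  rw [coactR, coeff_gradR_tmul]
  simp

theorem coeff_coactL_coeff_coactL (θ : K) (w : A θ ⊗[K] MvPolynomial (Fin 2) K) (m : ℕ) :
    (coactL θ ((coactL θ w).coeff m)).coeff m = (coactL θ w).coeff m := by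
  induction w with
  | zero => simp
  | add w w' hw hw' => rw [map_add, Polynomial.coeff_add, map_add, Polynomial.coeff_add, hw, hw']
  | tmul a b =>
    rw [coeff_coactL_tmul, coeff_coactL_tmul,
      (isCoaction_coactA θ).apply_of_mem m _ ((isCoaction_coactA θ).coeff_mem a m),
      Polynomial.coeff_C_mul, Polynomial.coeff_X_pow_self, mul_one]

theorem coeff_coactL_coeff_coactR_mem (θ : K) (w : A θ ⊗[K] MvPolynomial (Fin 2) K) (m : ℕ) :
    (coactL θ ((coactR θ w).coeff m)).coeff m ∈ segrePiece (grA θ) (grB K) m := by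
  induction w with
  | zero => simp
  | add w w' hw hw' =>
    rw [map_add, Polynomial.coeff_add, map_add, Polynomial.coeff_add]
    exact add_mem hw hw'
  | tmul a b =>
    rw [coeff_coactR_tmul, coeff_coactL_tmul]
    exact Submodule.subset_span ⟨_, (isCoaction_coactA θ).coeff_mem a m, _,
      isCoaction.coeff_mem b m, rfl⟩

theorem eval_one_coactL (θ : K) (w : A θ ⊗[K] MvPolynomial (Fin 2) K) :
    (coactL θ w).eval 1 = w := by
  induction w with
  | zero => simp
  | add w w' hw hw' => rw [map_add, Polynomial.eval_add, hw, hw']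
  | tmul a b =>
    rw [coactL, eval_one_gradL_tmul]
    simp

/-- Presents `R` as an equalizer. In the converse direction `w` is the sum of its left components,
and the hypothesis makes each of them a right component of the same degree as well. -/
theorem mem_segreProduct_iff (θ : K) (w : A θ ⊗[K] MvPolynomial (Fin 2) K) :
    w ∈ segreProduct (grA θ) (grB K) ↔ coactL θ w = coactR θ w := by
  constructor
  · intro hw
    have hle : ⨆ n, segrePiece (grA θ) (grB K) n ≤
        LinearMap.eqLocus (coactL θ).toLinearMap (coactR θ).toLinearMap := by
      refine iSup_le fun n => Submodule.span_le.2 ?_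
      rintro _ ⟨a, ha, b, hb, rfl⟩
      change coactL θ (a ⊗ₜ b) = coactR θ (a ⊗ₜ b)
      ext m
      rw [coeff_coactL_tmul, coeff_coactR_tmul, (isCoaction_coactA θ).apply_of_mem n a ha,
        isCoaction.apply_of_mem n b hb, Polynomial.coeff_C_mul_X_pow, Polynomial.coeff_C_mul_X_pow]
      split_ifs
      · rfl
      · rw [TensorProduct.zero_tmul, TensorProduct.tmul_zero]
    exact hle hw
  · intro h
    rw [← eval_one_coactL θ w, Polynomial.eval_eq_sum_range]
    refine sum_mem fun m _ => ?_
    -- Projecting a second time on the left allows the inner projection to be replaced by the right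
    -- one, which puts the result in `A_m ⊗ B_m`.
    rw [one_pow, mul_one, ← coeff_coactL_coeff_coactL, h]
    exact Submodule.mem_iSup_of_mem m (coeff_coactL_coeff_coactR_mem θ w m)

/-! ### The Segre product -/

theorem isDomain_R (θ : K) [IsDomain (A θ)] : IsDomain (R θ) :=
  have := isDomain_tensor θ
  (inclR_injective θ).isDomain (inclR θ).toRingHom

/-- An equalizer of two ring homomorphisms into a domain is closed under division, provided they do
not kill the denominator; evaluation at `T = 1` shows that they do not. -/
theorem isIntegrallyClosed_R (θ : K) [IsDomain (A θ)] [IsIntegrallyClosed (A θ)] :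
    IsIntegrallyClosed (R θ) := by
  have := isDomain_tensor θ
  have := isDomain_R θ
  have := isIntegrallyClosed_tensor θ
  refine IsIntegrallyClosed.of_injective (inclR θ).toRingHom (inclR_injective θ) ?_
  intro r s w hs h
  have hmem : ∀ r : R θ, coactL θ (inclR θ r) = coactR θ (inclR θ r) := fun r =>
    (mem_segreProduct_iff θ _).1 r.2
  have hw : coactL θ w = coactR θ w := by
    have h1 := congrArg (coactL θ) h
    have h2 := congrArg (coactR θ) h
    change coactL θ (inclR θ s * w) = coactL θ (inclR θ r) at h1
    change coactR θ (inclR θ s * w) = coactR θ (inclR θ r) at h2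
    rw [map_mul] at h1 h2
    rw [← hmem r, ← h1, hmem s] at h2
    refine (mul_left_cancel₀ (fun h0 => hs ?_) h2).symm
    refine inclR_injective θ ?_
    rw [← eval_one_coactL θ (inclR θ s), hmem, h0, map_zero, Polynomial.eval_zero]
  exact ⟨⟨w, (mem_segreProduct_iff θ w).2 hw⟩, rfl⟩

theorem segrePiece_succ_le (θ : K) {n : ℕ} {V : Submodule K (A θ ⊗[K] MvPolynomial (Fin 2) K)}
    (h : ∀ i j, ∀ w ∈ segrePiece (grA θ) (grB K) n, inclR θ (mon θ i j) * w ∈ V) :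
    segrePiece (grA θ) (grB K) (n + 1) ≤ V := by
  refine Submodule.span_le.2 ?_
  rintro _ ⟨a, ha, b, hb, rfl⟩
  have hA : grA θ (n + 1) ≤ V.comap ((TensorProduct.mk K _ _).flip b) := by
    refine grA_succ_le θ fun i a' ha' => ?_
    have hB : grB K (n + 1) ≤ V.comap (TensorProduct.mk K _ _ (gen θ i * a')) := by
      refine grB_succ_le fun j b' hb' => ?_
      have := h i j (a' ⊗ₜ b') (Submodule.subset_span ⟨a', ha', b', hb', rfl⟩)
      rwa [mon, inclR_tens, Algebra.TensorProduct.tmul_mul_tmul] at this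
    exact hB hb
  exact hA ha

theorem segrePiece_le_range (θ : K) (n : ℕ) :
    segrePiece (grA θ) (grB K) n ≤ LinearMap.range (inclR θ).toLinearMap := fun w hw =>
  ⟨⟨w, Submodule.mem_iSup_of_mem n hw⟩, rfl⟩

theorem exists_smul_one_of_mem_grA_zero (θ : K) {a : A θ} (ha : a ∈ grA θ 0) :
    ∃ c : K, a = c • 1 := by
  obtain ⟨c, hc⟩ := Submodule.mem_one.1 (grA_zero_le θ ha)
  exact ⟨c, by rw [← hc, Algebra.algebraMap_eq_smul_one]⟩

theorem exists_smul_one_of_mem_grB_zero {b : MvPolynomial (Fin 2) K} (hb : b ∈ grB K 0) :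
    ∃ c : K, b = c • 1 := by
  have hb' : b ∈ (1 : Submodule K (MvPolynomial (Fin 2) K)) := grB_zero_le hb
  obtain ⟨c, hc⟩ := Submodule.mem_one.1 hb'
  exact ⟨c, by rw [← hc, Algebra.algebraMap_eq_smul_one]⟩

theorem exists_smul_one_of_mem_segrePiece_zero (θ : K) {w : A θ ⊗[K] MvPolynomial (Fin 2) K}
    (hw : w ∈ segrePiece (grA θ) (grB K) 0) : ∃ c : K, w = c • 1 := by
  induction hw using Submodule.span_induction with
  | mem w hw =>
    obtain ⟨a, ha, b, hb, rfl⟩ := hw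
    obtain ⟨c, rfl⟩ := exists_smul_one_of_mem_grA_zero θ ha
    obtain ⟨d, rfl⟩ := exists_smul_one_of_mem_grB_zero hb
    exact ⟨c * d, TensorProduct.smul_tmul_smul c d 1 1⟩
  | zero => exact ⟨0, (zero_smul K _).symm⟩
  | add w w' _ _ hw hw' =>
    obtain ⟨c, hc⟩ := hw
    obtain ⟨d, hd⟩ := hw'
    exact ⟨c + d, by rw [hc, hd, add_smul]⟩
  | smul c w _ hw =>
    obtain ⟨d, hd⟩ := hw
    exact ⟨c * d, by rw [hd, smul_smul]⟩

theorem eq_top_of_mon_mul_mem (θ : K) {V : Submodule K (R θ)} (h1 : 1 ∈ V)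
    (hm : ∀ i j, ∀ r ∈ V, mon θ i j * r ∈ V) : V = ⊤ := by
  have h : ∀ n, segrePiece (grA θ) (grB K) n ≤ V.map (inclR θ).toLinearMap := by
    intro n
    induction n with
    | zero =>
      intro w hw
      obtain ⟨c, rfl⟩ := exists_smul_one_of_mem_segrePiece_zero θ hw
      refine ⟨c • 1, V.smul_mem _ h1, ?_⟩
      change inclR θ (c • 1) = _
      rw [map_smul, map_one]
    | succ n ih =>
      refine segrePiece_succ_le θ fun i j w hw => ?_
      obtain ⟨r, hr, rfl⟩ := ih hw
      exact ⟨mon θ i j * r, hm i j r hr, map_mul (inclR θ) _ _⟩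
  rw [eq_top_iff]
  rintro r -
  obtain ⟨r', hr', hrr'⟩ := (iSup_le h : _) r.2
  rwa [← inclR_injective θ hrr']

theorem mon_mem (θ : K) (i : Fin 3) (j : Fin 2) : mon θ i j ∈ grR θ 1 :=
  Submodule.subset_span ⟨_, gen_mem θ i, _, var_mem j, rfl⟩

theorem positiveIdeal_eq_span (θ : K) :
    positiveIdeal (grR θ) = Ideal.span (Set.range fun ij : Fin 3 × Fin 2 => mon θ ij.1 ij.2) := by
  refine le_antisymm (Ideal.span_le.2 ?_) (Ideal.span_le.2 ?_)
  · rintro r ⟨n, hn, hr⟩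
    obtain ⟨n, rfl⟩ := Nat.exists_eq_succ_of_ne_zero hn.ne'
    have hle : segrePiece (grA θ) (grB K) (n + 1) ≤ Submodule.map (inclR θ).toLinearMap
        ((Ideal.span (Set.range fun ij : Fin 3 × Fin 2 => mon θ ij.1 ij.2)).restrictScalars K) := by
      refine segrePiece_succ_le θ fun i j w hw => ?_
      obtain ⟨r, rfl⟩ := segrePiece_le_range θ n hw
      exact ⟨mon θ i j * r, Ideal.mul_mem_right _ _ (Ideal.subset_span ⟨(i, j), rfl⟩),
        map_mul (inclR θ) _ _⟩
    obtain ⟨r', hr', hrr'⟩ := hle hr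
    rwa [← inclR_injective θ hrr']
  · rintro _ ⟨⟨i, j⟩, rfl⟩
    exact Ideal.subset_span ⟨1, one_pos, mon_mem θ i j⟩

/-- The homomorphism `R → A` that evaluates the polynomials in `s` and `t`. -/
def evalR (θ : K) (c : Fin 2 → K) : R θ →ₐ[K] A θ :=
  (Algebra.TensorProduct.productMap (AlgHom.id K (A θ)) ((Algebra.ofId K (A θ)).comp (aeval c))).comp
    (inclR θ)

theorem evalR_mon (θ : K) (c : Fin 2 → K) (i : Fin 3) (j : Fin 2) :
    evalR θ c (mon θ i j) = gen θ i * algebraMap K _ (c j) := by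
  rw [evalR, AlgHom.comp_apply, mon, inclR_tens, Algebra.TensorProduct.productMap_apply_tmul, AlgHom.comp_apply,
    aeval_X]
  rfl

theorem gen_ne_zero {θ : K} (hθ : IsPrimitiveRoot θ 3) (i : Fin 3) : gen θ i ≠ 0 := by
  intro h
  have h1 : pointA hθ (gen θ i) = Polynomial.X := liftA_gen _ _ i
  rw [h, map_zero] at h1
  exact Polynomial.X_ne_zero h1.symm

theorem mon_ne_zero {θ : K} (hθ : IsPrimitiveRoot θ 3) (i : Fin 3) (j : Fin 2) : mon θ i j ≠ 0 := by
  intro h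
  have h1 := evalR_mon θ (fun _ => 1) i j
  rw [h, map_zero, map_one, mul_one] at h1
  exact gen_ne_zero hθ i h1.symm

theorem gen_zero_ne_gen_one (θ : K) : gen θ 0 ≠ gen θ 1 := by
  intro hm
  have := polyA_injective θ ((polyA_X θ 0).trans (hm.trans (polyA_X θ 1).symm))
  exact absurd (X_injective this) (by simp)

/-- Specializing `s = 1, t = 0` maps `R` to `A` and kills the elements `mon θ i 1`. The remaining
part of the chain is pulled back from the line over `(1, 1, 1)` and the vertex in `A`. -/
theorem three_le_ringKrullDim_R {θ : K} (hθ : IsPrimitiveRoot θ 3) [IsDomain (A θ)]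
    [IsDomain (R θ)] : ((3 : ℕ) : WithBot ℕ∞) ≤ ringKrullDim (R θ) := by
  let e := (evalR θ ![1, 0]).toRingHom
  let f := (pointA hθ).toRingHom.comp e
  let g := (Polynomial.evalRingHom (0 : K)).comp f
  let p : Fin 4 → PrimeSpectrum (R θ) := ![⟨⊥, Ideal.isPrime_bot⟩,
    ⟨RingHom.ker e, RingHom.ker_isPrime e⟩, ⟨RingHom.ker f, RingHom.ker_isPrime f⟩,
    ⟨RingHom.ker g, RingHom.ker_isPrime g⟩]
  have he0 : ∀ i, e (mon θ i 0) = gen θ i := fun i =>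
    (evalR_mon θ _ i 0).trans (by
      rw [Matrix.cons_val_zero, map_one, mul_one])
  have he1 : ∀ i, e (mon θ i 1) = 0 := fun i =>
    (evalR_mon θ _ i 1).trans (by
      rw [Matrix.cons_val_one, Matrix.cons_val_fin_one, map_zero, mul_zero])
  have hf0 : ∀ i, f (mon θ i 0) = Polynomial.X := fun i => by
    rw [RingHom.comp_apply, he0]
    exact liftA_gen _ _ i
  refine le_ringKrullDim_of_strictMono p (Fin.strictMono_iff_lt_succ.2 fun i => ?_)
  fin_cases i
  · change (⊥ : Ideal (R θ)) < RingHom.ker e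
    refine lt_of_le_of_ne bot_le fun h => ?_
    have hm : mon θ 0 1 ∈ RingHom.ker e := he1 0
    rw [← h, Ideal.mem_bot] at hm
    exact mon_ne_zero hθ 0 1 hm
  · change RingHom.ker e < RingHom.ker f
    refine lt_of_le_of_ne (fun a ha => by
      rw [RingHom.mem_ker] at ha ⊢
      rw [RingHom.comp_apply, ha, map_zero]) fun h => ?_
    have hm : mon θ 0 0 - mon θ 1 0 ∈ RingHom.ker f := by
      rw [RingHom.mem_ker, map_sub, hf0, hf0, sub_self]
    rw [← h, RingHom.mem_ker, map_sub, he0, he0, sub_eq_zero] at hm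
    exact gen_zero_ne_gen_one θ hm
  · change RingHom.ker f < RingHom.ker g
    refine lt_of_le_of_ne (fun a ha => by
      rw [RingHom.mem_ker] at ha ⊢
      rw [RingHom.comp_apply, ha, map_zero]) fun h => ?_
    have hm : mon θ 0 0 ∈ RingHom.ker g := by
      rw [RingHom.mem_ker, RingHom.comp_apply, hf0]
      simp
    rw [← h, RingHom.mem_ker, hf0] at hm
    exact Polynomial.X_ne_zero hm

/-- The ring is the sum of `K` and the ideal, so the ideal is the kernel of the augmentation `R →
K`. -/
theorem isMaximal_positiveIdeal {θ : K} (hθ : IsPrimitiveRoot θ 3) :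
    (positiveIdeal (grR θ)).IsMaximal := by
  let g : R θ →ₐ[K] K := ((Polynomial.aeval (0 : K)).comp (pointA hθ)).comp (evalR θ 0)
  have hg : ∀ i j, g (mon θ i j) = 0 := fun i j => by
    change Polynomial.aeval (0 : K) (pointA hθ (evalR θ 0 (mon θ i j))) = 0
    rw [evalR_mon, Pi.zero_apply, map_zero, mul_zero, map_zero, map_zero]
  have hle : positiveIdeal (grR θ) ≤ RingHom.ker g := by
    rw [positiveIdeal_eq_span, Ideal.span_le]
    rintro _ ⟨⟨i, j⟩, rfl⟩
    exact hg i j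
  have htop : Submodule.span K {(1 : R θ)} ⊔ (positiveIdeal (grR θ)).restrictScalars K = ⊤ := by
    refine eq_top_of_mon_mul_mem θ (Submodule.mem_sup_left (Submodule.mem_span_singleton_self _))
      fun i j r _ => Submodule.mem_sup_right ?_
    exact Ideal.mul_mem_right _ _ (Ideal.subset_span ⟨1, one_pos, mon_mem θ i j⟩)
  have hker : positiveIdeal (grR θ) = RingHom.ker g := by
    refine le_antisymm hle fun r hr => ?_
    obtain ⟨c', hc', m, hm, rfl⟩ := Submodule.mem_sup.1 (htop ▸ Submodule.mem_top : r ∈ _)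
    obtain ⟨c, rfl⟩ := Submodule.mem_span_singleton.1 hc'
    have hm' : g m = 0 := hle hm
    rw [RingHom.mem_ker, map_add, hm', add_zero, map_smul, map_one, smul_eq_mul, mul_one] at hr
    rwa [hr, zero_smul, zero_add]
  rw [hker]
  exact RingHom.ker_isMaximal_of_surjective g.toRingHom fun c =>
    ⟨algebraMap K _ c, g.commutes c⟩

/-! ### Relations between the generators -/

theorem mon_mul_mon (θ : K) (i i' : Fin 3) (j j' : Fin 2) :
    mon θ i j * mon θ i' j' = mon θ i j' * mon θ i' j := by
  refine inclR_injective θ ?_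
  simp only [map_mul, mon, inclR_tens, Algebra.TensorProduct.tmul_mul_tmul]
  rw [mul_comm (X j)]

theorem mon_cubic (θ : K) (j₁ j₂ j₃ : Fin 2) :
    algebraMap K (R θ) θ * (mon θ 0 j₁ * mon θ 0 j₂ * mon θ 0 j₃) +
      algebraMap K (R θ) θ ^ 2 * (mon θ 1 j₁ * mon θ 1 j₂ * mon θ 1 j₃) +
      mon θ 2 j₁ * mon θ 2 j₂ * mon θ 2 j₃ = 0 := by
  refine inclR_injective θ ?_
  have h := congrArg (fun a => a ⊗ₜ[K] (X j₁ * X j₂ * X j₃ : MvPolynomial (Fin 2) K))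
    (cubic_relation θ)
  simp only [TensorProduct.add_tmul, TensorProduct.zero_tmul, ← map_pow, ← Algebra.smul_def,
    ← TensorProduct.smul_tmul'] at h
  simp only [map_add, map_mul, map_zero, mon, inclR_tens, Algebra.TensorProduct.tmul_mul_tmul,
    ← map_pow, ← Algebra.smul_def, map_smul]
  simpa only [pow_succ, pow_zero, one_mul] using h

theorem radical_params {θ : K} (hθ : IsPrimitiveRoot θ 3) :
    (Ideal.span (Set.range (params θ))).radical = positiveIdeal (grR θ) := by
  have hmax := isMaximal_positiveIdeal hθ
  set I := Ideal.span (Set.range (params θ)) with hI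
  have h0 : mon θ 0 0 ∈ I := Ideal.subset_span ⟨0, rfl⟩
  have h1 : mon θ 1 1 ∈ I := Ideal.subset_span ⟨1, rfl⟩
  have h2 : mon θ 1 0 + mon θ 0 1 ∈ I := Ideal.subset_span ⟨2, rfl⟩
  refine le_antisymm ?_ ?_
  · refine (Ideal.radical_mono (Ideal.span_le.2 ?_)).trans hmax.isPrime.radical.le
    have hm : ∀ i j, mon θ i j ∈ positiveIdeal (grR θ) := fun i j =>
      Ideal.subset_span ⟨1, one_pos, mon_mem θ i j⟩
    rintro _ ⟨i, rfl⟩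
    fin_cases i
    exacts [hm 0 0, hm 1 1, add_mem (hm 1 0) (hm 0 1)]
  · have r10 : mon θ 1 0 ∈ I.radical := by
      refine ⟨2, ?_⟩
      -- The elements `sy` and `tx` are the roots of `T² - (sy + tx)T + (sx)(ty)`.
      have : mon θ 1 0 ^ 2 = mon θ 1 0 * (mon θ 1 0 + mon θ 0 1) - mon θ 0 0 * mon θ 1 1 := by
        linear_combination -mon_mul_mon θ 1 0 0 1
      rw [this]
      exact sub_mem (I.mul_mem_left _ h2) (I.mul_mem_right _ h0)
    have r01 : mon θ 0 1 ∈ I.radical := by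
      have : mon θ 0 1 = (mon θ 1 0 + mon θ 0 1) - mon θ 1 0 := by ring
      rw [this]
      exact sub_mem (Ideal.le_radical h2) r10
    have hx : ∀ i j, i ≠ 2 → mon θ i j ∈ I.radical := by
      intro i j hi
      fin_cases i <;> fin_cases j
      exacts [Ideal.le_radical h0, r01, r10, Ideal.le_radical h1, absurd rfl hi, absurd rfl hi]
    rw [positiveIdeal_eq_span, Ideal.span_le]
    rintro _ ⟨⟨i, j⟩, rfl⟩
    by_cases hi : i = 2
    · subst hi
      refine Ideal.radical_isRadical I ⟨3, ?_⟩
      have : mon θ 2 j ^ 3 = -(algebraMap K (R θ) θ * (mon θ 0 j * mon θ 0 j) * mon θ 0 j) -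
          (algebraMap K (R θ) θ ^ 2 * (mon θ 1 j * mon θ 1 j)) * mon θ 1 j := by
        linear_combination mon_cubic θ j j j
      rw [this]
      exact sub_mem (neg_mem (Ideal.mul_mem_left _ _ (hx 0 j (by decide))))
        (Ideal.mul_mem_left _ _ (hx 1 j (by decide)))
    · exact hx i j hi

end Cubic
end

noncomputable section

namespace Cubic

open MvPolynomial

variable {K : Type u} [Field K]

/-! ### The Segre product over the polynomial ring on the parameters -/

/-- The map `K[u,v,w] → R` given by the system of parameters. -/
def polyR (θ : K) : MvPolynomial (Fin 3) K →ₐ[K] R θ := aeval (params θ)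

theorem polyR_X (θ : K) (i : Fin 3) : polyR θ (X i) = params θ i := aeval_X _ _

/-- Generators of `R` as a module over `K[u,v,w]`. -/
def modGen (θ : K) : Fin 7 → R θ :=
  ![1, mon θ 1 0, mon θ 2 0, mon θ 2 1, mon θ 2 0 ^ 2, mon θ 2 0 * mon θ 2 1, mon θ 2 1 ^ 2]

/-- The combination of the module generators with coefficients `p`. -/
def modComb (θ : K) (p : Fin 7 → MvPolynomial (Fin 3) K) : R θ :=
  ∑ j, polyR θ (p j) * modGen θ j

theorem modComb_eq (θ : K) (p : Fin 7 → MvPolynomial (Fin 3) K) :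
    modComb θ p = polyR θ (p 0) + polyR θ (p 1) * mon θ 1 0 + polyR θ (p 2) * mon θ 2 0 +
      polyR θ (p 3) * mon θ 2 1 + polyR θ (p 4) * mon θ 2 0 ^ 2 +
      polyR θ (p 5) * (mon θ 2 0 * mon θ 2 1) + polyR θ (p 6) * mon θ 2 1 ^ 2 := by
  rw [modComb, Fin.sum_univ_seven]
  simp [modGen]

theorem modComb_add (θ : K) (p q : Fin 7 → MvPolynomial (Fin 3) K) :
    modComb θ (p + q) = modComb θ p + modComb θ q := by
  simp only [modComb, Pi.add_apply, map_add, add_mul, Finset.sum_add_distrib]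

theorem modComb_sub (θ : K) (p q : Fin 7 → MvPolynomial (Fin 3) K) :
    modComb θ (p - q) = modComb θ p - modComb θ q := by
  simp only [modComb, Pi.sub_apply, map_sub, sub_mul, Finset.sum_sub_distrib]

theorem modComb_smul (θ : K) (a : MvPolynomial (Fin 3) K) (p : Fin 7 → MvPolynomial (Fin 3) K) :
    modComb θ (a • p) = polyR θ a * modComb θ p := by
  simp only [modComb, Pi.smul_apply, smul_eq_mul, map_mul, mul_assoc, Finset.mul_sum]

theorem exists_sy_mul_modComb (θ : K) (p : Fin 7 → MvPolynomial (Fin 3) K) :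
    ∃ q, modComb θ q = mon θ 1 0 * modComb θ p := by
  -- With `u = sx`, `v = ty`, `w = sy + tx`, the coefficients come from `(sy)² = w·sy - uv`, `sy·sz
  -- = w·sz - u·tz` and `sy·tz = v·sz`.
  refine ⟨![-(X 0 * X 1 * p 1), p 0 + X 2 * p 1, X 2 * p 2 + X 1 * p 3, -(X 0 * p 2),
    X 2 * p 4 + X 1 * p 5, -(X 0 * p 4) + X 1 * p 6, 0], ?_⟩
  have h1 := mon_mul_mon θ 1 0 0 1
  have h2 := mon_mul_mon θ 2 0 0 1
  have h3 := mon_mul_mon θ 1 2 0 1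
  simp only [modComb_eq, map_add, map_mul, map_neg, polyR_X, params, Matrix.cons_val_zero,
    Matrix.cons_val_one, Matrix.cons_val, map_zero]
  linear_combination polyR θ (p 1) * h1 + polyR θ (p 2) * h2 - polyR θ (p 3) * h3 +
    polyR θ (p 4) * mon θ 2 0 * h2 - polyR θ (p 5) * mon θ 2 0 * h3 - polyR θ (p 6) * mon θ 2 1 * h3

theorem exists_sz_mul_modComb (θ : K) (p : Fin 7 → MvPolynomial (Fin 3) K) :
    ∃ q, modComb θ q = mon θ 2 0 * modComb θ p := by
  -- Only the products of degree three in `z` need the cubic relation. For instance `(sz)³ = -θu³ -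
  -- θ²(sy)³`, where `(sy)³ = (w² - uv)·sy - uvw`.
  refine ⟨![p 4 * (-(C θ * X 0 ^ 3) + C θ ^ 2 * (X 0 * X 1 * X 2)) +
      p 5 * (-(C θ * X 0 ^ 2 * X 2) + C θ ^ 2 * (X 0 * X 1 ^ 2)) +
      p 6 * (-(C θ * X 0 * (X 2 ^ 2 - X 0 * X 1))),
    p 4 * (-(C θ ^ 2 * (X 2 ^ 2 - X 0 * X 1))) + p 5 * (C θ * X 0 ^ 2 - C θ ^ 2 * (X 1 * X 2)) +
      p 6 * (C θ * (X 0 * X 2) - C θ ^ 2 * X 1 ^ 2),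
    p 0 + X 2 * p 1, -(X 0 * p 1), p 2, p 3, 0], ?_⟩
  have h1 := mon_mul_mon θ 1 0 0 1
  have h2 := mon_mul_mon θ 2 0 0 1
  have hC : polyR θ (C θ) = algebraMap K (R θ) θ := by
    rw [← MvPolynomial.algebraMap_eq, AlgHom.commutes]
  simp only [modComb_eq, map_add, map_sub, map_mul, map_neg, map_pow, polyR_X, params, hC,
    Matrix.cons_val_zero, Matrix.cons_val_one, Matrix.cons_val, map_zero]
  linear_combination polyR θ (p 1) * h2 -
    polyR θ (p 4) * (mon_cubic θ 0 0 0 +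
      algebraMap K (R θ) θ ^ 2 * (mon θ 1 0 + mon θ 0 1 + mon θ 1 0) * h1) -
    polyR θ (p 5) * (mon_cubic θ 0 0 1 + algebraMap K (R θ) θ ^ 2 * mon θ 1 1 * h1) -
    polyR θ (p 6) * (mon_cubic θ 0 1 1 + algebraMap K (R θ) θ * mon θ 0 0 * h1)

theorem exists_tz_mul_modComb (θ : K) (p : Fin 7 → MvPolynomial (Fin 3) K) :
    ∃ q, modComb θ q = mon θ 2 1 * modComb θ p := by
  refine ⟨![p 4 * (-(C θ * X 0 ^ 2 * X 2) + C θ ^ 2 * (X 0 * X 1 ^ 2)) +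
      p 5 * (-(C θ * X 0 * (X 2 ^ 2 - X 0 * X 1))) +
      p 6 * (-(C θ * (X 2 ^ 3 - 2 * (X 0 * X 1 * X 2))) - C θ ^ 2 * X 1 ^ 3),
    p 4 * (C θ * X 0 ^ 2 - C θ ^ 2 * (X 1 * X 2)) +
      p 5 * (C θ * (X 0 * X 2) - C θ ^ 2 * X 1 ^ 2) + p 6 * (C θ * (X 2 ^ 2 - X 0 * X 1)),
    X 1 * p 1, p 0, 0, p 2, p 3], ?_⟩
  have h1 := mon_mul_mon θ 1 0 0 1
  have h3 := mon_mul_mon θ 1 2 0 1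
  have hC : polyR θ (C θ) = algebraMap K (R θ) θ := by
    rw [← MvPolynomial.algebraMap_eq, AlgHom.commutes]
  simp only [modComb_eq, map_add, map_sub, map_mul, map_neg, map_pow, polyR_X, params, hC,
    Matrix.cons_val_zero, Matrix.cons_val_one, Matrix.cons_val, map_zero, map_ofNat]
  linear_combination -polyR θ (p 1) * h3 -
    polyR θ (p 4) * (mon_cubic θ 0 0 1 + algebraMap K (R θ) θ ^ 2 * mon θ 1 1 * h1) -
    polyR θ (p 5) * (mon_cubic θ 0 1 1 + algebraMap K (R θ) θ * mon θ 0 0 * h1) -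
    polyR θ (p 6) * (mon_cubic θ 1 1 1 +
      algebraMap K (R θ) θ * (2 * (mon θ 1 0 + mon θ 0 1) - mon θ 1 0) * h1)

/-- The image contains `1` and is stable under multiplication by the six generators of `R`, where
`tx` acts as `w - sy`. -/
theorem modComb_surjective (θ : K) : Function.Surjective (modComb θ) := by
  let V : Submodule K (R θ) :=
    { carrier := Set.range (modComb θ)
      add_mem' := by
        rintro _ _ ⟨p, rfl⟩ ⟨q, rfl⟩
        exact ⟨p + q, modComb_add θ p q⟩
      zero_mem' := ⟨0, by simp [modComb]⟩
      smul_mem' := by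
        rintro c _ ⟨p, rfl⟩
        refine ⟨(C c : MvPolynomial (Fin 3) K) • p, ?_⟩
        rw [modComb_smul, ← MvPolynomial.algebraMap_eq, AlgHom.commutes, Algebra.smul_def] }
  have hpoly : ∀ a, ∀ r ∈ V, polyR θ a * r ∈ V := by
    rintro a _ ⟨p, rfl⟩
    exact ⟨a • p, modComb_smul θ a p⟩
  have h0 : ∀ r ∈ V, mon θ 0 0 * r ∈ V := fun r hr => by
    have := hpoly (X 0) r hr
    rwa [polyR_X] at this
  have h11 : ∀ r ∈ V, mon θ 1 1 * r ∈ V := fun r hr => by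
    have := hpoly (X 1) r hr
    rwa [polyR_X] at this
  have h10 : ∀ r ∈ V, mon θ 1 0 * r ∈ V := by
    rintro _ ⟨p, rfl⟩
    exact exists_sy_mul_modComb θ p
  have h01 : ∀ r ∈ V, mon θ 0 1 * r ∈ V := fun r hr => by
    have h := V.sub_mem (hpoly (X 2) r hr) (h10 r hr)
    rw [polyR_X] at h
    have e : params θ 2 * r - mon θ 1 0 * r = mon θ 0 1 * r := by
      change (mon θ 1 0 + mon θ 0 1) * r - _ = _
      ring
    rwa [e] at h
  have h20 : ∀ r ∈ V, mon θ 2 0 * r ∈ V := by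
    rintro _ ⟨p, rfl⟩
    exact exists_sz_mul_modComb θ p
  have h21 : ∀ r ∈ V, mon θ 2 1 * r ∈ V := by
    rintro _ ⟨p, rfl⟩
    exact exists_tz_mul_modComb θ p
  have htop : V = ⊤ := by
    refine eq_top_of_mon_mul_mem θ ⟨![1, 0, 0, 0, 0, 0, 0], ?_⟩ fun i j => ?_
    · simp [modComb_eq]
    · fin_cases i <;> fin_cases j
      exacts [h0, h01, h10, h11, h20, h21]
  intro r
  exact (htop ▸ Submodule.mem_top : r ∈ V)

theorem finite_polyR (θ : K) : (polyR θ).toRingHom.Finite := by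
  let := (polyR θ).toRingHom.toAlgebra
  change Module.Finite (MvPolynomial (Fin 3) K) (R θ)
  refine Module.finite_def.2 (Submodule.fg_def.2
    ⟨Set.range (modGen θ), Set.finite_range _, ?_⟩)
  rw [eq_top_iff]
  rintro r -
  obtain ⟨p, rfl⟩ := modComb_surjective θ r
  exact sum_mem fun j _ => Submodule.smul_mem _ (p j) (Submodule.subset_span ⟨j, rfl⟩)

theorem polyR_injective {θ : K} (hθ : IsPrimitiveRoot θ 3) [IsDomain (A θ)] :
    Function.Injective (polyR θ) :=
  have := isDomain_R θ
  injective_of_isIntegral_of_le_ringKrullDim (polyR θ).toRingHom (finite_polyR θ).to_isIntegral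
    (three_le_ringKrullDim_R hθ)

theorem ringKrullDim_R {θ : K} (hθ : IsPrimitiveRoot θ 3) [IsDomain (A θ)] :
    ringKrullDim (R θ) = 3 := by
  have := isDomain_R θ
  refine le_antisymm ?_ (three_le_ringKrullDim_R hθ)
  refine (finite_polyR θ).to_isIntegral.ringKrullDim_le.trans ?_
  simp

end Cubic
end

noncomputable section

namespace Cubic

open MvPolynomial

variable {K : Type u} [Field K]

/-! ### Relations between the module generators -/

variable (K) in
/-- The ring `K[x,y] ⊗ K[s,t]`. -/
abbrev BiPoly : Type u := MvPolynomial (Fin 2) K ⊗[K] MvPolynomial (Fin 2) K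

variable (K) in
/-- The map `K[u,v,w] → K[x,y] ⊗ K[s,t]` given by `sx`, `ty`, `sy + tx`. -/
def polyBi : MvPolynomial (Fin 3) K →ₐ[K] BiPoly K :=
  aeval ![X 0 ⊗ₜ X 0, X 1 ⊗ₜ X 1, X 1 ⊗ₜ X 0 + X 0 ⊗ₜ X 1]

/-- The inclusion of `K[x,y] ⊗ K[s,t]` in `A ⊗ K[s,t]`. -/
def biA (θ : K) : BiPoly K →ₐ[K] A θ ⊗[K] MvPolynomial (Fin 2) K :=
  Algebra.TensorProduct.map (polyA θ) (AlgHom.id K _)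

theorem biA_tmul (θ : K) (p q : MvPolynomial (Fin 2) K) : biA θ (p ⊗ₜ q) = polyA θ p ⊗ₜ q :=
  Algebra.TensorProduct.map_tmul _ _ _ _

theorem biA_injective (θ : K) : Function.Injective (biA θ) :=
  Module.Flat.rTensor_preserves_injective_linearMap (M := MvPolynomial (Fin 2) K)
    (polyA θ).toLinearMap (polyA_injective θ)

theorem biA_polyBi (θ : K) (p : MvPolynomial (Fin 3) K) :
    biA θ (polyBi K p) = inclR θ (polyR θ p) := by
  have h0 : polyA θ (X 0) = gen θ 0 := polyA_X θ 0
  have h1 : polyA θ (X 1) = gen θ 1 := polyA_X θ 1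
  have : (biA θ).comp (polyBi K) = (inclR θ).comp (polyR θ) := by
    refine MvPolynomial.algHom_ext fun i => ?_
    rw [AlgHom.comp_apply, AlgHom.comp_apply, polyR_X, polyBi, aeval_X]
    fin_cases i
    · change biA θ (X 0 ⊗ₜ X 0) = gen θ 0 ⊗ₜ X 0
      rw [biA_tmul, h0]
    · change biA θ (X 1 ⊗ₜ X 1) = gen θ 1 ⊗ₜ X 1
      rw [biA_tmul, h1]
    · change biA θ (X 1 ⊗ₜ X 0 + X 0 ⊗ₜ X 1) = inclR θ (mon θ 1 0 + mon θ 0 1)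
      rw [map_add, biA_tmul, biA_tmul, h0, h1, map_add]
      rfl
  exact DFunLike.congr_fun this p

/-- The parameters are symmetric under exchanging `(x, y)` with `(s, t)`. This symmetry supplies a
second equation for every relation over `K[u,v,w]`. -/
theorem comm_polyBi (p : MvPolynomial (Fin 3) K) :
    Algebra.TensorProduct.comm K _ _ (polyBi K p) = polyBi K p := by
  have : (Algebra.TensorProduct.comm K _ _).toAlgHom.comp (polyBi K) = polyBi K := by
    refine MvPolynomial.algHom_ext fun i => ?_
    rw [AlgHom.comp_apply, polyBi, aeval_X]
    change Algebra.TensorProduct.comm K _ _ _ = _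
    fin_cases i
    · exact Algebra.TensorProduct.comm_tmul K _ _
    · exact Algebra.TensorProduct.comm_tmul K _ _
    · change Algebra.TensorProduct.comm K _ _ (X 1 ⊗ₜ X 0 + X 0 ⊗ₜ X 1) = X 1 ⊗ₜ X 0 + X 0 ⊗ₜ X 1
      rw [map_add, Algebra.TensorProduct.comm_tmul, Algebra.TensorProduct.comm_tmul, add_comm]
  exact DFunLike.congr_fun this p

theorem polyBi_injective {θ : K} (hθ : IsPrimitiveRoot θ 3) [IsDomain (A θ)] :
    Function.Injective (polyBi K) := fun p q h => by
  refine polyR_injective hθ (inclR_injective θ ?_)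
  rw [← biA_polyBi, h, biA_polyBi]

theorem biPoly_sub_ne_zero :
    (X 1 ⊗ₜ X 0 - X 0 ⊗ₜ X 1 : BiPoly K) ≠ 0 := by
  intro h
  have := congrArg (Algebra.TensorProduct.productMap (aeval ![(0 : K), 1])
    (aeval ![(1 : K), 0] : MvPolynomial (Fin 2) K →ₐ[K] K)) h
  rw [map_sub, Algebra.TensorProduct.productMap_apply_tmul,
    Algebra.TensorProduct.productMap_apply_tmul, map_zero] at this
  simp at this

/-- The elements `1 ⊗ s` and `1 ⊗ t`. -/
def biVar (K : Type u) [Field K] (j : Fin 2) : BiPoly K := 1 ⊗ₜ X j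

/-- The elements `x ⊗ 1` and `y ⊗ 1`. -/
def biVar' (K : Type u) [Field K] (j : Fin 2) : BiPoly K := X j ⊗ₜ 1

theorem comm_biVar (j : Fin 2) :
    Algebra.TensorProduct.comm K _ _ (biVar K j) = biVar' K j :=
  Algebra.TensorProduct.comm_tmul K _ _

theorem comm_biVar' (j : Fin 2) :
    Algebra.TensorProduct.comm K _ _ (biVar' K j) = biVar K j :=
  Algebra.TensorProduct.comm_tmul K _ _

theorem biVar'_mul_biVar (i j : Fin 2) : biVar' K i * biVar K j = X i ⊗ₜ X j := by
  rw [biVar, biVar', Algebra.TensorProduct.tmul_mul_tmul, mul_one, one_mul]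

theorem polyBi_X_zero : polyBi K (X 0) = biVar' K 0 * biVar K 0 := by
  rw [polyBi, aeval_X, biVar'_mul_biVar]
  rfl

theorem polyBi_X_one : polyBi K (X 1) = biVar' K 1 * biVar K 1 := by
  rw [polyBi, aeval_X, biVar'_mul_biVar]
  rfl

theorem polyBi_X_two : polyBi K (X 2) = biVar' K 1 * biVar K 0 + biVar' K 0 * biVar K 1 := by
  rw [polyBi, aeval_X, biVar'_mul_biVar, biVar'_mul_biVar]
  rfl

/-- The coefficients of `1`, `z` and `z²` in an element of `R`. -/
theorem inclR_modComb (θ : K) (p : Fin 7 → MvPolynomial (Fin 3) K) :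
    inclR θ (modComb θ p) =
      biA θ (polyBi K (p 0) + polyBi K (p 1) * (biVar' K 1 * biVar K 0)) +
      biA θ (polyBi K (p 2) * biVar K 0 + polyBi K (p 3) * biVar K 1) * (gen θ 2 ⊗ₜ 1) +
      biA θ (polyBi K (p 4) * biVar K 0 ^ 2 + polyBi K (p 5) * (biVar K 0 * biVar K 1) +
        polyBi K (p 6) * biVar K 1 ^ 2) * (gen θ 2 ⊗ₜ 1) ^ 2 := by
  have hv : ∀ j, biA θ (biVar K j) = 1 ⊗ₜ X j := fun j => by rw [biVar, biA_tmul, map_one]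
  have hv' : biA θ (biVar' K 1) = gen θ 1 ⊗ₜ 1 := by
    rw [biVar', biA_tmul, polyA_X]
    rfl
  have hm : ∀ i j, inclR θ (mon θ i j) = (gen θ i ⊗ₜ 1) * (1 ⊗ₜ X j) := fun i j => by
    rw [mon, inclR_tens, Algebra.TensorProduct.tmul_mul_tmul, mul_one, one_mul]
  simp only [modComb_eq, map_add, map_mul, map_pow, biA_polyBi, hv, hv', hm]
  ring

/-- The three summands are eigenvectors of `σ` for the eigenvalues `1, τ, τ²`, so applying `σ` twice
and combining isolates each up to a factor `3`. -/
theorem eq_zero_of_add_mul_add_mul {D : Type*} [CommRing D] [IsDomain D] [CharZero D]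
    (σ : D →+* D) {z τ a b c : D} (hτ : 1 + τ + τ ^ 2 = 0) (hτσ : σ τ = τ)
    (hz : z ≠ 0) (hσz : σ z = τ * z) (ha : σ a = a) (hb : σ b = b) (hc : σ c = c)
    (h : a + b * z + c * z ^ 2 = 0) : a = 0 ∧ b = 0 ∧ c = 0 := by
  have h1 := congrArg σ h
  have h2 := congrArg σ h1
  simp only [map_add, map_mul, map_pow, ha, hb, hc, hσz, hτσ, map_zero] at h1 h2
  have h3 : (3 : D) ≠ 0 := OfNat.ofNat_ne_zero 3
  have e : τ ^ 3 = 1 := by linear_combination (τ - 1) * hτ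
  refine ⟨?_, ?_, ?_⟩
  · refine (mul_eq_zero.1 (?_ : 3 * a = 0)).resolve_left h3
    linear_combination h + h1 + h2 - b * z * hτ - c * z ^ 2 * ((1 - τ + τ ^ 2) * hτ)
  · refine (mul_eq_zero.1 (?_ : 3 * z * b = 0)).resolve_left (mul_ne_zero h3 hz)
    linear_combination h + τ ^ 2 * h1 + τ * h2 - a * hτ - c * z ^ 2 * (hτ + (τ + τ ^ 2) * e) - 2 * b * z * e
  · refine (mul_eq_zero.1 (?_ : 3 * z ^ 2 * c = 0)).resolve_left (mul_ne_zero h3 (pow_ne_zero 2 hz))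
    linear_combination h + τ * h1 + τ ^ 2 * h2 - a * hτ - b * z * (hτ + τ * e) - c * z ^ 2 * (2 + τ ^ 3) * e

theorem map_rotA_biA {θ : K} (hθ : θ ^ 3 = 1) (q : BiPoly K) :
    Algebra.TensorProduct.map (rotA hθ) (AlgHom.id K (MvPolynomial (Fin 2) K)) (biA θ q) =
      biA θ q := by
  have : (Algebra.TensorProduct.map (rotA hθ) (AlgHom.id K (MvPolynomial (Fin 2) K))).comp
      (biA θ) = biA θ := by
    refine Algebra.TensorProduct.ext' fun p p' => ?_
    rw [AlgHom.comp_apply, biA_tmul, Algebra.TensorProduct.map_tmul, rotA_polyA]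
    rfl
  exact DFunLike.congr_fun this q

theorem biA_eq_zero_of_modComb_eq_zero [CharZero K] {θ : K} (hθ : IsPrimitiveRoot θ 3)
    [IsDomain (A θ)] {p : Fin 7 → MvPolynomial (Fin 3) K} (h : modComb θ p = 0) :
    polyBi K (p 0) + polyBi K (p 1) * (biVar' K 1 * biVar K 0) = 0 ∧
      polyBi K (p 2) * biVar K 0 + polyBi K (p 3) * biVar K 1 = 0 ∧
      polyBi K (p 4) * biVar K 0 ^ 2 + polyBi K (p 5) * (biVar K 0 * biVar K 1) +
        polyBi K (p 6) * biVar K 1 ^ 2 = 0 := by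
  have h1 : θ ^ 3 = 1 := hθ.pow_eq_one
  have hs : 1 + θ + θ ^ 2 = 0 := by
    have := hθ.geom_sum_eq_zero (by norm_num)
    simpa [Finset.sum_range_succ] using this
  have := isDomain_tensor θ
  have : CharZero (A θ ⊗[K] MvPolynomial (Fin 2) K) :=
    charZero_of_injective_algebraMap
      (algebraMap K (A θ ⊗[K] MvPolynomial (Fin 2) K)).injective
  have hτ := congrArg (algebraMap K (A θ ⊗[K] MvPolynomial (Fin 2) K)) hs
  rw [map_add, map_add, map_pow, map_one, map_zero] at hτ
  have hz : (gen θ 2 ⊗ₜ 1 : A θ ⊗[K] MvPolynomial (Fin 2) K) ≠ 0 := by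
    intro h0
    have := congrArg (inclR θ (mon θ 2 0) * ·) h0
    have e : inclR θ (mon θ 2 0) = (gen θ 2 ⊗ₜ 1) * (1 ⊗ₜ X 0) := by
      rw [mon, inclR_tens, Algebra.TensorProduct.tmul_mul_tmul, mul_one, one_mul]
    rw [h0, zero_mul, ← map_zero (inclR θ)] at e
    exact mon_ne_zero hθ 2 0 (inclR_injective θ e)
  have h' := congrArg (inclR θ) h
  rw [inclR_modComb, map_zero] at h'
  have key := eq_zero_of_add_mul_add_mul
    (Algebra.TensorProduct.map (rotA h1) (AlgHom.id K (MvPolynomial (Fin 2) K))).toRingHom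
    hτ (AlgHom.commutes _ _) hz (by
      change Algebra.TensorProduct.map _ _ _ = _
      rw [Algebra.TensorProduct.map_tmul, rotA_gen_two, map_one, ← Algebra.smul_def,
        ← Algebra.smul_def, TensorProduct.smul_tmul'])
    (map_rotA_biA h1 _) (map_rotA_biA h1 _) (map_rotA_biA h1 _) h'
  simp only [← map_zero (biA θ)] at key
  exact ⟨biA_injective θ key.1, biA_injective θ key.2.1, biA_injective θ key.2.2⟩

/-- The syzygies of the module generators. -/
theorem syzygy_of_modComb_eq_zero [CharZero K] {θ : K} (hθ : IsPrimitiveRoot θ 3)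
    [IsDomain (A θ)] {p : Fin 7 → MvPolynomial (Fin 3) K} (h : modComb θ p = 0) :
    p 0 = 0 ∧ p 1 = 0 ∧ p 2 = 0 ∧ p 3 = 0 ∧
      ∃ q, p 4 = X 1 * q ∧ p 5 = -(X 2 * q) ∧ p 6 = X 0 * q := by
  obtain ⟨h0, h1, h2⟩ := biA_eq_zero_of_modComb_eq_zero hθ h
  have : IsDomain (BiPoly K) := by
    have := isDomain_tensor θ
    exact (biA_injective θ).isDomain (biA θ).toRingHom
  -- The swap fixes the coefficients from `K[u,v,w]`, and eliminating between an equation and its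
  -- swap leaves a multiple of `sy - tx`, which is nonzero.
  have h0' := congrArg (Algebra.TensorProduct.comm K _ _) h0
  have h1' := congrArg (Algebra.TensorProduct.comm K _ _) h1
  have h2' := congrArg (Algebra.TensorProduct.comm K _ _) h2
  simp only [map_add, map_mul, map_pow, map_zero, comm_polyBi, comm_biVar, comm_biVar'] at h0' h1' h2'
  have hD : biVar' K 1 * biVar K 0 - biVar' K 0 * biVar K 1 ≠ 0 := by
    rw [biVar'_mul_biVar, biVar'_mul_biVar]
    exact biPoly_sub_ne_zero
  have hinj := polyBi_injective hθ
  have cancel : ∀ a : MvPolynomial (Fin 3) K,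
      polyBi K a * (biVar' K 1 * biVar K 0 - biVar' K 0 * biVar K 1) = 0 → a = 0 := fun a ha =>
    hinj (((mul_eq_zero.1 ha).resolve_right hD).trans (map_zero _).symm)
  have e1 : p 1 = 0 := cancel _ (by linear_combination h0 - h0')
  have e0 : p 0 = 0 := by
    rw [e1, map_zero, zero_mul, add_zero] at h0
    exact hinj (h0.trans (map_zero _).symm)
  have e2 : p 2 = 0 := cancel _ (by linear_combination biVar' K 1 * h1 - biVar K 1 * h1')
  have e3 : p 3 = 0 := cancel _ (by linear_combination biVar K 0 * h1' - biVar' K 0 * h1)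
  have e45 : p 4 * X 2 + p 5 * X 1 = 0 := cancel _ (by
    rw [map_add, map_mul, map_mul, polyBi_X_one, polyBi_X_two]
    linear_combination biVar' K 1 ^ 2 * h2 - biVar K 1 ^ 2 * h2')
  have e56 : p 5 * X 0 + p 6 * X 2 = 0 := cancel _ (by
    rw [map_add, map_mul, map_mul, polyBi_X_zero, polyBi_X_two]
    linear_combination biVar K 0 ^ 2 * h2' - biVar' K 0 ^ 2 * h2)
  -- What remains is `w·p 4 + v·p 5 = 0` and `u·p 5 + w·p 6 = 0`; as `v` is a prime not dividing
  -- `w`, it divides `p 4`, and the cofactor is `q`.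
  obtain ⟨q, hq⟩ : X 1 ∣ p 4 := by
    have hd : X 1 ∣ p 4 * X 2 := ⟨-p 5, by linear_combination e45⟩
    refine ((X_prime (R := K) (i := (1 : Fin 3))).dvd_or_dvd hd).resolve_right fun hX => ?_
    exact absurd ((X_dvd_X (R := K)).1 hX) (by simp)
  have hX1 : (X 1 : MvPolynomial (Fin 3) K) ≠ 0 := X_ne_zero 1
  have hX2 : (X 2 : MvPolynomial (Fin 3) K) ≠ 0 := X_ne_zero 2
  have e5 : p 5 = -(X 2 * q) := by
    refine mul_right_cancel₀ hX1 ?_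
    linear_combination e45 - X 2 * hq
  refine ⟨e0, e1, e2, e3, q, hq, e5, mul_right_cancel₀ hX2 ?_⟩
  linear_combination e56 - X 0 * e5

end Cubic
end

noncomputable section

namespace Cubic

open MvPolynomial

variable {K : Type u} [Field K]

/-! ### The second local cohomology of the Segre product -/

theorem params_ne_zero {θ : K} (hθ : IsPrimitiveRoot θ 3) [IsDomain (A θ)] (i : Fin 3) :
    params θ i ≠ 0 := by
  rw [← polyR_X, Ne, map_eq_zero_iff _ (polyR_injective hθ)]
  exact X_ne_zero i

theorem modComb_mul_params_pow (θ : K) (p : Fin 7 → MvPolynomial (Fin 3) K) (i : Fin 3) (l : ℕ) :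
    modComb θ p * params θ i ^ l = modComb θ ((X i ^ l : MvPolynomial (Fin 3) K) • p) := by
  rw [modComb_smul, map_pow, polyR_X, mul_comm]

/-- The relation between `(sz)²`, `(sz)(tz)` and `(tz)²`. -/
theorem modComb_syzygy (θ : K) (a : MvPolynomial (Fin 3) K) :
    modComb θ ![0, 0, 0, 0, X 1 * a, -(X 2 * a), X 0 * a] = 0 := by
  have h := relation θ
  simp only [Fin.sum_univ_three, relCoeff, params, Matrix.cons_val_zero, Matrix.cons_val_one,
    Matrix.cons_val] at h
  simp only [modComb_eq, map_mul, map_neg, polyR_X, params, Matrix.cons_val_zero,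
    Matrix.cons_val_one, Matrix.cons_val, map_zero]
  linear_combination -polyR θ a * h

/-- The coefficients of the multiples of the relation `η` that describe its class with
denominators `(l+1)`-st powers. -/
def relComb (K : Type u) [Field K] (l : ℕ) : Fin 3 → Fin 7 → MvPolynomial (Fin 3) K :=
  ![![0, 0, 0, 0, 0, 0, -(X 1 * X 2) ^ l], ![0, 0, 0, 0, -(X 0 * X 2) ^ l, 0, 0],
    ![0, 0, 0, 0, 0, (X 0 * X 1) ^ l, 0]]

theorem modComb_relComb (θ : K) (l : ℕ) (k : Fin 3) : modComb θ (relComb K l k) =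
    (![relCoeff θ 0 * (params θ 1 * params θ 2) ^ l, relCoeff θ 1 * (params θ 0 * params θ 2) ^ l,
      relCoeff θ 2 * (params θ 0 * params θ 1) ^ l] : Fin 3 → R θ) k := by
  fin_cases k <;>
  · simp [modComb_eq, relComb, relCoeff, polyR_X]
    ring

theorem modComb_koszul (θ : K) (e : Fin 3 → Fin 7 → MvPolynomial (Fin 3) K)
    (p : Fin 3 → Fin 7 → MvPolynomial (Fin 3) K) (m : ℕ)
    (h : ∀ j, (fun i => p i j) = Cech.koszul X (fun i => e i j) m) (k : Fin 3) :
    modComb θ (p k) = Cech.koszul (params θ) (fun i => modComb θ (e i)) m k := by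
  have hk : ∀ k, p k = fun j => Cech.koszul X (fun i => e i j) m k := fun k =>
    funext fun j => congrFun (h j) k
  rw [hk]
  fin_cases k
  · change modComb θ (fun j => e 2 j * X 1 ^ m - e 1 j * X 2 ^ m) =
      modComb θ (e 2) * params θ 1 ^ m - modComb θ (e 1) * params θ 2 ^ m
    rw [modComb_mul_params_pow, modComb_mul_params_pow, ← modComb_sub]
    congr 1
    funext j
    simp [mul_comm]
  · change modComb θ (fun j => e 0 j * X 2 ^ m - e 2 j * X 0 ^ m) =
      modComb θ (e 0) * params θ 2 ^ m - modComb θ (e 2) * params θ 0 ^ m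
    rw [modComb_mul_params_pow, modComb_mul_params_pow, ← modComb_sub]
    congr 1
    funext j
    simp [mul_comm]
  · change modComb θ (fun j => e 1 j * X 0 ^ m - e 0 j * X 1 ^ m) =
      modComb θ (e 1) * params θ 0 ^ m - modComb θ (e 0) * params θ 1 ^ m
    rw [modComb_mul_params_pow, modComb_mul_params_pow, ← modComb_sub]
    congr 1
    funext j
    simp [mul_comm]

variable [CharZero K] {θ : K}

/-- If `η` vanished, its numerators would be Koszul modulo the syzygies. Summing the coefficients of
`(sz)²` against the powers `X k ^ (l + 1)` kills the Koszul part and would put `(uvw)^l` in the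
ideal of the `(l+1)`-st powers. -/
theorem relationClass_ne_zero (hθ : IsPrimitiveRoot θ 3) [IsDomain (A θ)] :
    Cech.relationClass (params θ) (relCoeff θ) (relation θ) ≠ 0 := by
  intro h0
  have := isDomain_R θ
  obtain ⟨l, e, he⟩ :=
    Cech.exists_koszul_of_relationClass_eq_zero (params_ne_zero hθ) _ _ h0
  choose e' he' using fun i => modComb_surjective θ (e i)
  -- Index `4` is the generator `(sz)²`, whose coefficient in any syzygy is a multiple of `v = X 1`.
  have key : ∀ k, ∃ q, relComb K l k 4 - Cech.koszul X (fun i => e' i 4) (l + 1) k = X 1 * q := by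
    intro k
    have hk : modComb θ (fun j => relComb K l k j -
        Cech.koszul X (fun i => e' i j) (l + 1) k) = 0 := by
      have h1 := modComb_koszul θ e' (fun k j => Cech.koszul X (fun i => e' i j) (l + 1) k) (l + 1)
        (fun _ => rfl) k
      have h2 := modComb_sub θ (relComb K l k)
        (fun j => Cech.koszul X (fun i => e' i j) (l + 1) k)
      rw [h1, modComb_relComb, he, funext he', sub_self] at h2
      exact h2
    obtain ⟨-, -, -, -, q, hq, -⟩ := syzygy_of_modComb_eq_zero hθ hk
    exact ⟨q, hq⟩
  choose q hq using key
  refine prod_X_pow_notMem_span_X_pow (σ := Fin 3) (K := K) l ?_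
  have hX : (X 1 : MvPolynomial (Fin 3) K) ≠ 0 := X_ne_zero 1
  have hsum : (∏ i, X i : MvPolynomial (Fin 3) K) ^ l = ∑ i, -q i * X i ^ (l + 1) := by
    refine mul_left_cancel₀ hX ?_
    have h0 := hq 0
    have h1 := hq 1
    have h2 := hq 2
    simp only [relComb, Cech.koszul, Matrix.cons_val_zero, Matrix.cons_val_one,
      Matrix.cons_val] at h0 h1 h2
    rw [Fin.sum_univ_three, Fin.prod_univ_three]
    linear_combination -(X 0 ^ (l + 1) * h0 + X 1 ^ (l + 1) * h1 + X 2 ^ (l + 1) * h2)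
  rw [hsum]
  exact Ideal.sum_mem _ fun i _ => Ideal.mul_mem_left _ _ (Ideal.subset_span ⟨i, rfl⟩)

/-- The relation given by a cocycle lifts to `K[u,v,w]` up to a multiple `q` of the syzygy. Modulo
the `(l+1)`-st powers `q` is a socle element `c(uvw)^l`; adding `c·η` makes the lift an honest
relation on powers of variables, hence Koszul. -/
theorem exists_eq_smul_relationClass (hθ : IsPrimitiveRoot θ 3) [IsDomain (A θ)]
    (ξ : Cech.H (params θ) 2) : ∃ c : K, ξ =
      algebraMap K (R θ) c • Cech.relationClass (params θ) (relCoeff θ) (relation θ) := by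
  have := isDomain_R θ
  obtain ⟨l, r, hr, rfl, hsum⟩ := Cech.exists_eq_toH_relCochain (params_ne_zero hθ) ξ
  choose p hp using fun i => modComb_surjective θ (r i)
  have hsyz : modComb θ (∑ i, (X i ^ (l + 1) : MvPolynomial (Fin 3) K) • p i) = 0 := by
    rw [Fin.sum_univ_three, modComb_add, modComb_add, ← modComb_mul_params_pow,
      ← modComb_mul_params_pow, ← modComb_mul_params_pow, hp, hp, hp, ← hsum, Fin.sum_univ_three]
  obtain ⟨h0, h1, h2, h3, q, h4, h5, h6⟩ := syzygy_of_modComb_eq_zero hθ hsyz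
  simp only [Finset.sum_apply, Pi.smul_apply, smul_eq_mul] at h0 h1 h2 h3 h4 h5 h6
  -- Each of `uq, vq, wq` is up to sign a coefficient of the lifted relation, so it lies in the
  -- ideal of the `(l+1)`-st powers.
  obtain ⟨c, hc⟩ : ∃ c : K, q - C c * (∏ i, X i) ^ l ∈
      Ideal.span (Set.range fun i => (X i ^ (l + 1) : MvPolynomial (Fin 3) K)) := by
    refine sub_C_mul_mem_span_X_pow fun j => ?_
    have hJ : ∀ j, ∑ i, (X i ^ (l + 1) : MvPolynomial (Fin 3) K) * p i j ∈
        Ideal.span (Set.range fun i => (X i ^ (l + 1) : MvPolynomial (Fin 3) K)) := fun j =>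
      Ideal.sum_mem _ fun i _ => Ideal.mul_mem_right _ _ (Ideal.subset_span ⟨i, rfl⟩)
    fin_cases j
    · change q * X 0 ∈ _
      rw [mul_comm, ← h6]
      exact hJ 6
    · change q * X 1 ∈ _
      rw [mul_comm, ← h4]
      exact hJ 4
    · change q * X 2 ∈ _
      have : q * X 2 = -(∑ i, (X i ^ (l + 1) : MvPolynomial (Fin 3) K) * p i 5) := by
        rw [h5]; ring
      rw [this]
      exact neg_mem (hJ 5)
  obtain ⟨a, ha⟩ := Ideal.mem_span_range_iff_exists_fun.1 hc
  -- Multiples of the syzygy, zero in `R`, that absorb the part of `q` lying in the ideal of the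
  -- `(l+1)`-st powers.
  let s : Fin 3 → Fin 7 → MvPolynomial (Fin 3) K := fun i =>
    ![0, 0, 0, 0, X 1 * a i, -(X 2 * a i), X 0 * a i]
  let p' : Fin 3 → Fin 7 → MvPolynomial (Fin 3) K := fun i =>
    p i + (C c : MvPolynomial (Fin 3) K) • relComb K l i - s i
  have hp' : ∀ j, ∑ i, p' i j * X i ^ (l + 1) = 0 := by
    intro j
    rw [Fin.sum_univ_three] at h0 h1 h2 h3 h4 h5 h6 ha ⊢
    rw [Fin.prod_univ_three] at ha
    simp only [p', Pi.add_apply, Pi.sub_apply, Pi.smul_apply, smul_eq_mul]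
    fin_cases j <;> simp [s, relComb]
    · linear_combination h0
    · linear_combination h1
    · linear_combination h2
    · linear_combination h3
    · linear_combination h4 - X 1 * ha
    · linear_combination h5 + X 2 * ha
    · linear_combination h6 - X 0 * ha
  choose e he using fun j => exists_koszul_eq (fun i => p' i j) (hp' j)
  have hmod : ∀ k, modComb θ (p' k) = r k + algebraMap K (R θ) c * modComb θ (relComb K l k) := by
    intro k
    have hC : polyR θ (C c) = algebraMap K (R θ) c := by
      rw [← MvPolynomial.algebraMap_eq, AlgHom.commutes]
    rw [modComb_sub, modComb_add, modComb_smul, hp, modComb_syzygy, sub_zero, hC]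
  refine ⟨-c, Cech.toH_eq_smul_relationClass r (relCoeff θ) (relation θ) l hr _
    (fun i => modComb θ fun j => e j i) fun k => ?_⟩
  rw [← modComb_koszul θ (fun i j => e j i) p' (l + 1) he k, hmod, modComb_relComb, map_neg]
  ring

end Cubic
end

noncomputable section

theorem FaithfulSMul.of_isFractionRing_of_isScalarTower (S F L : Type*) [CommRing S] [Field F]
    [Algebra S F] [IsFractionRing S F] [Field L] [Algebra F L] [Algebra S L]
    [IsScalarTower S F L] : FaithfulSMul S L := by
  rw [faithfulSMul_iff_algebraMap_injective, IsScalarTower.algebraMap_eq S F L]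
  exact (algebraMap F L).injective.comp (IsFractionRing.injective S F)

namespace Cubic

open MvPolynomial

variable {K : Type u} [Field K]

/-! ### The embedding of `A` in `R` -/

/-- The embedding `A → R` that sends `a` to `a ⊗ sᵐ` for `a` of degree `m`. -/
def embR (θ : K) : A θ →ₐ[K] R θ :=
  liftA (fun i => mon θ i 0) (by linear_combination mon_cubic θ 0 0 0)

theorem embR_gen (θ : K) (i : Fin 3) : embR θ (gen θ i) = mon θ i 0 := liftA_gen _ _ i

theorem inclR_embR (θ : K) {m : ℕ} {a : A θ} (ha : a ∈ grA θ m) :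
    inclR θ (embR θ a) = a ⊗ₜ (X 0 ^ m) := by
  induction m generalizing a with
  | zero =>
    obtain ⟨c, rfl⟩ := exists_smul_one_of_mem_grA_zero θ ha
    rw [map_smul, map_one, map_smul, map_one, pow_zero, ← TensorProduct.smul_tmul',
      Algebra.TensorProduct.one_def]
  | succ m ih =>
    have hle : grA θ (m + 1) ≤ LinearMap.eqLocus
        ((inclR θ).toLinearMap.comp (embR θ).toLinearMap)
        ((TensorProduct.mk K (A θ) (MvPolynomial (Fin 2) K)).flip (X 0 ^ (m + 1))) := by
      refine grA_succ_le θ fun i b hb => ?_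
      change inclR θ (embR θ (gen θ i * b)) = (gen θ i * b) ⊗ₜ (X 0 ^ (m + 1))
      rw [map_mul, map_mul, ih hb, embR_gen, mon, inclR_tens,
        Algebra.TensorProduct.tmul_mul_tmul, pow_succ']
    exact hle ha

theorem embR_eq_tens (θ : K) {m : ℕ} {a : A θ} (ha : a ∈ grA θ m) :
    embR θ a = tens ha (s_pow_mem m) :=
  inclR_injective θ ((inclR_embR θ ha).trans (inclR_tens ha (s_pow_mem m)).symm)

theorem embR_injective (θ : K) : Function.Injective (embR θ) := by
  have : (evalR θ ![1, 0]).comp (embR θ) = AlgHom.id K (A θ) := by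
    refine algHom_ext_gen fun i => ?_
    rw [AlgHom.comp_apply, embR_gen, evalR_mon, Matrix.cons_val_zero, map_one, mul_one]
    rfl
  exact Function.LeftInverse.injective (g := evalR θ ![1, 0]) (DFunLike.congr_fun this)

theorem embR_mem_grR (θ : K) {m : ℕ} {a : A θ} (ha : a ∈ grA θ m) : embR θ a ∈ grR θ m := by
  rw [embR_eq_tens θ ha]
  exact Submodule.subset_span ⟨_, ha, _, s_pow_mem m, rfl⟩

/-- The quotient `tx / sx` is `t/s`, and `a ⊗ sᵏ` times `(t/s)ⁱ` is `a ⊗ s^(k-i) tⁱ`, an element of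
`R` as long as `i ≤ k`. -/
theorem exists_mul_mon_pow_eq (θ : K) {k i : ℕ} (hik : i ≤ k) {a : A θ} (ha : a ∈ grA θ k) :
    ∃ d : R θ, d * mon θ 0 0 ^ i = embR θ a * mon θ 0 1 ^ i := by
  have hb : (X 0 ^ (k - i) * X 1 ^ i : MvPolynomial (Fin 2) K) ∈ grB K k := by
    have h := (isHomogeneous_X_pow (R := K) (0 : Fin 2) (k - i)).mul
      (isHomogeneous_X_pow (R := K) (1 : Fin 2) i)
    rwa [Nat.sub_add_cancel hik] at h
  refine ⟨tens ha hb, inclR_injective θ ?_⟩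
  rw [map_mul, map_mul, map_pow, map_pow, inclR_embR θ ha, inclR_tens, mon, mon, inclR_tens,
    inclR_tens, Algebra.TensorProduct.tmul_pow, Algebra.TensorProduct.tmul_pow,
    Algebra.TensorProduct.tmul_mul_tmul, Algebra.TensorProduct.tmul_mul_tmul, mul_right_comm,
    ← pow_add, Nat.sub_add_cancel hik]

variable {θ : K}

/-! ### Annihilators -/

theorem IsCubing.smul_map_topClass_eq_zero {ζ : K} {φ : A θ →ₐ[K] A θ} (h : IsCubing ζ φ) (n k : ℕ) {a : A θ}
    (ha : a ∈ grA θ (2 * k)) {u : A θ} (hu : u ∈ positiveIdeal (grA θ)) :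
    u • Cech.map (φ ^ n).toRingHom (xy θ) 2 (Cech.topClass (xy θ) a k) = 0 := by
  obtain ⟨α, β, hαβ⟩ := h.exists_eq_add n k ha hu
  exact Cech.smul_map_topClass_eq_zero _ _ _ _ _ α β hαβ

theorem IsTower.smul_map_topClass_eq_zero {ζ : K} {φ : A θ →ₐ[K] A θ} (h : IsCubing ζ φ)
    {T : Type w} [CommRing T] [Algebra (A θ) T] {ρ : ℕ → A θ →+* T} (hρ : IsTower φ (grA θ) ρ)
    (hρ0 : ρ 0 = algebraMap (A θ) T) (n k : ℕ) {a : A θ}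
    (ha : a ∈ grA θ (2 * k)) {u : A θ} (hu : u ∈ positiveIdeal (grA θ)) :
    ρ n u • Cech.map (algebraMap (A θ) T) (xy θ) 2 (Cech.topClass (xy θ) a k) = 0 := by
  obtain ⟨α, β, hαβ⟩ := h.exists_eq_add n k ha hu
  have key := congrArg (ρ n) hαβ
  simp only [map_mul, map_add, map_pow, hρ.apply_pow, hρ0] at key
  exact Cech.smul_map_topClass_eq_zero _ _ _ _ _ (ρ n α) (ρ n β) key

section

variable {ζ : K} {φ : A θ →ₐ[K] A θ} {L : Type w} [Field L] [Algebra (R θ) L]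
  [FaithfulSMul (R θ) L] {ρ : ℕ → A θ →+* integralClosure (R θ) L}

theorem algebraMap_integralClosure_mon_ne_zero (hθ : IsPrimitiveRoot θ 3) (i : Fin 3)
    (j : Fin 2) : algebraMap (R θ) (integralClosure (R θ) L) (mon θ i j) ≠ 0 := by
  intro h
  refine mon_ne_zero hθ i j (FaithfulSMul.algebraMap_injective (R θ) L ?_)
  rw [map_zero]
  exact congrArg Subtype.val h

/-- The fraction `t/s` multiplies elements of degree at least one of the tower into `R⁺`. -/
theorem IsTower.exists_mul_eq (hθ : IsPrimitiveRoot θ 3) [IsDomain (A θ)] (h : IsCubing ζ φ)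
    (hρ : IsTower φ (grR θ) ρ)
    (hρ0 : ρ 0 = (algebraMap (R θ) (integralClosure (R θ) L)).comp (embR θ).toRingHom)
    {n m : ℕ} (hm : 3 ^ n ≤ m) {a : A θ} (ha : a ∈ grA θ m) :
    ∃ b : integralClosure (R θ) L, b * algebraMap (R θ) _ (mon θ 0 0) =
      ρ n a * algebraMap (R θ) _ (mon θ 0 1) := by
  have := isDomain_R θ
  have h00 : algebraMap (R θ) L (mon θ 0 0) ≠ 0 := fun h0 =>
    mon_ne_zero hθ 0 0 (FaithfulSMul.algebraMap_injective (R θ) L (h0.trans (map_zero _).symm))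
  set w : L := algebraMap (R θ) L (mon θ 0 1) / algebraMap (R θ) L (mon θ 0 0) with hw
  have hpos : 0 < 3 ^ n := pow_pos (by norm_num) n
  obtain ⟨N, c, hc0, hc, hsum⟩ := exists_homogeneous_equation hpos
    (h.pow_isIntegral n) (fun i => by simpa using h.pow_mem n (gen_mem θ i)) ha
  have hsum' := congrArg (fun b => (ρ n b : L)) hsum
  simp only [map_sum, map_mul, map_pow, hρ.apply_pow, map_zero, AddSubmonoidClass.coe_finsetSum,
    MulMemClass.coe_mul, SubmonoidClass.coe_pow, ZeroMemClass.coe_zero] at hsum'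
  have hint : IsIntegral (R θ) ((ρ n a : L) * w) := by
    refine isIntegral_mul_of_sum_eq_zero N (fun i => (ρ 0 (c i) : L)) _ w ?_ hsum' fun i => ?_
    · simp only [hc0, map_one, OneMemClass.coe_one]
    · rcases hc i with hi | ⟨k, hk, hi⟩
      · refine ⟨0, ?_⟩
        simp only [hi, map_zero, ZeroMemClass.coe_zero, zero_mul]
      · have hik : i ≤ k := by
          refine Nat.le_of_mul_le_mul_right ?_ hpos
          rw [hk]
          exact Nat.mul_le_mul_left i hm
        obtain ⟨d, hd⟩ := exists_mul_mon_pow_eq θ hik hi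
        refine ⟨d, ?_⟩
        have e : (ρ 0 (c i) : L) = algebraMap (R θ) L (embR θ (c i)) := by
          rw [hρ0]
          rfl
        have hd' := congrArg (algebraMap (R θ) L) hd
        rw [map_mul, map_mul, map_pow, map_pow] at hd'
        rw [e, hw, div_pow, mul_div_assoc', eq_div_iff (pow_ne_zero i h00), hd']
  refine ⟨⟨(ρ n a : L) * w, hint⟩, Subtype.ext ?_⟩
  change (ρ n a : L) * w * algebraMap (R θ) L (mon θ 0 0) =
    (ρ n a : L) * algebraMap (R θ) L (mon θ 0 1)
  rw [mul_assoc, hw, div_mul_cancel₀ _ h00]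

/-- Take the identity `u φⁿ(z²) = α φⁿ(x) + β φⁿ(y)` with `α, β` of degree `m + 3ⁿ ≥ 3ⁿ`, apply `ρ
n`, and multiply by `t/s` once and twice. The products `α' = α t/s` and `β' = β t/s` stay in the
integral closure. -/
theorem IsTower.smul_map_relationClass_eq_zero (hθ : IsPrimitiveRoot θ 3) [IsDomain (A θ)]
    (h : IsCubing ζ φ) (hρ : IsTower φ (grR θ) ρ)
    (hρ0 : ρ 0 = (algebraMap (R θ) (integralClosure (R θ) L)).comp (embR θ).toRingHom)
    (n : ℕ) {m : ℕ} (hm : 0 < m) {u : A θ} (hu : u ∈ grA θ m) :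
    ρ n u • Cech.map (algebraMap (R θ) (integralClosure (R θ) L)) (params θ) 2
      (Cech.relationClass (params θ) (relCoeff θ) (relation θ)) = 0 := by
  have hz : gen θ 2 ^ 2 ∈ grA θ 2 := by
    have := SetLike.pow_mem_graded 2 (gen_mem θ 2)
    simpa using this
  obtain ⟨α, hα, β, hβ, hαβ⟩ := h.exists_eq_add_homogeneous n hz hm hu
  have hle : 3 ^ n ≤ m + 3 ^ n := Nat.le_add_left _ _
  obtain ⟨α', hα'⟩ := hρ.exists_mul_eq hθ h hρ0 hle hα
  obtain ⟨β', hβ'⟩ := hρ.exists_mul_eq hθ h hρ0 hle hβ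
  have h0 : ∀ a, ρ 0 a = algebraMap (R θ) (integralClosure (R θ) L) (embR θ a) := fun a => by
    rw [hρ0]
    rfl
  have key := congrArg (ρ n) hαβ
  simp only [map_mul, map_add, hρ.apply_pow, h0, map_pow, embR_gen] at key
  have hmon : ∀ i i' j j', algebraMap (R θ) (integralClosure (R θ) L) (mon θ i j) *
      algebraMap (R θ) _ (mon θ i' j') = algebraMap (R θ) _ (mon θ i j') *
      algebraMap (R θ) _ (mon θ i' j) := fun i i' j j' => by
    rw [← map_mul, mon_mul_mon, map_mul]
  have hsx := algebraMap_integralClosure_mon_ne_zero (L := L) hθ 0 0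
  have r1 := hmon 1 0 0 1
  have r2 := hmon 2 0 0 1
  set g := algebraMap (R θ) (integralClosure (R θ) L)
  refine Cech.smul_map_relationClass_eq_zero _ _ _ _ _
    -- Writing `u, α, β` for their images under `ρ n`, these entries make the Koszul relation yield
    -- `-u(tz)²`, `-u(sz)²` and `u(sz)(tz)`, by `α'·sy = α·ty` and `β'·sx = β·tx`.
    (![-(ρ n β), α', ρ n α - β'] : Fin 3 → integralClosure (R θ) L) fun k => ?_
  fin_cases k
  · change ρ n u * g (-(mon θ 2 1) ^ 2) = (ρ n α - β') * g (mon θ 1 1) ^ 1 -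
      α' * g (mon θ 1 0 + mon θ 0 1) ^ 1
    rw [map_neg, map_pow, map_add]
    -- The factor `(sx)²` clears the two divisions by `s` hidden in `α'` and `β'`.
    refine mul_left_cancel₀ (pow_ne_zero 2 hsx) ?_
    linear_combination ρ n u * (g (mon θ 2 0) * g (mon θ 0 1) + g (mon θ 2 1) * g (mon θ 0 0)) * r2 -
      g (mon θ 0 1) ^ 2 * key + g (mon θ 0 0) * (g (mon θ 0 1) + g (mon θ 1 0)) * hα' +
      (g (mon θ 0 0) * ρ n α - ρ n β * g (mon θ 0 1)) * r1 + g (mon θ 0 0) * g (mon θ 1 1) * hβ'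
  · change ρ n u * g (-(mon θ 2 0) ^ 2) = -(ρ n β) * g (mon θ 1 0 + mon θ 0 1) ^ 1 -
      (ρ n α - β') * g (mon θ 0 0) ^ 1
    rw [map_neg, map_pow, map_add]
    linear_combination -key - hβ'
  · change ρ n u * g (mon θ 2 0 * mon θ 2 1) = α' * g (mon θ 0 0) ^ 1 -
      -(ρ n β) * g (mon θ 1 1) ^ 1
    rw [map_mul]
    refine mul_left_cancel₀ hsx ?_
    linear_combination -ρ n u * g (mon θ 2 0) * r2 + g (mon θ 0 1) * key - g (mon θ 0 0) * hα' + ρ n β * r1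

theorem IsTower.smul_map_eq_zero [CharZero K] (hθ : IsPrimitiveRoot θ 3) [IsDomain (A θ)]
    (h : IsCubing ζ φ) (hρ : IsTower φ (grR θ) ρ)
    (hρ0 : ρ 0 = (algebraMap (R θ) (integralClosure (R θ) L)).comp (embR θ).toRingHom)
    (n : ℕ) {u : A θ} (hu : u ∈ positiveIdeal (grA θ)) (ξ : Cech.H (params θ) 2) :
    ρ n u • Cech.map (algebraMap (R θ) (integralClosure (R θ) L)) (params θ) 2 ξ = 0 := by
  obtain ⟨c, rfl⟩ := exists_eq_smul_relationClass hθ ξ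
  rw [map_smulₛₗ, smul_comm]
  suffices hs : ρ n u • Cech.map (algebraMap (R θ) (integralClosure (R θ) L)) (params θ) 2
      (Cech.relationClass (params θ) (relCoeff θ) (relation θ)) = 0 by
    rw [hs, smul_zero]
  induction hu using Submodule.span_induction with
  | mem u hu =>
    obtain ⟨m, hm, hu⟩ := hu
    exact hρ.smul_map_relationClass_eq_zero hθ h hρ0 n hm hu
  | zero => rw [map_zero, zero_smul]
  | add u u' _ _ hu hu' => rw [map_add, add_smul, hu, hu', add_zero]
  | smul a u _ hu => rw [smul_eq_mul, map_mul, mul_smul, hu, smul_zero]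

end

end Cubic
end

/-! ### The main theorem -/

open Cubic in
theorem mainTheorem6 {K : Type u} [Field K] [IsAlgClosed K] [CharZero K]
    (θ : K) (hθ : IsPrimitiveRoot θ 3) :
    IsDomain (A θ) ∧
    -- `R` is a normal domain of dimension three
    IsDomain (R θ) ∧ IsIntegrallyClosed (R θ) ∧ ringKrullDim (R θ) = 3 ∧
    -- `sx`, `ty`, `sy + tx` is a homogeneous system of parameters
    (positiveIdeal (grR θ)).IsMaximal ∧
    (∀ i, params θ i ∈ grR θ 1) ∧
    (Ideal.span (Set.range (params θ))).radical = positiveIdeal (grR θ) ∧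
    -- the second local cohomology is the `K`-line spanned by the class of the relation
    Cech.relationClass (params θ) (relCoeff θ) (relation θ) ≠ 0 ∧
    (∀ ξ : Cech.H (params θ) 2, ∃ c : K, ξ =
      algebraMap K (R θ) c • Cech.relationClass (params θ) (relCoeff θ) (relation θ)) ∧
    -- for every choice of a cube root of `θ`, the self-embedding `φ` of `A`
    ∀ ζ : K, ζ ^ 3 = θ → ∃ φ : A θ →ₐ[K] A θ,
      Function.Injective φ ∧ φ.toRingHom.Finite ∧
      gen θ 0 ^ 3 = ζ • φ (gen θ 0) + ζ ^ 2 • φ (gen θ 1) ∧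
      gen θ 1 ^ 3 = ζ • φ (gen θ 0) + ζ ^ 5 • φ (gen θ 1) ∧
      gen θ 2 ^ 3 = ζ • φ (gen θ 0) + ζ ^ 8 • φ (gen θ 1) ∧
      φ (gen θ 2) = -(gen θ 0 * gen θ 1 * gen θ 2) ∧
      (∀ m, ∀ a ∈ grA θ m, φ a ∈ grA θ (3 * m)) ∧
      -- the positive degree elements of the `n`-th ring of the tower kill the image of the
      -- degree zero part of the second local cohomology of `A`
      (∀ n k : ℕ, ∀ a ∈ grA θ (2 * k), ∀ u ∈ positiveIdeal (grA θ),
        u • Cech.map (φ ^ n).toRingHom (xy θ) 2 (Cech.topClass (xy θ) a k) = 0) ∧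
      -- the tower inside the absolute integral closure of `A`
      (∀ (F : Type v) [Field F] [Algebra (A θ) F] [IsFractionRing (A θ) F]
        (L : Type w) [Field L] [Algebra F L] [IsAlgClosure F L] [Algebra (A θ) L]
        [IsScalarTower (A θ) F L],
        ∃ ρ : ℕ → A θ →+* integralClosure (A θ) L,
          IsTower φ (grA θ) ρ ∧ ρ 0 = algebraMap (A θ) (integralClosure (A θ) L) ∧
          ∀ n k : ℕ, ∀ a ∈ grA θ (2 * k), ∀ u ∈ positiveIdeal (grA θ),
            ρ n u • Cech.map (algebraMap (A θ) (integralClosure (A θ) L)) (xy θ) 2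
              (Cech.topClass (xy θ) a k) = 0) ∧
      -- the tower inside the absolute integral closure of `R`, starting from the embedding
      -- `a ↦ a sᵐ` (`a` of degree `m`) of `A` into `R`, and the annihilators it provides
      (∀ (F : Type v) [Field F] [Algebra (R θ) F] [IsFractionRing (R θ) F]
        (L : Type w) [Field L] [Algebra F L] [IsAlgClosure F L] [Algebra (R θ) L]
        [IsScalarTower (R θ) F L],
        ∃ ρ : ℕ → A θ →+* integralClosure (R θ) L,
          IsTower φ (grR θ) ρ ∧
          (∀ (m : ℕ) (a : A θ) (ha : a ∈ grA θ m), ρ 0 a =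
            algebraMap (R θ) (integralClosure (R θ) L) (tens ha (s_pow_mem m))) ∧
          (∀ n, ∀ u ∈ positiveIdeal (grA θ), ∀ ξ : Cech.H (params θ) 2,
            ρ n u • Cech.map (algebraMap (R θ) (integralClosure (R θ) L)) (params θ) 2 ξ = 0) ∧
          -- in particular `xₙ`, `yₙ`, `zₙ` are nonzero annihilators of degree `1 / 3ⁿ`
          ∀ (n : ℕ) (i : Fin 3),
            ρ n (gen θ i) ≠ 0 ∧ HasDegree (grR θ) (ρ n (gen θ i)) (1 / 3 ^ n) ∧
            ∀ ξ : Cech.H (params θ) 2, ρ n (gen θ i) •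
              Cech.map (algebraMap (R θ) (integralClosure (R θ) L)) (params θ) 2 ξ = 0) := by
  have hA : IsDomain (A θ) := isDomain_A (hθ.ne_zero (by norm_num))
  have hAi : IsIntegrallyClosed (A θ) := isIntegrallyClosed_A hθ
  have hp : ∀ i, params θ i ∈ grR θ 1 := by
    intro i
    fin_cases i
    exacts [mon_mem θ 0 0, mon_mem θ 1 1, add_mem (mon_mem θ 1 0) (mon_mem θ 0 1)]
  refine ⟨hA, isDomain_R θ, isIntegrallyClosed_R θ, ringKrullDim_R hθ, isMaximal_positiveIdeal hθ,
    hp, radical_params hθ, relationClass_ne_zero hθ, exists_eq_smul_relationClass hθ,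
    fun ζ hζ => ?_⟩
  obtain ⟨φ, h⟩ := exists_isCubing hθ hζ
  refine ⟨φ, h.injective hθ, h.finite, h.gen_zero, h.gen_one, h.gen_two, h.apply_two,
    fun m a ha => map_mem_grA h.mem ha, fun n k a ha u hu => h.smul_map_topClass_eq_zero n k ha hu,
    ?_, ?_⟩
  · intro F _ _ _ L _ _ _ _ _
    have := IsAlgClosure.isAlgClosed F (K := L)
    have := FaithfulSMul.of_isFractionRing_of_isScalarTower (A θ) F L
    obtain ⟨ρ, hρ, hρ0⟩ := h.exists_isTower hθ (grA θ) (RingHom.id (A θ))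
      Function.injective_id (fun m a ha => ha) (L := L)
    rw [RingHom.comp_id] at hρ0
    exact ⟨ρ, hρ, hρ0, fun n k a ha u hu => hρ.smul_map_topClass_eq_zero h hρ0 n k ha hu⟩
  · intro F _ _ _ L _ _ _ _ _
    have := IsAlgClosure.isAlgClosed F (K := L)
    have := FaithfulSMul.of_isFractionRing_of_isScalarTower (R θ) F L
    obtain ⟨ρ, hρ, hρ0⟩ := h.exists_isTower hθ (grR θ) (embR θ).toRingHom
      (embR_injective θ) (fun m a ha => embR_mem_grR θ ha) (L := L)
    have hann := fun n u hu ξ => hρ.smul_map_eq_zero hθ h hρ0 n (u := u) hu ξ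
    refine ⟨ρ, hρ, fun m a ha => ?_, hann, fun n i => ⟨?_, ?_, ?_⟩⟩
    · rw [hρ0, ← embR_eq_tens θ ha]
      rfl
    · exact (map_ne_zero_iff _ (hρ.injective n)).2 (gen_ne_zero hθ i)
    · have := hρ.degree n 1 _ (gen_mem θ i)
      rwa [Nat.cast_one] at this
    · exact hann n _ (Ideal.subset_span ⟨1, one_pos, gen_mem θ i⟩)
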